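/- Fix a finite set $\mathcal F$ (of faces, or colors). Algebras are complex and associative, not necessarily unital. A multi-faced algebra is an algebra $A$ that is freely generated by given subalgebras $A^c$, $c\in\mathcal F$ (its faces). A multi-faced homomorphism is an algebra homomorphism that maps each face into the face of the same color. The free product $A\sqcup B$ of multi-faced algebras has the faces $(A\sqcup B)^c=A^c\sqcup B^c$. A multi-faced universal product $\odot$ associates with linear functionals $\varphi_1,\varphi_2$ on multi-faced algebras $A_1,A_2$ a linear functional $\varphi_1\odot\varphi_2$ on $A_1\sqcup A_2$ such that $(\varphi_1\circ h_1)\odot(\varphi_2\circ h_2)=(\varphi_1\odot\varphi_2)\circ(h_1\sqcup h_2)$ for all multi-faced homomorphisms $h_1,h_2$, such that $\odot$ is associative, and such that $\varphi_1\odot\varphi_2$ restricts to $\varphi_i$ on $A_i$. It is symmetric if $\varphi_1\odot\varphi_2=\varphi_2\odot\varphi_1$. It is positive if, on multi-faced $*$-algebras (each face being a $*$-subalgebra), the product of two restricted states is a restricted state; here a restricted state is a linear functional whose unital extension to the unitization is a state. Let $\odot$ be a positive symmetric multi-faced universal product. **Highest coefficients.** For a word $\mathbf f\in\mathcal F^n$,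 $n\ge 1$, let $\mathcal P(\mathbf f)$ be the set of set partitions of $[n]$, where each $\ell\in[n]$ carries the color $\mathbf f(\ell)$; let $\mathcal P$ be the union of the $\mathcal P(\mathbf f)$ over all such words. For $k,n\ge1$ and $\mathbf s=(\mathbf b,\mathbf f)\in([k]\times\mathcal F)^n$, a set partition $\pi$ of $[n]$ is adapted to $\mathbf s$, written $\pi\prec\mathbf s$, if $\mathbf b$ is constant on each block of $\pi$, and if $i,i+1$ lie in the same block whenever $\mathbf s(i)=\mathbf s(i+1)$. There are complex coefficients $\alpha^\pi_{\mathbf s}$ ($\pi\prec\mathbf s$) such that, for all linear functionals $\varphi_\kappa$ on multi-faced algebras $A_\kappa$ ($\kappa\in[k]$) and all $a_\ell\in A_{\mathbf b(\ell)}^{\mathbf f(\ell)}$, $$(\varphi_1\odot\cdots\odot\varphi_k)(a_1\cdots a_n)=\sum_{\pi\prec\mathbf s}\alpha^\pi_{\mathbf s}\prod_{\kappa\in[k]}\ \prod_{\beta\in\pi,\ \mathbf b|_\beta=\kappa}\varphi_\kappa\Bigl(\overrightarrow{\prod_{\ell\in\beta}}a_\ell\Bigr),$$ where the product over $\ell\in\beta$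 is taken in increasing order of $\ell$. The highest coefficient of $\pi\in\mathcal P(\mathbf f)$ is $\alpha_\pi:=\alpha^{\pi}_{\mathbf s}$, where $\beta_1,\dots,\beta_k$ is any enumeration of the blocks of $\pi$ and $\mathbf s(\ell)=(\kappa,\mathbf f(\ell))$ for $\ell\in\beta_\kappa$. The family $(\alpha_\pi)_{\pi\in\mathcal P}$ exists, does not depend on the enumeration of the blocks, and is uniquely determined by $\odot$. **Nesting coefficients.** For $c\in\mathcal F$, let $\nu_c:=\alpha_\pi$ for $\pi=\{\{1,3\},\{2\}\}$ where the leg $2$ has color $c$; this does not depend on the colors of the legs $1$ and $3$. **Theorem.** The following are equivalent. 1. $\odot$ is unit preserving: whenever $A_1,A_2$ are multi-faced algebras all of whose faces are unital, with units $1_i^c\in A_i^c$, and each $\varphi_i$ is a linear functional on $A_i$ that vanishes on the two-sided ideal of $A_i$ generated by $\{1_i^c-1_i^d: c,d\in\mathcal F\}$ and satisfies $\varphi_i(1_i^c)=1$ for all $c\in\mathcal F$, then $\varphi_1\odot\varphi_2$ vanishes on the two-sided ideal of $A_1\sqcup A_2$ generated by $\{1_i^c-1_j^d: i,j\in\{1,2\},\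 c,d\in\mathcal F\}$, and $(\varphi_1\odot\varphi_2)(1_i^c)=1$ for all $i\in\{1,2\}$, $c\in\mathcal F$. 2. $\nu_c=1$ for every $c\in\mathcal F$. 3. The highest coefficients are singleton inductive: $\alpha_\pi=\alpha_{\pi\setminus\{s\}}$ for every $\pi\in\mathcal P$ on at least two legs and every singleton block $\{s\}$ of $\pi$, where $\pi\setminus\{s\}$ denotes the partition of the remaining colored legs. -/

import Mathlib

open scoped ComplexOrder

set_option linter.unusedSectionVars false

universe u v

noncomputable section

/-! ### The free product of two complex, associative, not necessarily unital algebras -/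

section FreeProduct

variable (A B : Type u)
  [NonUnitalRing A] [Module ℂ A] [IsScalarTower ℂ A A] [SMulCommClass ℂ A A]
  [NonUnitalRing B] [Module ℂ B] [IsScalarTower ℂ B B] [SMulCommClass ℂ B B]

/-- The relations which make the two linear inclusions of `A` and `B` into the tensor algebra over
`A × B` multiplicative. -/
inductive FreeProdRel : TensorAlgebra ℂ (A × B) → TensorAlgebra ℂ (A × B) → Prop
  | left (a a' : A) : FreeProdRel
      (TensorAlgebra.ι ℂ (a, (0 : B)) * TensorAlgebra.ι ℂ (a', (0 : B)))
      (TensorAlgebra.ι ℂ (a * a', (0 : B)))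
  | right (b b' : B) : FreeProdRel
      (TensorAlgebra.ι ℂ ((0 : A), b) * TensorAlgebra.ι ℂ ((0 : A), b'))
      (TensorAlgebra.ι ℂ ((0 : A), b * b'))

/-- The universal unital algebra receiving (non-unital) homomorphisms from `A` and `B`, that is,
the unitization of the free product. -/
abbrev FreeProdUnital : Type u := RingQuot (FreeProdRel A B)

/-- The inclusion of `A` into the unitized free product. -/
def FreeProdUnital.inl : A →ₙₐ[ℂ] FreeProdUnital A B where
  toFun a := RingQuot.mkAlgHom ℂ (FreeProdRel A B) (TensorAlgebra.ι ℂ (a, (0 : B)))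
  map_smul' z a := by
    rw [show ((z • a, (0 : B)) : A × B) = z • (a, (0 : B)) by simp]
    rw [map_smul, map_smul]; rfl
  map_zero' := by
    rw [show (((0 : A), (0 : B)) : A × B) = 0 from rfl]
    rw [map_zero, map_zero]
  map_add' a a' := by
    rw [show ((a + a', (0 : B)) : A × B) = (a, 0) + (a', 0) by simp]
    rw [map_add, map_add]
  map_mul' a a' := by
    rw [← map_mul]
    exact (RingQuot.mkAlgHom_rel ℂ (FreeProdRel.left a a')).symm

/-- The inclusion of `B` into the unitized free product. -/
def FreeProdUnital.inr : B →ₙₐ[ℂ] FreeProdUnital A B where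
  toFun b := RingQuot.mkAlgHom ℂ (FreeProdRel A B) (TensorAlgebra.ι ℂ ((0 : A), b))
  map_smul' z b := by
    rw [show (((0 : A), z • b) : A × B) = z • ((0 : A), b) by simp]
    rw [map_smul, map_smul]; rfl
  map_zero' := by
    rw [show (((0 : A), (0 : B)) : A × B) = 0 from rfl]
    rw [map_zero, map_zero]
  map_add' b b' := by
    rw [show (((0 : A), b + b') : A × B) = (0, b) + (0, b') by simp]
    rw [map_add, map_add]
  map_mul' b b' := by
    rw [← map_mul]
    exact (RingQuot.mkAlgHom_rel ℂ (FreeProdRel.right b b')).symm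

/-- The free product `A ⊔ B` of non-unital algebras: the non-unital subalgebra generated by
`A` and `B` in its unitization. -/
def freeProdSubalgebra : NonUnitalSubalgebra ℂ (FreeProdUnital A B) :=
  NonUnitalAlgebra.adjoin ℂ
    (Set.range (FreeProdUnital.inl A B) ∪ Set.range (FreeProdUnital.inr A B))

/-- The free product `A ⊔ B` as a type. -/
def FreeProd : Type u := freeProdSubalgebra A B

instance : NonUnitalRing (FreeProd A B) :=
  inferInstanceAs (NonUnitalRing (freeProdSubalgebra A B))

instance : Module ℂ (FreeProd A B) :=
  inferInstanceAs (Module ℂ (freeProdSubalgebra A B))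

instance : IsScalarTower ℂ (FreeProd A B) (FreeProd A B) :=
  inferInstanceAs (IsScalarTower ℂ (freeProdSubalgebra A B) (freeProdSubalgebra A B))

instance : SMulCommClass ℂ (FreeProd A B) (FreeProd A B) :=
  inferInstanceAs (SMulCommClass ℂ (freeProdSubalgebra A B) (freeProdSubalgebra A B))

variable {A B}

namespace FreeProd

/-- The inclusion of the free product into its unitization. -/
def val : FreeProd A B →ₙₐ[ℂ] FreeProdUnital A B :=
  NonUnitalSubalgebraClass.subtype (freeProdSubalgebra A B)

/-- The inclusion `A → A ⊔ B`. -/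
def inl : A →ₙₐ[ℂ] FreeProd A B :=
  NonUnitalAlgHom.codRestrict (FreeProdUnital.inl A B) (freeProdSubalgebra A B) fun a =>
    NonUnitalAlgebra.subset_adjoin ℂ (Or.inl ⟨a, rfl⟩)

/-- The inclusion `B → A ⊔ B`. -/
def inr : B →ₙₐ[ℂ] FreeProd A B :=
  NonUnitalAlgHom.codRestrict (FreeProdUnital.inr A B) (freeProdSubalgebra A B) fun b =>
    NonUnitalAlgebra.subset_adjoin ℂ (Or.inr ⟨b, rfl⟩)

/-- `A ⊔ B` is generated by `A` and `B`. -/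
theorem induction {p : FreeProd A B → Prop}
    (hl : ∀ a, p (inl a)) (hr : ∀ b, p (inr b))
    (hadd : ∀ x y, p x → p y → p (x + y)) (hmul : ∀ x y, p x → p y → p (x * y))
    (hsmul : ∀ (z : ℂ) x, p x → p (z • x)) (x : FreeProd A B) : p x := by
  obtain ⟨x, hx⟩ := x
  induction hx using NonUnitalAlgebra.adjoin_induction with
  | mem x hx =>
    rcases hx with ⟨a, rfl⟩ | ⟨b, rfl⟩
    · exact hl a
    · exact hr b
  | add x y hx hy ihx ihy => exact hadd _ _ ihx ihy
  | zero =>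
    have h := hl 0
    rw [map_zero] at h
    exact h
  | mul x y hx hy ihx ihy => exact hmul _ _ ihx ihy
  | smul r x hx ih => exact hsmul r _ ih

variable {C : Type*} [NonUnitalRing C] [Module ℂ C] [IsScalarTower ℂ C C] [SMulCommClass ℂ C C]

/-- Homomorphisms out of `A ⊔ B` are determined on `A` and `B`. -/
theorem hom_ext {f g : FreeProd A B →ₙₐ[ℂ] C} (hl : ∀ a, f (inl a) = g (inl a))
    (hr : ∀ b, f (inr b) = g (inr b)) : f = g := by
  ext x
  induction x using FreeProd.induction with
  | hl a => exact hl a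
  | hr b => exact hr b
  | hadd x y hx hy => rw [map_add, map_add, hx, hy]
  | hmul x y hx hy => rw [map_mul, map_mul, hx, hy]
  | hsmul z x hx => rw [map_smul, map_smul, hx]

/-- Auxiliary: the extension of two homomorphisms to the unitized free product. -/
def liftUnital (f : A →ₙₐ[ℂ] C) (g : B →ₙₐ[ℂ] C) :
    FreeProdUnital A B →ₐ[ℂ] Unitization ℂ C :=
  RingQuot.liftAlgHom ℂ ⟨TensorAlgebra.lift ℂ
    ((Unitization.inrHom ℂ ℂ C).comp
      ((f : A →ₗ[ℂ] C).coprod (g : B →ₗ[ℂ] C))), by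
    intro x y h
    induction h with
    | left a a' => simp
    | right b b' => simp⟩

theorem liftUnital_inl (f : A →ₙₐ[ℂ] C) (g : B →ₙₐ[ℂ] C) (a : A) :
    liftUnital f g (val (inl a)) = (f a : Unitization ℂ C) := by
  change liftUnital f g (FreeProdUnital.inl A B a) = _
  simp [liftUnital, FreeProdUnital.inl]

theorem liftUnital_inr (f : A →ₙₐ[ℂ] C) (g : B →ₙₐ[ℂ] C) (b : B) :
    liftUnital f g (val (inr b)) = (g b : Unitization ℂ C) := by
  change liftUnital f g (FreeProdUnital.inr A B b) = _
  simp [liftUnital, FreeProdUnital.inr]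

theorem liftUnital_eq (f : A →ₙₐ[ℂ] C) (g : B →ₙₐ[ℂ] C) (x : FreeProd A B) :
    liftUnital f g (val x) = ((liftUnital f g (val x)).snd : Unitization ℂ C) := by
  induction x using FreeProd.induction with
  | hl a => rw [liftUnital_inl, Unitization.snd_inr]
  | hr b => rw [liftUnital_inr, Unitization.snd_inr]
  | hadd x y hx hy =>
    rw [map_add, map_add, Unitization.snd_add, Unitization.inr_add, ← hx, ← hy]
  | hmul x y hx hy =>
    rw [map_mul, map_mul, hx, hy, ← Unitization.inr_mul, Unitization.snd_inr]
  | hsmul z x hx =>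
    rw [map_smul, map_smul, Unitization.snd_smul, Unitization.inr_smul, ← hx]

/-- The homomorphism `f ⊔ g : A ⊔ B → C` which restricts to `f` and `g`. -/
def lift (f : A →ₙₐ[ℂ] C) (g : B →ₙₐ[ℂ] C) : FreeProd A B →ₙₐ[ℂ] C where
  toFun x := (liftUnital f g (val x)).snd
  map_smul' z x := by simp
  map_zero' := by simp
  map_add' x y := by simp
  map_mul' x y := by
    rw [map_mul, map_mul, liftUnital_eq f g x, liftUnital_eq f g y,
      ← Unitization.inr_mul]
    simp

@[simp] theorem lift_inl (f : A →ₙₐ[ℂ] C) (g : B →ₙₐ[ℂ] C) (a : A) :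
    lift f g (inl a) = f a :=
  (congrArg (fun z : Unitization ℂ C => z.snd) (liftUnital_inl f g a)).trans
    (Unitization.snd_inr ℂ (f a))

@[simp] theorem lift_inr (f : A →ₙₐ[ℂ] C) (g : B →ₙₐ[ℂ] C) (b : B) :
    lift f g (inr b) = g b :=
  (congrArg (fun z : Unitization ℂ C => z.snd) (liftUnital_inr f g b)).trans
    (Unitization.snd_inr ℂ (g b))

end FreeProd

end FreeProduct

/-! ### The involution on the free product of `*`-algebras -/

section Star

/-- The opposite algebra with the complex conjugate scalar multiplication. Linear homomorphisms
into `ConjOp C` are conjugate linear anti-homomorphisms into `C`. -/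
def ConjOp (C : Type u) : Type u := Cᵐᵒᵖ

namespace ConjOp

variable {C : Type u} [NonUnitalRing C] [Module ℂ C]

instance : NonUnitalRing (ConjOp C) := inferInstanceAs (NonUnitalRing Cᵐᵒᵖ)

instance : Module ℂ (ConjOp C) :=
  Module.compHom Cᵐᵒᵖ (starRingEnd ℂ)

/-- The identity map `C → ConjOp C`. -/
def op (c : C) : ConjOp C := MulOpposite.op c

/-- The identity map `ConjOp C → C`. -/
def unop (c : ConjOp C) : C := MulOpposite.unop c

theorem unop_op (c : C) : unop (op c) = c := rfl

theorem op_add (c d : C) : op (c + d) = op c + op d := rfl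

theorem unop_add (c d : ConjOp C) : unop (c + d) = unop c + unop d := rfl

theorem op_mul (c d : C) : op (c * d) = op d * op c := rfl

theorem unop_mul (c d : ConjOp C) : unop (c * d) = unop d * unop c := rfl

theorem op_smul (z : ℂ) (c : C) : op (star z • c) = z • op c := rfl

theorem unop_smul (z : ℂ) (c : ConjOp C) : unop (z • c) = star z • unop c := rfl

instance [IsScalarTower ℂ C C] [SMulCommClass ℂ C C] : IsScalarTower ℂ (ConjOp C) (ConjOp C) :=
  ⟨fun z x y => by
    change op (unop y * (star z • unop x)) = op (star z • (unop y * unop x))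
    rw [mul_smul_comm]⟩

instance [IsScalarTower ℂ C C] [SMulCommClass ℂ C C] : SMulCommClass ℂ (ConjOp C) (ConjOp C) :=
  ⟨fun z x y => by
    change op (star z • (unop y * unop x)) = op ((star z • unop y) * unop x)
    rw [smul_mul_assoc]⟩

/-- Star followed by a homomorphism, as a homomorphism into the conjugate opposite algebra. -/
def starHom {A : Type u} [NonUnitalRing A] [Module ℂ A] [StarRing A] [StarModule ℂ A]
    (f : A →ₙₐ[ℂ] C) : A →ₙₐ[ℂ] ConjOp C where
  toFun a := op (f (star a))
  map_smul' z a := by rw [star_smul, map_smul, op_smul]; rfl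
  map_zero' := by rw [star_zero, map_zero]; rfl
  map_add' a b := by rw [star_add, map_add, op_add]
  map_mul' a b := by rw [star_mul, map_mul, op_mul]

end ConjOp

namespace FreeProd

variable {A B : Type u}
  [NonUnitalRing A] [Module ℂ A] [IsScalarTower ℂ A A] [SMulCommClass ℂ A A]
  [NonUnitalRing B] [Module ℂ B] [IsScalarTower ℂ B B] [SMulCommClass ℂ B B]
  [StarRing A] [StarModule ℂ A] [StarRing B] [StarModule ℂ B]

/-- The involution of `A ⊔ B` as a homomorphism into the conjugate opposite algebra. -/
def starAux : FreeProd A B →ₙₐ[ℂ] ConjOp (FreeProd A B) :=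
  lift (ConjOp.starHom inl) (ConjOp.starHom inr)

/-- The involution of `A ⊔ B` which extends the involutions of `A` and `B`. -/
instance : Star (FreeProd A B) := ⟨fun x => (starAux x).unop⟩

theorem star_def (x : FreeProd A B) : star x = (starAux x).unop := rfl

theorem star_inl (a : A) : star (inl a : FreeProd A B) = inl (star a) := by
  rw [star_def, starAux, lift_inl]; rfl

theorem star_inr (b : B) : star (inr b : FreeProd A B) = inr (star b) := by
  rw [star_def, starAux, lift_inr]; rfl

theorem star_add' (x y : FreeProd A B) : star (x + y) = star x + star y := by
  rw [star_def, map_add, ConjOp.unop_add]; rfl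

theorem star_mul' (x y : FreeProd A B) : star (x * y) = star y * star x := by
  rw [star_def, map_mul, ConjOp.unop_mul]; rfl

theorem star_smul' (z : ℂ) (x : FreeProd A B) : star (z • x) = star z • star x := by
  rw [star_def, map_smul, ConjOp.unop_smul]; rfl

instance : StarRing (FreeProd A B) where
  star_involutive x := by
    induction x using FreeProd.induction with
    | hl a => rw [star_inl, star_inl, star_star]
    | hr b => rw [star_inr, star_inr, star_star]
    | hadd x y hx hy => rw [star_add', star_add', hx, hy]
    | hmul x y hx hy => rw [star_mul', star_mul', hx, hy]
    | hsmul z x hx => rw [star_smul', star_smul', star_star, hx]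
  star_mul := star_mul'
  star_add := star_add'

instance : StarModule ℂ (FreeProd A B) := ⟨star_smul'⟩

end FreeProd

end Star

/-! ### Multi-faced algebras -/

/-- An `F`-faced algebra: a complex associative algebra which is freely generated by given
subalgebras, its faces. Free generation is expressed by the universal property of the free product
of the faces. -/
structure MultiFacedAlgebra (F : Type v) where
  carrier : Type u
  [ring : NonUnitalRing carrier]
  [module : Module ℂ carrier]
  [tower : IsScalarTower ℂ carrier carrier]
  [comm : SMulCommClass ℂ carrier carrier]
  face : F → NonUnitalSubalgebra ℂ carrier
  free : ∀ (B : Type u) [NonUnitalRing B] [Module ℂ B] [IsScalarTower ℂ B B]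
    [SMulCommClass ℂ B B] (h : ∀ c, face c →ₙₐ[ℂ] B),
    ∃! H : carrier →ₙₐ[ℂ] B, ∀ c (x : face c), H x = h c x

namespace MultiFacedAlgebra

variable {F : Type v}

instance : CoeSort (MultiFacedAlgebra.{u} F) (Type u) := ⟨carrier⟩

instance (A : MultiFacedAlgebra.{u} F) : NonUnitalRing A := A.ring

instance (A : MultiFacedAlgebra.{u} F) : Module ℂ A := A.module

instance (A : MultiFacedAlgebra.{u} F) : IsScalarTower ℂ A A := A.tower

instance (A : MultiFacedAlgebra.{u} F) : SMulCommClass ℂ A A := A.comm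

/-- A homomorphism of multi-faced algebras maps each face into the face of the same color. -/
def IsMultiFaced {A B : MultiFacedAlgebra.{u} F} (h : A →ₙₐ[ℂ] B) : Prop :=
  ∀ c, ∀ x ∈ A.face c, h x ∈ B.face c

/-- The free product of multi-faced algebras; its face of color `c` is generated by the faces of
color `c` of the two factors. -/
def coprod (A B : MultiFacedAlgebra.{u} F) : MultiFacedAlgebra.{u} F where
  carrier := FreeProd A B
  face c := NonUnitalAlgebra.adjoin ℂ
    ((FreeProd.inl : A →ₙₐ[ℂ] FreeProd A B) '' A.face c ∪
      (FreeProd.inr : B →ₙₐ[ℂ] FreeProd A B) '' B.face c)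
  free C _ _ _ _ h := by
    have memL : ∀ c (x : A.face c), (FreeProd.inl (x : A) : FreeProd A B) ∈
        NonUnitalAlgebra.adjoin ℂ
          ((FreeProd.inl : A →ₙₐ[ℂ] FreeProd A B) '' A.face c ∪
            (FreeProd.inr : B →ₙₐ[ℂ] FreeProd A B) '' B.face c) := fun c x =>
      NonUnitalAlgebra.subset_adjoin ℂ (Or.inl ⟨x, x.2, rfl⟩)
    have memR : ∀ c (x : B.face c), (FreeProd.inr (x : B) : FreeProd A B) ∈
        NonUnitalAlgebra.adjoin ℂ
          ((FreeProd.inl : A →ₙₐ[ℂ] FreeProd A B) '' A.face c ∪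
            (FreeProd.inr : B →ₙₐ[ℂ] FreeProd A B) '' B.face c) := fun c x =>
      NonUnitalAlgebra.subset_adjoin ℂ (Or.inr ⟨x, x.2, rfl⟩)
    obtain ⟨f, hf, hf'⟩ := A.free C fun c => (h c).comp
      (NonUnitalAlgHom.codRestrict (FreeProd.inl.comp (NonUnitalSubalgebraClass.subtype (A.face c)))
        _ (memL c))
    obtain ⟨g, hg, hg'⟩ := B.free C fun c => (h c).comp
      (NonUnitalAlgHom.codRestrict (FreeProd.inr.comp (NonUnitalSubalgebraClass.subtype (B.face c)))
        _ (memR c))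
    refine ⟨FreeProd.lift f g, ?_, ?_⟩
    · rintro c ⟨x, hx⟩
      induction hx using NonUnitalAlgebra.adjoin_induction with
      | mem x hx =>
        rcases hx with ⟨a, ha, rfl⟩ | ⟨b, hb, rfl⟩
        · exact (FreeProd.lift_inl f g a).trans (hf c ⟨a, ha⟩)
        · exact (FreeProd.lift_inr f g b).trans (hg c ⟨b, hb⟩)
      | add x y hx hy ihx ihy =>
        refine (map_add (FreeProd.lift f g) x y).trans ?_
        exact (congrArg₂ (· + ·) ihx ihy).trans (map_add (h c) ⟨x, hx⟩ ⟨y, hy⟩).symm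
      | zero => exact (map_zero (FreeProd.lift f g)).trans (map_zero (h c)).symm
      | mul x y hx hy ihx ihy =>
        refine (map_mul (FreeProd.lift f g) x y).trans ?_
        exact (congrArg₂ (· * ·) ihx ihy).trans (map_mul (h c) ⟨x, hx⟩ ⟨y, hy⟩).symm
      | smul r x hx ih =>
        refine (map_smul (FreeProd.lift f g) r x).trans ?_
        exact (congrArg (fun y : C => r • y) ih).trans
          (map_smul (h c) r ⟨x, hx⟩).symm
    · intro H hH
      have e1 : H.comp FreeProd.inl = f := hf' _ fun c x => hH c ⟨_, memL c x⟩
      have e2 : H.comp FreeProd.inr = g := hg' _ fun c x => hH c ⟨_, memR c x⟩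
      apply FreeProd.hom_ext
      · intro a
        rw [FreeProd.lift_inl, ← e1]; rfl
      · intro b
        rw [FreeProd.lift_inr, ← e2]; rfl

variable {A B C A' B' : MultiFacedAlgebra.{u} F}

/-- The inclusion of the first factor into the free product. -/
def inl : A →ₙₐ[ℂ] A.coprod B := (FreeProd.inl : A →ₙₐ[ℂ] FreeProd A B)

/-- The inclusion of the second factor into the free product. -/
def inr : B →ₙₐ[ℂ] A.coprod B := (FreeProd.inr : B →ₙₐ[ℂ] FreeProd A B)

/-- The homomorphism from the free product induced by homomorphisms from the factors. -/
def lift (f : A →ₙₐ[ℂ] C) (g : B →ₙₐ[ℂ] C) : A.coprod B →ₙₐ[ℂ] C :=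
  (FreeProd.lift f g : FreeProd A B →ₙₐ[ℂ] C)

/-- The free product of two homomorphisms. -/
def map (f : A →ₙₐ[ℂ] A') (g : B →ₙₐ[ℂ] B') : A.coprod B →ₙₐ[ℂ] A'.coprod B' :=
  lift (inl.comp f) (inr.comp g)

/-- The canonical isomorphism `A ⊔ B → B ⊔ A`. -/
def swap (A B : MultiFacedAlgebra.{u} F) : A.coprod B →ₙₐ[ℂ] B.coprod A :=
  lift inr inl

/-- The canonical isomorphism `(A ⊔ B) ⊔ C → A ⊔ (B ⊔ C)`. -/
def assoc (A B C : MultiFacedAlgebra.{u} F) :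
    (A.coprod B).coprod C →ₙₐ[ℂ] A.coprod (B.coprod C) :=
  lift (lift inl (inr.comp inl)) (inr.comp inr)

/-- The free product of involutive algebras carries the involution that extends the given ones. -/
instance [StarRing A] [StarModule ℂ A] [StarRing B] [StarModule ℂ B] :
    StarRing (A.coprod B) :=
  inferInstanceAs (StarRing (FreeProd A B))

instance [StarRing A] [StarModule ℂ A] [StarRing B] [StarModule ℂ B] :
    StarModule ℂ (A.coprod B) :=
  inferInstanceAs (StarModule ℂ (FreeProd A B))

/-- A multi-faced `*`-algebra is a multi-faced algebra with an involution (given by the two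
instance arguments) whose faces are `*`-subalgebras. -/
def IsStarFaced (A : MultiFacedAlgebra.{u} F) [StarRing A] [StarModule ℂ A] : Prop :=
  ∀ c, ∀ x ∈ A.face c, star x ∈ A.face c

/-- A linear functional is a restricted state if its unital extension to the unitization,
`z + a ↦ z + φ a`, is a state. -/
def IsRestrictedState [StarRing A] (φ : A →ₗ[ℂ] ℂ) : Prop :=
  ∀ x : Unitization ℂ A, 0 ≤ (star x * x).fst + φ (star x * x).snd

/-- The element `e` is the unit of the face of color `c`. -/
def IsFaceUnit (A : MultiFacedAlgebra.{u} F) (c : F) (e : A) : Prop :=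
  e ∈ A.face c ∧ ∀ x ∈ A.face c, e * x = x ∧ x * e = x

/-- The two-sided ideal (of the complex algebra `A`) generated by a set. -/
def idealSpan (A : MultiFacedAlgebra.{u} F) (S : Set A) : Submodule ℂ A :=
  sInf {I | S ⊆ I ∧ ∀ a, ∀ x ∈ I, a * x ∈ I ∧ x * a ∈ I}

/-- The iterated free product `A 0 ⊔ (A 1 ⊔ (⋯ ⊔ A k))`. -/
def iterCoprod : (k : ℕ) → (Fin (k + 1) → MultiFacedAlgebra.{u} F) → MultiFacedAlgebra.{u} F
  | 0, A => A 0
  | k + 1, A => (A 0).coprod (iterCoprod k fun i => A i.succ)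

/-- The inclusion of the factor `A κ` into the iterated free product. -/
def embed : (k : ℕ) → (A : Fin (k + 1) → MultiFacedAlgebra.{u} F) → (κ : Fin (k + 1)) →
    (A κ →ₙₐ[ℂ] iterCoprod k A)
  | 0, A => fun κ => Fin.cases (motive := fun κ => A κ →ₙₐ[ℂ] A 0)
      (NonUnitalAlgHom.id ℂ (A 0)) (fun i => i.elim0) κ
  | k + 1, A => fun κ => Fin.cases
      (motive := fun κ => A κ →ₙₐ[ℂ] (A 0).coprod (iterCoprod k fun i => A i.succ))
      inl (fun i => inr.comp (embed k (fun i => A i.succ) i)) κ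

end MultiFacedAlgebra

open MultiFacedAlgebra

/-! ### Multi-faced universal products -/

/-- A multi-faced universal product: a product operation for linear functionals on multi-faced
algebras which is universal, associative, and has the restriction property. -/
structure UniversalProduct (F : Type v) where
  prod : ∀ {A B : MultiFacedAlgebra.{u} F}, (A →ₗ[ℂ] ℂ) → (B →ₗ[ℂ] ℂ) → (A.coprod B →ₗ[ℂ] ℂ)
  universality : ∀ {A A' B B' : MultiFacedAlgebra.{u} F} (h : A' →ₙₐ[ℂ] A) (k : B' →ₙₐ[ℂ] B),
    IsMultiFaced h → IsMultiFaced k → ∀ (φ : A →ₗ[ℂ] ℂ) (ψ : B →ₗ[ℂ] ℂ),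
      prod (φ ∘ₗ (h : A' →ₗ[ℂ] A)) (ψ ∘ₗ (k : B' →ₗ[ℂ] B)) =
        prod φ ψ ∘ₗ (map h k : A'.coprod B' →ₗ[ℂ] A.coprod B)
  associativity : ∀ {A B C : MultiFacedAlgebra.{u} F}
    (φ : A →ₗ[ℂ] ℂ) (ψ : B →ₗ[ℂ] ℂ) (χ : C →ₗ[ℂ] ℂ),
      prod (prod φ ψ) χ = prod φ (prod ψ χ) ∘ₗ
        (assoc A B C : (A.coprod B).coprod C →ₗ[ℂ] A.coprod (B.coprod C))
  restrict_left : ∀ {A B : MultiFacedAlgebra.{u} F} (φ : A →ₗ[ℂ] ℂ) (ψ : B →ₗ[ℂ] ℂ) (a : A),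
    prod φ ψ (inl a) = φ a
  restrict_right : ∀ {A B : MultiFacedAlgebra.{u} F} (φ : A →ₗ[ℂ] ℂ) (ψ : B →ₗ[ℂ] ℂ) (b : B),
    prod φ ψ (inr b) = ψ b

/-- The product `x₁ * (x₂ * ⋯)` of the members of a nonempty list, in the order of the list (no
unit is needed; the value `0` for the empty list is never used). -/
def wordProd {R : Type*} [NonUnitalRing R] : List R → R
  | [] => 0
  | [x] => x
  | x :: y :: l => x * wordProd (y :: l)

/-- Partitions of a word of length `n + 1`, whose legs are numbered `0, …, n`. -/
abbrev WordPartition (n : ℕ) : Type := Finpartition (Finset.univ : Finset (Fin (n + 1)))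

open Classical in
/-- The partition of the legs into the fibres of a map. -/
def WordPartition.ofMap {n : ℕ} {β : Type*} (b : Fin (n + 1) → β) : WordPartition n :=
  Finpartition.ofSetoid (Setoid.ker b)

/-- The partition `π` of the legs is adapted to `s = b × f`: each block of `π` lies in one fibre of
`b`, and neighboring legs with the same value of `s` lie in the same block. -/
def IsAdapted {F : Type v} {k n : ℕ} (s : Fin (n + 1) → Fin (k + 1) × F) (π : WordPartition n) :
    Prop :=
  (∀ β ∈ π.parts, ∃ κ, ∀ ℓ ∈ β, (s ℓ).1 = κ) ∧
    ∀ i : Fin n, s i.castSucc = s i.succ → ∃ β ∈ π.parts, i.castSucc ∈ β ∧ i.succ ∈ β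

/-- A family of complex numbers indexed by `s ∈ ([k] × F)ⁿ` (`k, n ≥ 1`) and partitions. -/
def CoefficientFamily (F : Type v) : Type v :=
  ∀ k n : ℕ, (Fin (n + 1) → Fin (k + 1) × F) → WordPartition n → ℂ

/-- Weights on partitions: a family of complex numbers indexed by multi-faced partitions, i.e. by
words in the faces (of positive length) and partitions of their legs. -/
def Weights (F : Type v) : Type v :=
  ∀ n : ℕ, (Fin (n + 1) → F) → WordPartition n → ℂ

namespace UniversalProduct

variable {F : Type v} (P : UniversalProduct.{u} F)

/-- Symmetry: `φ ⊙ ψ = ψ ⊙ φ`, under the canonical identification `A ⊔ B = B ⊔ A`. -/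
def Symmetric : Prop :=
  ∀ (A B : MultiFacedAlgebra.{u} F) (φ : A →ₗ[ℂ] ℂ) (ψ : B →ₗ[ℂ] ℂ),
    P.prod φ ψ = P.prod ψ φ ∘ₗ (swap A B : A.coprod B →ₗ[ℂ] B.coprod A)

/-- Positivity: the product of restricted states on multi-faced `*`-algebras is a restricted state
on the free product. -/
def Positive : Prop :=
  ∀ (A B : MultiFacedAlgebra.{u} F) [StarRing A] [StarModule ℂ A] [StarRing B] [StarModule ℂ B],
    A.IsStarFaced → B.IsStarFaced → ∀ (φ : A →ₗ[ℂ] ℂ) (ψ : B →ₗ[ℂ] ℂ),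
      IsRestrictedState φ → IsRestrictedState ψ → IsRestrictedState (P.prod φ ψ)

/-- The product is unit preserving: if all faces of `A₁` and `A₂` are unital, with units `e₁ c` and
`e₂ c`, and if each `φᵢ` vanishes on the ideal generated by the differences of the units of the
faces of `Aᵢ` and is unital on each face, then the product functional vanishes on the ideal
generated by the differences of all the units `E i c` of the faces of both factors, and takes the
value `1` at each of these units. -/
def UnitPreserving : Prop :=
  ∀ (A₁ A₂ : MultiFacedAlgebra.{u} F) (e₁ : F → A₁) (e₂ : F → A₂),
    (∀ c, A₁.IsFaceUnit c (e₁ c)) → (∀ c, A₂.IsFaceUnit c (e₂ c)) →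
    ∀ (φ₁ : A₁ →ₗ[ℂ] ℂ) (φ₂ : A₂ →ₗ[ℂ] ℂ),
      (∀ x ∈ A₁.idealSpan {x | ∃ c d, x = e₁ c - e₁ d}, φ₁ x = 0) → (∀ c, φ₁ (e₁ c) = 1) →
      (∀ x ∈ A₂.idealSpan {x | ∃ c d, x = e₂ c - e₂ d}, φ₂ x = 0) → (∀ c, φ₂ (e₂ c) = 1) →
      let E : Fin 2 → F → A₁.coprod A₂ := ![fun c => inl (e₁ c), fun c => inr (e₂ c)]
      (∀ x ∈ (A₁.coprod A₂).idealSpan {x | ∃ i j c d, x = E i c - E j d},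
        P.prod φ₁ φ₂ x = 0) ∧ ∀ i c, P.prod φ₁ φ₂ (E i c) = 1

/-- The iterated product `φ 0 ⊙ (φ 1 ⊙ (⋯ ⊙ φ k))`. -/
def iterProd : (k : ℕ) → (A : Fin (k + 1) → MultiFacedAlgebra.{u} F) →
    (∀ κ, A κ →ₗ[ℂ] ℂ) → (iterCoprod k A →ₗ[ℂ] ℂ)
  | 0, _, φ => φ 0
  | k + 1, A, φ => P.prod (φ 0) (iterProd k (fun i => A i.succ) fun i => φ i.succ)

open Classical in
/-- The family `α` consists of coefficients of the universal product: for all linear functionals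
`φ κ` on multi-faced algebras `A κ` and every product `a₁ ⋯ aₙ` with `a_ℓ` in the face of color
`f ℓ` of `A (b ℓ)`, where `s = b × f`,
`(φ₁ ⊙ ⋯ ⊙ φₖ) (a₁ ⋯ aₙ) = ∑_π α_s^π ∏_κ ∏_β φ κ (∏_{ℓ ∈ β} a_ℓ)`,
where `π` runs through the partitions adapted to `s`, `β` runs through the blocks of `π` which
belong to `κ`, and the product over `ℓ ∈ β` is taken in increasing order.
In the family `a`, only the entries `a (b ℓ) ℓ` are used; they are the factors `a_ℓ`. -/
def HasCoefficients (α : CoefficientFamily F) : Prop :=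
  ∀ (k n : ℕ) (s : Fin (n + 1) → Fin (k + 1) × F) (A : Fin (k + 1) → MultiFacedAlgebra.{u} F)
    (φ : ∀ κ, A κ →ₗ[ℂ] ℂ) (a : ∀ κ, Fin (n + 1) → A κ),
    (∀ ℓ, a (s ℓ).1 ℓ ∈ (A (s ℓ).1).face (s ℓ).2) →
    P.iterProd k A φ (wordProd (List.ofFn fun ℓ => embed k A (s ℓ).1 (a (s ℓ).1 ℓ))) =
      ∑ π : WordPartition n with IsAdapted s π,
        α k n s π * ∏ κ, ∏ β ∈ π.parts with ∀ ℓ ∈ β, (s ℓ).1 = κ,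
          φ κ (wordProd ((β.sort (· ≤ ·)).map (a κ)))

/-- The weights `w` are the highest coefficients of a symmetric universal product: for every
multi-faced partition `π` and every ordering `β₀ < ⋯ < βₖ` of its blocks, `w_π` is the coefficient
`α_s^σ` where `s ℓ = (κ, f ℓ)` for `ℓ ∈ β_κ`, and `σ = π` is the maximal partition adapted
to `s`. -/
def HasHighestCoefficients (w : Weights F) : Prop :=
  ∃ α : CoefficientFamily F, P.HasCoefficients α ∧
    ∀ (k n : ℕ) (f : Fin (n + 1) → F) (π : WordPartition n) (e : Fin (k + 1) ≃ π.parts),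
      w n f π =
        α k n (fun ℓ => (e.symm ⟨π.part ℓ, π.part_mem.2 (Finset.mem_univ ℓ)⟩, f ℓ)) π

end UniversalProduct

/-- The partition `π \ {s}` of the remaining legs, when `{s}` is a block of `π`. -/
def WordPartition.erase {n : ℕ} (π : WordPartition (n + 1)) (s : Fin (n + 2)) : WordPartition n :=
  WordPartition.ofMap fun i => π.part (s.succAbove i)

/-- Weights are singleton inductive if they do not change when a singleton block is removed. -/
def Weights.SingletonInductive {F : Type v} (w : Weights F) : Prop :=
  ∀ (n : ℕ) (f : Fin (n + 2) → F) (π : WordPartition (n + 1)) (s : Fin (n + 2)),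
    {s} ∈ π.parts → w (n + 1) f π = w n (fun i => f (s.succAbove i)) (π.erase s)

/-- The partition `{{1, 3}, {2}}` of three legs. -/
def nestPartition : WordPartition 2 := WordPartition.ofMap ![(0 : Fin 2), 1, 0]

end

/-! The combinatorial half. By universality, the value of a product functional on a word depends
only on the moments of the factors along words in its letters, and it is multilinear in the letters.
Splitting each letter into labeled copies and rescaling letters yields an expansion
(`wordValue_eq_sum`) over systems of words without repetition. The coefficient of a system is the
value of the product at the functionals that are indicators of that system. In a contributing system
each letter lies in its own word and words stay within one factor (`wordCoeff_ne_zero`), and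
neighboring letters of the same factor and color stay neighbors (`adjacent_of_wordCoeff_ne_zero`).
Positivity forces the words to be increasing (`Positive.sorted_of_wordCoeff_ne_zero`): for a vector
state on disjoint paths that detects the system, a descent would turn a tail of the word into a null
vector. So contributing systems are set partitions, which gives the coefficients; testing on
indicators gives their uniqueness, and symmetry the independence of the enumeration of the blocks.

The analytic half is a null vector argument in the GNS picture. For centered `x`, `y` in the first
factor and `e` in the second, the product of `φ` and `ψ` takes the value `ν φ(xy) ψ(e)` at `x e y`
(`Positive.prod_nest`). Letters of different colors that give the same vector show that `ν` depends
only on the color of `e` (`Positive.nestCoeff_congr`). Suppose `ν = 1` and let `r` be a letter of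
the second factor with the distribution of a unit. Then `rΩ - Ω` and `ryΩ - yΩ` are null for
centered `y`, so `r` fixes every vector produced by the first factor and can be deleted from `X r
Z`. This is proved for vector states; since coefficients are universal and vector states detect
them, it gives `φ(XZ) ψ(e)` as the value at `X e Z` for all functionals and all `e` of that color
(`Positive.prod_insert`).

The implications follow. A singleton block, taken as a factor of its own, can be deleted by this
insertion formula (2 to 3). Deleting the inner leg of the nested partition leaves one block, whose
coefficient is 1 (3 to 2). Units can be inserted anywhere in the free product, by comparison with a
fresh letter in an auxiliary third factor (2 to 1). If units are preserved, the product functional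
vanishes at `x (e₂ - e₁) x`, where `x` is centered with `φ(x²) = 1` and `e₁`, `e₂` are copies of the
unit of the face of `x`; this reads `ν - 1 = 0` (1 to 2). -/

noncomputable section

open MultiFacedAlgebra

/-! ### Unitizations -/

section Unital

variable {R S T : Type*}
  [NonUnitalRing R] [Module ℂ R] [IsScalarTower ℂ R R] [SMulCommClass ℂ R R]
  [NonUnitalRing S] [Module ℂ S] [IsScalarTower ℂ S S] [SMulCommClass ℂ S S]
  [NonUnitalRing T] [Module ℂ T] [IsScalarTower ℂ T T] [SMulCommClass ℂ T T]

/-- The unital extension of a linear functional to the unitization. -/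
def uext (φ : R →ₗ[ℂ] ℂ) : Unitization ℂ R →ₗ[ℂ] ℂ where
  toFun x := x.fst + φ x.snd
  map_add' x y := by simp; ring
  map_smul' z x := by simp; ring

theorem uext_apply (φ : R →ₗ[ℂ] ℂ) (x : Unitization ℂ R) : uext φ x = x.fst + φ x.snd := rfl

@[simp] theorem uext_inr (φ : R →ₗ[ℂ] ℂ) (x : R) : uext φ (x : Unitization ℂ R) = φ x := by
  simp [uext_apply]

@[simp] theorem uext_one (φ : R →ₗ[ℂ] ℂ) : uext φ 1 = 1 := by
  simp [uext_apply]

/-- The unital extension of a homomorphism to the unitizations. -/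
def umap (h : R →ₙₐ[ℂ] S) : Unitization ℂ R →ₐ[ℂ] Unitization ℂ S :=
  Unitization.lift ((Unitization.inrNonUnitalAlgHom ℂ S).comp h)

@[simp] theorem umap_inr (h : R →ₙₐ[ℂ] S) (x : R) :
    umap h (x : Unitization ℂ R) = (h x : Unitization ℂ S) := by
  simp [umap]

theorem umap_apply (h : R →ₙₐ[ℂ] S) (x : Unitization ℂ R) :
    umap h x = Unitization.inl x.fst + (h x.snd : Unitization ℂ S) := by
  conv_lhs => rw [← Unitization.inl_fst_add_inr_snd_eq x]
  rw [map_add, umap_inr, ← Unitization.algebraMap_eq_inl, AlgHom.commutes,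
    Unitization.algebraMap_eq_inl]

theorem umap_comp_apply (g : S →ₙₐ[ℂ] T) (h : R →ₙₐ[ℂ] S) (x : Unitization ℂ R) :
    umap (g.comp h) x = umap g (umap h x) := by
  simp [umap_apply]

theorem uext_umap {φ : S →ₗ[ℂ] ℂ} {ψ : R →ₗ[ℂ] ℂ} {h : R →ₙₐ[ℂ] S} (H : ∀ x, ψ x = φ (h x))
    (x : Unitization ℂ R) : uext φ (umap h x) = uext ψ x := by
  simp [umap_apply, uext_apply, H]

/-- Words become ordinary monoid products in the unitization. The empty word must be excluded: there
`wordProd` is `0` but the product is `1`. -/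
theorem inr_wordProd {l : List R} (hl : l ≠ []) :
    ((wordProd l : R) : Unitization ℂ R) = (l.map (Unitization.inr : R → Unitization ℂ R)).prod := by
  induction l with
  | nil => exact absurd rfl hl
  | cons x l ih =>
    cases l with
    | nil => simp [wordProd]
    | cons y l => rw [wordProd, Unitization.inr_mul, ih (by simp)]; simp

theorem map_wordProd (h : R →ₙₐ[ℂ] S) (l : List R) : h (wordProd l) = wordProd (l.map h) := by
  induction l with
  | nil => simp [wordProd]
  | cons x l ih =>
    cases l with
    | nil => simp [wordProd]
    | cons y l => rw [wordProd, map_mul, ih]; rfl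

end Unital

/-! ### Generation by faces and construction from generators -/

namespace MultiFacedAlgebra

variable {F : Type v} {A B C A' B' : MultiFacedAlgebra.{u} F}

/-- The universal property retracts the algebra onto the subalgebra generated by the faces. Followed
by the inclusion, the retraction fixes all faces, so uniqueness makes it the identity. -/
theorem adjoin_faces (A : MultiFacedAlgebra.{u} F) :
    NonUnitalAlgebra.adjoin ℂ (⋃ c, (A.face c : Set A)) = ⊤ := by
  set S := NonUnitalAlgebra.adjoin ℂ (⋃ c, (A.face c : Set A)) with hS
  have hmem : ∀ c (x : A.face c), (x : A) ∈ S := fun c x =>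
    NonUnitalAlgebra.subset_adjoin ℂ (Set.mem_iUnion.2 ⟨c, x.2⟩)
  obtain ⟨H, hH, -⟩ := A.free S fun c =>
    NonUnitalAlgHom.codRestrict (NonUnitalSubalgebraClass.subtype (A.face c)) S (hmem c)
  obtain ⟨I, -, hI⟩ := A.free A fun c => NonUnitalSubalgebraClass.subtype (A.face c)
  have e1 : (NonUnitalSubalgebraClass.subtype S).comp H = I := hI _ fun c x => by
    rw [NonUnitalAlgHom.comp_apply, hH]; rfl
  have e2 : NonUnitalAlgHom.id ℂ A = I := hI _ fun c x => rfl
  refine eq_top_iff.2 fun x _ => ?_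
  have : ((NonUnitalSubalgebraClass.subtype S).comp H) x = x := by rw [e1, ← e2]; rfl
  rw [← this]
  exact (H x).2

/-- An algebra generated by a family of elements which has the universal property for
homomorphisms defined on the subalgebras generated by the elements of equal color. -/
def ofGenerators {X : Type*} (R : Type u) [NonUnitalRing R] [Module ℂ R] [IsScalarTower ℂ R R]
    [SMulCommClass ℂ R R] (g : X → R) (col : X → F)
    (hg : NonUnitalAlgebra.adjoin ℂ (Set.range g) = ⊤)
    (hfree : ∀ (B : Type u) [NonUnitalRing B] [Module ℂ B] [IsScalarTower ℂ B B]
      [SMulCommClass ℂ B B]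
      (h : ∀ c, NonUnitalAlgebra.adjoin ℂ (g '' {x | col x = c}) →ₙₐ[ℂ] B),
      ∃ H : R →ₙₐ[ℂ] B, ∀ x, H (g x) =
        h (col x) ⟨g x, NonUnitalAlgebra.subset_adjoin ℂ ⟨x, rfl, rfl⟩⟩) :
    MultiFacedAlgebra.{u} F where
  carrier := R
  face c := NonUnitalAlgebra.adjoin ℂ (g '' {x | col x = c})
  free B _ _ _ _ h := by
    obtain ⟨H, hH⟩ := hfree B h
    refine ⟨H, ?_, ?_⟩
    · rintro c ⟨x, hx⟩
      induction hx using NonUnitalAlgebra.adjoin_induction with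
      | mem x hx =>
        obtain ⟨y, rfl, rfl⟩ := hx
        exact hH y
      | add x y hx hy ihx ihy =>
        refine (map_add H x y).trans ?_
        exact (congrArg₂ (· + ·) ihx ihy).trans (map_add (h c) ⟨x, hx⟩ ⟨y, hy⟩).symm
      | zero => exact (map_zero H).trans (map_zero (h c)).symm
      | mul x y hx hy ihx ihy =>
        refine (map_mul H x y).trans ?_
        exact (congrArg₂ (· * ·) ihx ihy).trans (map_mul (h c) ⟨x, hx⟩ ⟨y, hy⟩).symm
      | smul r x hx ih =>
        refine (map_smul H r x).trans ?_
        exact (congrArg (fun y : B => r • y) ih).trans (map_smul (h c) r ⟨x, hx⟩).symm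
    · intro H' hH'
      refine NonUnitalAlgHom.ext fun x => ?_
      have hx : x ∈ NonUnitalAlgebra.adjoin ℂ (Set.range g) := by rw [hg]; trivial
      induction hx using NonUnitalAlgebra.adjoin_induction with
      | mem x hx =>
        obtain ⟨y, rfl⟩ := hx
        rw [hH]
        exact hH' (col y) ⟨g y, NonUnitalAlgebra.subset_adjoin ℂ ⟨y, rfl, rfl⟩⟩
      | add x y _ _ ihx ihy => rw [map_add, map_add, ihx, ihy]
      | zero => rw [map_zero, map_zero]
      | mul x y _ _ ihx ihy => rw [map_mul, map_mul, ihx, ihy]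
      | smul r x _ ih => rw [map_smul, map_smul, ih]

/-! ### Iterated free products -/

@[simp] theorem lift_inl (f : A →ₙₐ[ℂ] C) (g : B →ₙₐ[ℂ] C) (a : A) :
    lift f g ((inl : A →ₙₐ[ℂ] A.coprod B) a) = f a :=
  FreeProd.lift_inl (f : A →ₙₐ[ℂ] C) g a

@[simp] theorem lift_inr (f : A →ₙₐ[ℂ] C) (g : B →ₙₐ[ℂ] C) (b : B) :
    lift f g ((inr : B →ₙₐ[ℂ] A.coprod B) b) = g b :=
  FreeProd.lift_inr (f : A →ₙₐ[ℂ] C) g b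

theorem coprod_hom_ext {R : Type*} [NonUnitalRing R] [Module ℂ R] [IsScalarTower ℂ R R]
    [SMulCommClass ℂ R R] {f g : A.coprod B →ₙₐ[ℂ] R} (hl : ∀ a, f (inl a) = g (inl a))
    (hr : ∀ b, f (inr b) = g (inr b)) : f = g :=
  FreeProd.hom_ext (A := A) (B := B) hl hr

theorem isMultiFaced_inl : IsMultiFaced (inl : A →ₙₐ[ℂ] A.coprod B) := fun _ x hx =>
  NonUnitalAlgebra.subset_adjoin ℂ (A := FreeProd A B) (Or.inl ⟨x, hx, rfl⟩)

theorem isMultiFaced_inr : IsMultiFaced (inr : B →ₙₐ[ℂ] A.coprod B) := fun _ x hx =>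
  NonUnitalAlgebra.subset_adjoin ℂ (A := FreeProd A B) (Or.inr ⟨x, hx, rfl⟩)

theorem isMultiFaced_id : IsMultiFaced (NonUnitalAlgHom.id ℂ A) := fun _ _ hx => hx

theorem IsMultiFaced.comp {g : B →ₙₐ[ℂ] C} {f : A →ₙₐ[ℂ] B} (hg : IsMultiFaced g)
    (hf : IsMultiFaced f) : IsMultiFaced (g.comp f) := fun c x hx => hg c _ (hf c x hx)

theorem isMultiFaced_of_face_eq_adjoin {f : A →ₙₐ[ℂ] B} (S : F → Set A)
    (hS : ∀ c, A.face c = NonUnitalAlgebra.adjoin ℂ (S c)) (hf : ∀ c, ∀ x ∈ S c, f x ∈ B.face c) :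
    IsMultiFaced f := by
  intro c x hx
  rw [hS] at hx
  induction hx using NonUnitalAlgebra.adjoin_induction with
  | mem x hx => exact hf c x hx
  | add x y _ _ hx hy => rw [map_add]; exact add_mem hx hy
  | zero => rw [map_zero]; exact zero_mem _
  | mul x y _ _ hx hy => rw [map_mul]; exact mul_mem hx hy
  | smul z x _ hx => rw [map_smul]; exact SMulMemClass.smul_mem z hx

theorem IsMultiFaced.lift {f : A →ₙₐ[ℂ] C} {g : B →ₙₐ[ℂ] C} (hf : IsMultiFaced f)
    (hg : IsMultiFaced g) : IsMultiFaced (lift f g) := by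
  refine isMultiFaced_of_face_eq_adjoin _ (fun c => rfl) ?_
  rintro c _ (⟨a, ha, rfl⟩ | ⟨b, hb, rfl⟩)
  · exact (congrArg (· ∈ C.face c) (lift_inl f g a)).mpr (hf c a ha)
  · exact (congrArg (· ∈ C.face c) (lift_inr f g b)).mpr (hg c b hb)

theorem isMultiFaced_swap : IsMultiFaced (swap A B) :=
  isMultiFaced_inr.lift isMultiFaced_inl

theorem isMultiFaced_embed (k : ℕ) (A : Fin (k + 1) → MultiFacedAlgebra.{u} F)
    (κ : Fin (k + 1)) : IsMultiFaced (embed k A κ) := by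
  induction k with
  | zero =>
    obtain rfl : κ = 0 := Fin.fin_one_eq_zero κ
    exact fun c x hx => hx
  | succ k ih =>
    refine Fin.cases ?_ (fun i => ?_) κ
    · exact isMultiFaced_inl
    · exact isMultiFaced_inr.comp (ih (fun i => A i.succ) i)

/-- The homomorphism from the iterated free product induced by homomorphisms from the factors. -/
def iterLift : (k : ℕ) → (A : Fin (k + 1) → MultiFacedAlgebra.{u} F) →
    (∀ κ, A κ →ₙₐ[ℂ] C) → (iterCoprod k A →ₙₐ[ℂ] C)
  | 0, _, h => h 0
  | k + 1, A, h => lift (h 0) (iterLift k (fun i => A i.succ) fun i => h i.succ)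

@[simp] theorem iterLift_embed (k : ℕ) (A : Fin (k + 1) → MultiFacedAlgebra.{u} F)
    (h : ∀ κ, A κ →ₙₐ[ℂ] C) (κ : Fin (k + 1)) (x : A κ) :
    iterLift k A h (embed k A κ x) = h κ x := by
  induction k with
  | zero =>
    obtain rfl : κ = 0 := Fin.fin_one_eq_zero κ
    rfl
  | succ k ih =>
    revert x
    refine Fin.cases ?_ (fun i => ?_) κ
    · exact fun x => lift_inl _ _ x
    · exact fun x => (lift_inr _ _ _).trans (ih (fun i => A i.succ) (fun i => h i.succ) i x)

theorem isMultiFaced_iterLift (k : ℕ) (A : Fin (k + 1) → MultiFacedAlgebra.{u} F)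
    (h : ∀ κ, A κ →ₙₐ[ℂ] C) (hh : ∀ κ, IsMultiFaced (h κ)) : IsMultiFaced (iterLift k A h) := by
  induction k with
  | zero => exact hh 0
  | succ k ih => exact (hh 0).lift (ih _ _ fun i => hh i.succ)

theorem iterCoprod_hom_ext {R : Type*} [NonUnitalRing R] [Module ℂ R] [IsScalarTower ℂ R R]
    [SMulCommClass ℂ R R] (k : ℕ) (A : Fin (k + 1) → MultiFacedAlgebra.{u} F)
    {f g : iterCoprod k A →ₙₐ[ℂ] R} (h : ∀ κ x, f (embed k A κ x) = g (embed k A κ x)) :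
    f = g := by
  induction k with
  | zero => exact NonUnitalAlgHom.ext fun x => h 0 x
  | succ k ih =>
    refine coprod_hom_ext (fun a => h 0 a) fun b => ?_
    have := ih (fun i => A i.succ) (f := f.comp inr) (g := g.comp inr) fun κ x => h κ.succ x
    exact DFunLike.congr_fun this b

end MultiFacedAlgebra

namespace UniversalProduct

variable {F : Type v} (P : UniversalProduct.{u} F)

/-- Universality of the iterated product. -/
theorem iterProd_comp (k : ℕ) (A A' : Fin (k + 1) → MultiFacedAlgebra.{u} F)
    (h : ∀ κ, A' κ →ₙₐ[ℂ] A κ) (hh : ∀ κ, IsMultiFaced (h κ)) (φ : ∀ κ, A κ →ₗ[ℂ] ℂ) :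
    P.iterProd k A' (fun κ => φ κ ∘ₗ (h κ : A' κ →ₗ[ℂ] A κ)) =
      P.iterProd k A φ ∘ₗ
        (iterLift k A' (fun κ => (embed k A κ).comp (h κ)) :
          iterCoprod k A' →ₗ[ℂ] iterCoprod k A) := by
  induction k with
  | zero => rfl
  | succ k ih =>
    have e := ih (fun i => A i.succ) (fun i => A' i.succ) (fun i => h i.succ)
      (fun i => hh i.succ) fun i => φ i.succ
    have hm := P.universality (h 0) (iterLift k (fun i => A' i.succ) fun κ =>
      (embed k (fun i => A i.succ) κ).comp (h κ.succ)) (hh 0)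
      (isMultiFaced_iterLift _ _ _ fun κ => (isMultiFaced_embed _ _ _).comp (hh κ.succ)) (φ 0)
      (P.iterProd k (fun i => A i.succ) fun i => φ i.succ)
    have e3 : (map (h 0) (iterLift k (fun i => A' i.succ) fun κ =>
        (embed k (fun i => A i.succ) κ).comp (h κ.succ)) :
        (A' 0).coprod (iterCoprod k fun i => A' i.succ) →ₙₐ[ℂ]
          (A 0).coprod (iterCoprod k fun i => A i.succ)) =
        iterLift (k + 1) A' fun κ => (embed (k + 1) A κ).comp (h κ) := by
      refine iterCoprod_hom_ext (k + 1) A' fun κ x => ?_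
      refine Eq.trans ?_ (iterLift_embed (k + 1) A' _ κ x).symm
      revert x
      refine Fin.cases (fun x => ?_) (fun i x => ?_) κ
      · exact lift_inl _ _ _
      · exact (lift_inr _ _ _).trans (congrArg inr (iterLift_embed _ _ _ _ _))
    rw [← e3]
    refine Eq.trans ?_ hm
    change P.prod _ _ = P.prod _ _
    rw [← e]

end UniversalProduct

end

noncomputable section

open MultiFacedAlgebra

/-! ### Free multi-faced algebras -/

namespace MultiFacedAlgebra

variable {F : Type v} {X : Type} (col : X → F)

/-- The free non-unital algebra over `X`. -/
abbrev WordAlgebra (X : Type) : Type u := MonoidAlgebra ℂ (ULift.{u} (FreeSemigroup X))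

/-- The homomorphism from the free non-unital algebra given by the images of the letters. -/
def wordLift {R : Type*} [NonUnitalRing R] [Module ℂ R] [IsScalarTower ℂ R R]
    [SMulCommClass ℂ R R] (g : X → R) : WordAlgebra.{u} X →ₙₐ[ℂ] R :=
  MonoidAlgebra.liftMagma ℂ
    ((FreeSemigroup.lift g).comp (MulEquiv.ulift : ULift.{u} (FreeSemigroup X) ≃* _).toMulHom)

/-- A letter, as an element of the free non-unital algebra. -/
def letter (x : X) : WordAlgebra.{u} X := MonoidAlgebra.single ⟨FreeSemigroup.of x⟩ 1

theorem wordLift_letter {R : Type*} [NonUnitalRing R] [Module ℂ R] [IsScalarTower ℂ R R]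
    [SMulCommClass ℂ R R] (g : X → R) (x : X) : wordLift g (letter.{u} x) = g x := by
  simp only [wordLift, letter, MonoidAlgebra.liftMagma_apply_apply]
  simp only [MulEquiv.ulift]
  simp
  exact FreeSemigroup.lift_of g x

theorem wordProd_letter (x : X) (l : List X) :
    wordProd ((x :: l).map letter.{u}) = MonoidAlgebra.single ⟨⟨x, l⟩⟩ 1 := by
  induction l generalizing x with
  | nil => rfl
  | cons y l ih =>
    rw [List.map_cons, List.map_cons, wordProd, ← List.map_cons, ih, letter,
      MonoidAlgebra.single_mul_single]
    simp [FreeSemigroup.of]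
    rfl

theorem word_span_induction {p : WordAlgebra.{u} X → Prop} (h0 : p 0)
    (hadd : ∀ x y, p x → p y → p (x + y)) (hsmul : ∀ (z : ℂ) x, p x → p (z • x))
    (hw : ∀ l : List X, l ≠ [] → p (wordProd (l.map letter))) (x : WordAlgebra.{u} X) : p x := by
  induction x using MonoidAlgebra.induction_linear with
  | zero => exact h0
  | add x y hx hy => exact hadd x y hx hy
  | single a z =>
    have := hsmul z _ (hw (a.down.head :: a.down.tail) (by simp))
    rw [wordProd_letter, MonoidAlgebra.smul_single] at this
    simpa using this

theorem adjoin_letter : NonUnitalAlgebra.adjoin ℂ (Set.range (letter.{u} (X := X))) = ⊤ := by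
  refine eq_top_iff.2 fun x _ => ?_
  induction x using word_span_induction with
  | h0 => exact zero_mem _
  | hadd x y hx hy => exact add_mem (hx trivial) (hy trivial)
  | hsmul z x hx => exact SMulMemClass.smul_mem z (hx trivial)
  | hw l hl =>
    induction l with
    | nil => exact absurd rfl hl
    | cons x l ih =>
      have hx : letter x ∈ NonUnitalAlgebra.adjoin ℂ (Set.range (letter.{u} (X := X))) :=
        NonUnitalAlgebra.subset_adjoin ℂ ⟨x, rfl⟩
      cases l with
      | nil => exact hx
      | cons y l => exact mul_mem hx (ih (by simp) trivial)

/-- The free multi-faced algebra over a set of colored letters. -/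
def freeFaced (col : X → F) : MultiFacedAlgebra.{u} F :=
  ofGenerators (WordAlgebra X) letter col adjoin_letter fun _ _ _ _ _ h =>
    ⟨wordLift fun x => h (col x) ⟨letter x, NonUnitalAlgebra.subset_adjoin ℂ ⟨x, rfl, rfl⟩⟩,
      fun x => wordLift_letter _ x⟩

variable {col}

/-- A letter, as an element of the free multi-faced algebra. -/
def gen (x : X) : freeFaced.{u} col := letter.{u} x

theorem gen_mem (x : X) : (gen x : freeFaced.{u} col) ∈ (freeFaced col).face (col x) :=
  NonUnitalAlgebra.subset_adjoin ℂ (A := WordAlgebra.{u} X) ⟨x, rfl, rfl⟩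

/-- The homomorphism from the free multi-faced algebra given by the images of the letters. -/
def freeLift {R : Type*} [NonUnitalRing R] [Module ℂ R] [IsScalarTower ℂ R R]
    [SMulCommClass ℂ R R] (g : X → R) : freeFaced.{u} col →ₙₐ[ℂ] R :=
  (wordLift g : WordAlgebra.{u} X →ₙₐ[ℂ] R)

@[simp] theorem freeLift_gen {R : Type*} [NonUnitalRing R] [Module ℂ R] [IsScalarTower ℂ R R]
    [SMulCommClass ℂ R R] (g : X → R) (x : X) : freeLift g (gen x : freeFaced.{u} col) = g x :=
  wordLift_letter g x

theorem isMultiFaced_freeLift {B : MultiFacedAlgebra.{u} F} (g : X → B)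
    (hg : ∀ x, g x ∈ B.face (col x)) :
    IsMultiFaced (freeLift g : freeFaced.{u} col →ₙₐ[ℂ] B) := by
  refine isMultiFaced_of_face_eq_adjoin _ (fun c => rfl) ?_
  rintro c _ ⟨x, rfl, rfl⟩
  have := hg x
  rwa [← freeLift_gen (col := col) g x] at this

theorem free_induction {p : freeFaced.{u} col → Prop} (h0 : p 0)
    (hadd : ∀ x y, p x → p y → p (x + y)) (hsmul : ∀ (z : ℂ) x, p x → p (z • x))
    (hw : ∀ l : List X, l ≠ [] → p (wordProd (l.map gen))) (x : freeFaced.{u} col) : p x :=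
  word_span_induction h0 hadd hsmul hw x

theorem free_functional_ext {φ ψ : freeFaced.{u} col →ₗ[ℂ] ℂ}
    (h : ∀ l : List X, l ≠ [] → φ (wordProd (l.map gen)) = ψ (wordProd (l.map gen))) : φ = ψ := by
  refine LinearMap.ext fun x => ?_
  induction x using free_induction with
  | h0 => rw [map_zero, map_zero]
  | hadd x y hx hy => rw [map_add, map_add, hx, hy]
  | hsmul z x hx => rw [map_smul, map_smul, hx]
  | hw l hl => exact h l hl

/-- The functional on the free multi-faced algebra with prescribed values on words. -/
def moments (m : List X → ℂ) : freeFaced.{u} col →ₗ[ℂ] ℂ :=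
  (Finsupp.linearCombination ℂ fun w : ULift.{u} (FreeSemigroup X) =>
      m (w.down.head :: w.down.tail)) ∘ₗ
    (MonoidAlgebra.coeffLinearEquiv ℂ :
      WordAlgebra.{u} X ≃ₗ[ℂ] (ULift.{u} (FreeSemigroup X) →₀ ℂ)).toLinearMap

theorem moments_word (m : List X → ℂ) {l : List X} (hl : l ≠ []) :
    moments m (wordProd (l.map gen) : freeFaced.{u} col) = m l := by
  cases l with
  | nil => exact absurd rfl hl
  | cons x l =>
    refine (congrArg (moments m) (wordProd_letter x l)).trans ?_
    change Finsupp.linearCombination ℂ _ (Finsupp.single _ 1) = _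
    simp

end MultiFacedAlgebra

end

noncomputable section

open MultiFacedAlgebra

/-! ### Values of iterated products on words -/

section Words

variable {R : Type*} [NonUnitalRing R] [Module ℂ R] [IsScalarTower ℂ R R] [SMulCommClass ℂ R R]

theorem wordProd_cons {x : R} {l : List R} (hl : l ≠ []) : wordProd (x :: l) = x * wordProd l := by
  cases l with
  | nil => exact absurd rfl hl
  | cons y l => rfl

theorem wordProd_map_smul {X : Type*} (t : X → ℂ) (g : X → R) (l : List X) :
    wordProd (l.map fun x => t x • g x) = (l.map t).prod • wordProd (l.map g) := by
  induction l with
  | nil => simp [wordProd]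
  | cons x l ih =>
    by_cases hl : l = []
    · simp [hl, wordProd]
    · rw [List.map_cons, List.map_cons, List.map_cons, wordProd_cons (by simpa), wordProd_cons
        (by simpa), ih, List.prod_cons, smul_mul_smul_comm]

theorem wordProd_eq_zero {l : List R} (h : (0 : R) ∈ l) : wordProd l = 0 := by
  apply Unitization.inr_injective (R := ℂ)
  rw [inr_wordProd (List.ne_nil_of_mem h), Unitization.inr_zero]
  exact List.prod_eq_zero (List.mem_map.2 ⟨0, h, rfl⟩)

/-- This allows the content of two neighboring slots of a word to be moved into one of them, the
other one becoming `1`. -/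
theorem prod_ofFn_merge {M : Type*} [Monoid M] {N : ℕ} {i i' : Fin N} (hi : (i' : ℕ) = i + 1)
    {g g' : Fin N → M} (h : ∀ ℓ, ℓ ≠ i → ℓ ≠ i' → g ℓ = g' ℓ) (h2 : g i * g i' = g' i * g' i') :
    (List.ofFn g).prod = (List.ofFn g').prod := by
  induction N with
  | zero => exact i.elim0
  | succ N ih =>
    rw [List.ofFn_succ, List.ofFn_succ, List.prod_cons, List.prod_cons]
    by_cases h0 : i = 0
    · subst h0
      obtain ⟨N, rfl⟩ : ∃ M, N = M + 1 := by
        refine ⟨N - 1, ?_⟩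
        have := i'.2
        simp at hi
        omega
      obtain rfl : i' = Fin.succ 0 := by ext; simpa using hi
      rw [List.ofFn_succ, List.ofFn_succ, List.prod_cons, List.prod_cons, ← mul_assoc, h2,
        mul_assoc]
      congr 4
      ext ℓ
      exact h _ (Fin.succ_ne_zero _) fun e => Fin.succ_ne_zero _ (Fin.succ_injective _ e)
    · obtain ⟨p, rfl⟩ := Fin.exists_succ_eq.2 h0
      have h0' : i' ≠ 0 := by rintro rfl; simp at hi
      obtain ⟨q, rfl⟩ := Fin.exists_succ_eq.2 h0'
      rw [h 0 (Ne.symm h0) (Ne.symm h0')]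
      congr 1
      refine ih (i := p) (i' := q) (by simpa using hi) (fun ℓ hp hq => h _ ?_ ?_) h2
      · simpa using hp
      · simpa using hq

end Words

namespace UniversalProduct

variable {F : Type v} (P : UniversalProduct.{u} F)

theorem uext_iterProd_comp (k : ℕ) (A A' : Fin (k + 1) → MultiFacedAlgebra.{u} F)
    (h : ∀ κ, A' κ →ₙₐ[ℂ] A κ) (hh : ∀ κ, IsMultiFaced (h κ)) (φ : ∀ κ, A κ →ₗ[ℂ] ℂ)
    (x : Unitization ℂ (iterCoprod k A')) :
    uext (P.iterProd k A' (fun κ => φ κ ∘ₗ (h κ : A' κ →ₗ[ℂ] A κ))) x =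
      uext (P.iterProd k A φ) (umap (iterLift k A' fun κ => (embed k A κ).comp (h κ)) x) := by
  rw [uext_umap]
  intro y
  rw [iterProd_comp P k A A' h hh φ]
  rfl

/-- The value of the (unital extension of the) iterated product on a word `x₁ ⋯ x_N`, as a
multilinear map of the letters. -/
def wordValue (k : ℕ) (A : Fin (k + 1) → MultiFacedAlgebra.{u} F) (φ : ∀ κ, A κ →ₗ[ℂ] ℂ)
    {N : ℕ} (b : Fin N → Fin (k + 1)) : MultilinearMap ℂ (fun ℓ => A (b ℓ)) ℂ :=
  (uext (P.iterProd k A φ)).compMultilinearMap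
    ((MultilinearMap.mkPiAlgebraFin ℂ N (Unitization ℂ (iterCoprod k A))).compLinearMap fun ℓ =>
      Unitization.inrHom ℂ ℂ (iterCoprod k A) ∘ₗ
        (embed k A (b ℓ) : A (b ℓ) →ₗ[ℂ] iterCoprod k A))

variable {P} {k N : ℕ} {A A' : Fin (k + 1) → MultiFacedAlgebra.{u} F} {φ : ∀ κ, A κ →ₗ[ℂ] ℂ}
  {b : Fin N → Fin (k + 1)}

theorem wordValue_apply (x : ∀ ℓ, A (b ℓ)) :
    P.wordValue k A φ b x = uext (P.iterProd k A φ)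
      (List.ofFn fun ℓ => (Unitization.inr (embed k A (b ℓ) (x ℓ)) : Unitization ℂ (iterCoprod k A))).prod :=
  rfl

theorem wordValue_comp {ψ : ∀ κ, A' κ →ₗ[ℂ] ℂ} (h : ∀ κ, A' κ →ₙₐ[ℂ] A κ)
    (hh : ∀ κ, IsMultiFaced (h κ)) (hψ : ∀ κ x, ψ κ x = φ κ (h κ x)) (x : ∀ ℓ, A' (b ℓ)) :
    P.wordValue k A' ψ b x = P.wordValue k A φ b fun ℓ => h (b ℓ) (x ℓ) := by
  have : ψ = fun κ => φ κ ∘ₗ (h κ : A' κ →ₗ[ℂ] A κ) := funext fun κ => LinearMap.ext (hψ κ)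
  rw [wordValue_apply, wordValue_apply, this, uext_iterProd_comp P k A A' h hh, map_list_prod,
    List.map_ofFn]
  refine congrArg (fun g => uext (P.iterProd k A φ) (List.ofFn g).prod) (funext fun ℓ => ?_)
  simp

/-! ### The expansion of an iterated product -/

section Expansion

variable {f : Fin N → F}

/-- Words in which every letter occurs at most once. -/
abbrev InjWord (N : ℕ) : Type := {l : List (Fin N) // l.Nodup}

variable (P b f) in
/-- The value of the iterated product on the word of letters, for functionals on free algebras
with given values on words. -/
def freeValue (m : Fin (k + 1) → List (Fin N) → ℂ) : ℂ :=
  P.wordValue k (fun _ => freeFaced f) (fun κ => moments (m κ)) b fun ℓ => gen ℓ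

theorem freeValue_congr {m m' : Fin (k + 1) → List (Fin N) → ℂ}
    (h : ∀ κ l, l ≠ [] → m κ l = m' κ l) : P.freeValue b f m = P.freeValue b f m' := by
  have : (fun κ => moments (m κ) : Fin (k + 1) → freeFaced.{u} f →ₗ[ℂ] ℂ) =
      fun κ => moments (m' κ) := by
    funext κ
    refine free_functional_ext fun l hl => ?_
    rw [moments_word _ hl, moments_word _ hl, h κ l hl]
  rw [freeValue, freeValue, this]

/-- Universality along the homomorphisms that send free letters to the given elements: only the
moments of these elements matter, so all words can be studied over one free algebra. -/
theorem wordValue_eq_freeValue (g : ∀ κ, Fin N → A κ) (hg : ∀ κ ℓ, g κ ℓ ∈ (A κ).face (f ℓ)) :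
    P.wordValue k A φ b (fun ℓ => g (b ℓ) ℓ) =
      P.freeValue b f fun κ l => φ κ (wordProd (l.map (g κ))) := by
  rw [freeValue, wordValue_comp (φ := φ) (fun κ => freeLift (g κ))
    (fun κ => isMultiFaced_freeLift _ (hg κ))]
  · simp
  · intro κ x
    change _ = (φ κ ∘ₗ ((freeLift (g κ) : freeFaced f →ₙₐ[ℂ] A κ) : freeFaced f →ₗ[ℂ] A κ)) x
    refine LinearMap.congr_fun (free_functional_ext fun l hl => ?_) x
    rw [moments_word _ hl, LinearMap.comp_apply]
    change _ = φ κ (freeLift (g κ) _)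
    rw [map_wordProd, List.map_map]
    congr 3
    funext ℓ
    simp

/-- Rescaled letters stay in their faces, so rescaling can be read either as a change of the moments
or, by multilinearity, as a scalar factor. -/
theorem freeValue_smul (t : Fin N → ℂ) (m : Fin (k + 1) → List (Fin N) → ℂ) :
    P.freeValue b f (fun κ l => (l.map t).prod * m κ l) = (∏ ℓ, t ℓ) * P.freeValue b f m := by
  have := wordValue_eq_freeValue (P := P) (b := b) (f := f) (A := fun _ => freeFaced f)
    (φ := fun κ => moments (m κ)) (fun _ ℓ => t ℓ • gen ℓ)
    fun κ ℓ => SMulMemClass.smul_mem _ (gen_mem ℓ)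
  rw [MultilinearMap.map_smul_univ] at this
  rw [freeValue_congr (m' := fun κ l => moments (m κ) (wordProd (l.map fun ℓ => t ℓ •
    (gen ℓ : freeFaced.{u} f)))), ← this]
  · rfl
  · intro κ l hl
    rw [wordProd_map_smul, map_smul, moments_word _ hl, smul_eq_mul]

theorem moments_gen_mul {X : Type} {col : X → F} (m : List X → ℂ) (x : X)
    (z : freeFaced.{u} col) : moments m (gen x * z) = moments (fun l => m (x :: l)) z := by
  have := free_functional_ext (φ := moments m ∘ₗ LinearMap.mulLeft ℂ (gen x : freeFaced.{u} col))
    (ψ := moments fun l => m (x :: l)) fun l hl => by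
      rw [LinearMap.comp_apply, LinearMap.mulLeft_apply, moments_word _ hl,
        ← wordProd_cons (by simpa), ← List.map_cons, moments_word _ (by simp)]
  exact LinearMap.congr_fun this z

open Classical in
-- Expanding the sums of labeled copies gives one term for each labeling of the word, and only the
-- labeling `c` has a nonzero moment. The value `g = 0` is needed in the induction, for a wrong
-- first label.
theorem moments_sum_gen {X J : Type} [Fintype J] {col : X × J → F} (g : ℂ) (l : List X)
    (hl : l ≠ []) (c : List J) (hc : c.length = l.length) (m : List (X × J) → ℂ)
    (hm : ∀ c', c'.length = l.length → m (l.zip c') = if c' = c then g else 0) :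
    moments m (wordProd (l.map fun x => ∑ j, (gen (x, j) : freeFaced.{u} col))) = g := by
  induction l generalizing g c m with
  | nil => exact absurd rfl hl
  | cons x l ih =>
    obtain ⟨j₀, c, rfl⟩ : ∃ j₀ c₀, c = j₀ :: c₀ := by
      cases c with
      | nil => simp at hc
      | cons j₀ c => exact ⟨j₀, c, rfl⟩
    by_cases hl' : l = []
    · subst hl'
      obtain rfl : c = [] := by simpa using hc
      rw [List.map_cons, List.map_nil, wordProd, map_sum]
      have e : ∀ j, moments m (gen (x, j) : freeFaced.{u} col) = if j = j₀ then g else 0 := by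
        intro j
        have := moments_word (col := col) m (l := [(x, j)]) (by simp)
        rw [List.map_cons, List.map_nil, wordProd] at this
        rw [this]
        simpa using hm [j] (by simp)
      simp [e]
    · rw [List.map_cons, wordProd_cons (by simpa), Finset.sum_mul, map_sum]
      simp_rw [moments_gen_mul]
      rw [Finset.sum_eq_single j₀]
      · refine ih g hl' c (by simpa using hc) _ fun c' hc' => ?_
        simpa using hm (j₀ :: c') (by simpa using hc')
      · intro j _ hj
        refine ih 0 hl' c (by simpa using hc) _ fun c' hc' => ?_
        simpa [hj] using hm (j :: c') (by simpa using hc')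
      · simp

/-- Labels of the letters of a word which are not constant on the occurrences of a letter which
occurs more than once. -/
def separatingLabels : List (Fin N) → List (InjWord N)
  | [] => []
  | x :: l => (if x ∈ l then ⟨[], List.nodup_nil⟩ else ⟨[x], List.nodup_singleton x⟩) ::
      separatingLabels l

theorem length_separatingLabels (l : List (Fin N)) : (separatingLabels l).length = l.length := by
  induction l with
  | nil => rfl
  | cons x l ih => simp [separatingLabels, ih]

theorem eq_of_map_eq_separatingLabels {l : List (Fin N)} {j : Fin N → InjWord N}
    (h : l.map j = separatingLabels l) {x : Fin N} (hx : x ∈ l) : (j x).1 = [x] := by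
  induction l with
  | nil => simp at hx
  | cons y l ih =>
    rw [List.map_cons, separatingLabels, List.cons.injEq] at h
    by_cases hxl : x ∈ l
    · exact ih h.2 hxl
    · obtain rfl : x = y := by simpa [hxl] using hx
      rw [h.1, if_neg hxl]

/-- The last occurrence of a letter `x` is labeled `[x]` and every earlier one `[]`, so labels
depending only on the letter rule out repetitions. -/
theorem nodup_of_map_eq_separatingLabels {l : List (Fin N)} {j : Fin N → InjWord N}
    (h : l.map j = separatingLabels l) : l.Nodup := by
  induction l with
  | nil => simp
  | cons y l ih =>
    rw [List.map_cons, separatingLabels, List.cons.injEq] at h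
    refine List.nodup_cons.2 ⟨fun hy => ?_, ih h.2⟩
    have h1 := eq_of_map_eq_separatingLabels h.2 hy
    rw [h.1, if_pos hy] at h1
    simp at h1

open Classical in
/-- Labels of the letters of a word: the word itself, if all letters are different. -/
def wordLabels (l : List (Fin N)) : List (InjWord N) :=
  if h : l.Nodup then List.replicate l.length ⟨l, h⟩ else separatingLabels l

theorem length_wordLabels (l : List (Fin N)) : (wordLabels l).length = l.length := by
  unfold wordLabels
  split_ifs
  · simp
  · exact length_separatingLabels l

/-- For a repetitive word both sides are false: no labeling of letters produces separating labels,
and no `InjWord` is equal to the word. -/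
theorem map_eq_wordLabels_iff {l : List (Fin N)} {j : Fin N → InjWord N} :
    l.map j = wordLabels l ↔ ∀ x ∈ l, (j x).1 = l := by
  unfold wordLabels
  split_ifs with h
  · rw [List.eq_replicate_iff]
    refine ⟨fun h' x hx => congrArg Subtype.val (h'.2 _ (List.mem_map_of_mem hx)),
      fun h' => ⟨by simp, fun y hy => ?_⟩⟩
    obtain ⟨x, hx, rfl⟩ := List.mem_map.1 hy
    exact Subtype.ext (h' x hx)
  · constructor
    · exact fun h' => absurd (nodup_of_map_eq_separatingLabels h') h
    · intro h'
      cases l with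
      | nil => simp at h
      | cons x l => exact absurd (h' x (by simp) ▸ (j x).2) h

open Classical in
-- Replace each letter by the sum of its labeled copies. The functionals `M` carry the moment of a
-- word at the single labeling `wordLabels`, so the sums have the original moments. Multilinearity
-- then gives one term for each choice `j` of labels, and in it only the words that are the common
-- label of all their letters survive.
theorem freeValue_eq_sum (m : Fin (k + 1) → List (Fin N) → ℂ) :
    P.freeValue b f m = ∑ j : Fin N → InjWord N,
      P.freeValue b f fun κ l => if ∀ x ∈ l, (j x).1 = l then m κ l else 0 := by
  let col : Fin N × InjWord N → F := fun y => f y.1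
  let M : Fin (k + 1) → List (Fin N × InjWord N) → ℂ := fun κ l =>
    if l.map Prod.snd = wordLabels (l.map Prod.fst) then m κ (l.map Prod.fst) else 0
  have h1 := wordValue_eq_freeValue (P := P) (b := b) (f := f) (A := fun _ => freeFaced col)
    (φ := fun κ => moments (M κ)) (fun _ ℓ => ∑ j, gen (ℓ, j))
    fun κ ℓ => sum_mem fun j _ => gen_mem (col := col) (ℓ, j)
  rw [MultilinearMap.map_sum] at h1
  have h2 : ∀ j : Fin N → InjWord N, _ := fun j =>
    wordValue_eq_freeValue (P := P) (b := b) (f := f) (A := fun _ => freeFaced col)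
    (φ := fun κ => moments (M κ)) (fun _ ℓ => gen (ℓ, j ℓ)) fun κ ℓ => gen_mem (col := col) (ℓ, j ℓ)
  simp_rw [h2] at h1
  rw [freeValue_congr (m' := fun κ l => moments (M κ) (wordProd (l.map fun ℓ => ∑ j,
    (gen (ℓ, j) : freeFaced.{u} col)))), ← h1]
  · refine Finset.sum_congr rfl fun j _ => freeValue_congr fun κ l hl => ?_
    have : (l.map fun ℓ => (gen (ℓ, j ℓ) : freeFaced.{u} col)) =
        (l.map fun ℓ => (ℓ, j ℓ)).map gen := by simp
    rw [this, moments_word _ (by simpa)]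
    have e1 : (l.map fun ℓ => (ℓ, j ℓ)).map Prod.fst = l := by simp [Function.comp_def]
    have e2 : (l.map fun ℓ => (ℓ, j ℓ)).map Prod.snd = l.map j := by simp [Function.comp_def]
    simp only [M, e1, e2, map_eq_wordLabels_iff]
  · intro κ l hl
    rw [moments_sum_gen (m κ l) l hl (wordLabels l) (length_wordLabels l)]
    intro c' hc'
    simp only [M]
    rw [List.map_fst_zip hc'.ge, List.map_snd_zip hc'.le]
    split_ifs <;> rfl

open Classical in
/-- The functional on words which tests whether a word belongs to the system `j` of words and to
the factor `κ`. -/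
def indicator (b : Fin N → Fin (k + 1)) (j : Fin N → InjWord N) (κ : Fin (k + 1))
    (l : List (Fin N)) : ℂ :=
  if ∀ x ∈ l, b x = κ ∧ (j x).1 = l then 1 else 0

variable (P b f) in
/-- The coefficient of the system `j` of words. -/
def wordCoeff (j : Fin N → InjWord N) : ℂ := P.freeValue b f (indicator b j)

/-- Rescale the letter `x` by `0`. If no word through `x` supports the indicator, the moments do not
change while the value is multiplied by `0`. A supporting word through `x` must be `j x`, lie in one
factor and carry a constant label. -/
theorem wordCoeff_ne_zero {j : Fin N → InjWord N} (h : P.wordCoeff b f j ≠ 0) (x : Fin N) :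
    x ∈ (j x).1 ∧ ∀ y ∈ (j x).1, b y = b x ∧ j y = j x := by
  classical
  by_contra hx
  apply h
  have := freeValue_smul (P := P) (b := b) (f := f) (fun y => if y = x then 0 else 1)
    (indicator b j)
  rw [Finset.prod_eq_zero (Finset.mem_univ x) (by simp), zero_mul] at this
  rw [wordCoeff, ← this]
  refine freeValue_congr fun κ l hl => ?_
  by_cases hxl : x ∈ l
  · have : indicator b j κ l = 0 := by
      rw [indicator, if_neg]
      intro hl'
      have e := (hl' x hxl).2
      refine hx ⟨e ▸ hxl, fun y hy => ?_⟩
      rw [e] at hy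
      exact ⟨(hl' y hy).1.trans (hl' x hxl).1.symm, Subtype.ext ((hl' y hy).2.trans e.symm)⟩
    rw [this, mul_zero]
  · rw [List.prod_eq_one, one_mul]
    intro z hz
    obtain ⟨y, hy, rfl⟩ := List.mem_map.1 hz
    rw [if_neg]
    rintro rfl
    exact hxl hy

open Classical in
/-- The expansion of an iterated product into products of moments. -/
theorem wordValue_eq_sum (a : ∀ κ, Fin N → A κ) (ha : ∀ ℓ, a (b ℓ) ℓ ∈ (A (b ℓ)).face (f ℓ)) :
    P.wordValue k A φ b (fun ℓ => a (b ℓ) ℓ) = ∑ j : Fin N → InjWord N,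
      P.wordCoeff b f j * ∏ ℓ, if (j ℓ).1.head? = some ℓ then
        φ (b ℓ) (wordProd ((j ℓ).1.map (a (b ℓ)))) else 1 := by
  -- Only the entries `a (b ℓ) ℓ` are controlled by `ha`; setting the others to zero also kills the
  -- moments of words that mix factors.
  let g : ∀ κ, Fin N → A κ := fun κ ℓ => if b ℓ = κ then a κ ℓ else 0
  have hg : ∀ κ ℓ, g κ ℓ ∈ (A κ).face (f ℓ) := by
    intro κ ℓ
    by_cases h : b ℓ = κ
    · subst h
      simpa [g] using ha ℓ
    · simp [g, h]
  have h1 : (fun ℓ => a (b ℓ) ℓ) = fun ℓ => g (b ℓ) ℓ := by simp [g]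
  rw [h1, wordValue_eq_freeValue g hg, freeValue_eq_sum]
  refine Finset.sum_congr rfl fun j _ => ?_
  -- The whole moment of a word is charged to its first letter. The moments restricted to the system
  -- `j` are then its indicator with rescaled letters, and the scalars factor out.
  set t : Fin N → ℂ := fun ℓ => if (j ℓ).1.head? = some ℓ then
    φ (b ℓ) (wordProd ((j ℓ).1.map (g (b ℓ)))) else 1 with ht
  have h2 := freeValue_smul (P := P) (b := b) (f := f) t (indicator b j)
  rw [freeValue_congr (m' := fun κ l => (l.map t).prod * indicator b j κ l), h2, mul_comm]
  · by_cases hc : P.wordCoeff b f j = 0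
    · rw [hc, zero_mul]; exact mul_eq_zero_of_left hc _
    congr 1
    refine Finset.prod_congr rfl fun ℓ _ => ?_
    simp only [ht]
    congr 3
    refine List.map_congr_left fun y hy => ?_
    simp only [g]
    rw [if_pos ((wordCoeff_ne_zero hc ℓ).2 y hy).1]
  · intro κ l hl
    by_cases hj : ∀ x ∈ l, (j x).1 = l
    · rw [if_pos hj]
      by_cases hb : ∀ x ∈ l, b x = κ
      · rw [indicator, if_pos fun x hx => ⟨hb x hx, hj x hx⟩, mul_one]
        obtain ⟨x, l, rfl⟩ := List.exists_cons_of_ne_nil hl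
        have hnd : (x :: l).Nodup := hj x (by simp) ▸ (j x).2
        have hp : ((x :: l).map t).prod = t x := by
          rw [List.map_cons, List.prod_cons, List.prod_eq_one, mul_one]
          intro z hz
          obtain ⟨y, hy, rfl⟩ := List.mem_map.1 hz
          simp only [ht]
          rw [if_neg]
          rw [hj y (by simp [hy])]
          simp only [List.head?_cons, Option.some.injEq]
          rintro rfl
          exact (List.nodup_cons.1 hnd).1 hy
        rw [hp]
        have e := hj x (by simp)
        simp only [ht]
        rw [if_pos (by rw [e]; rfl), e, hb x (by simp)]
      · rw [indicator, if_neg fun h => hb fun x hx => (h x hx).1, mul_zero]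
        push Not at hb
        obtain ⟨x, hx, hbx⟩ := hb
        rw [wordProd_eq_zero, map_zero]
        exact List.mem_map.2 ⟨x, hx, by simp [g, hbx]⟩
    · rw [if_neg hj, indicator, if_neg fun h => hj fun x hx => (h x hx).2, mul_zero]

end Expansion

end UniversalProduct

end

/-! ### Neighboring letters, and isolation of a single coefficient -/

noncomputable section

open MultiFacedAlgebra

namespace UniversalProduct

variable {F : Type v} {P : UniversalProduct.{u} F} {k N : ℕ}
  {A : Fin (k + 1) → MultiFacedAlgebra.{u} F} {φ : ∀ κ, A κ →ₗ[ℂ] ℂ}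
  {b : Fin N → Fin (k + 1)} {f : Fin N → F}

/-- Neighboring letters of the same factor and color are neighbors in the words which contribute
to the expansion. -/
theorem adjacent_of_wordCoeff_ne_zero {j : Fin N → InjWord N} (hj : P.wordCoeff b f j ≠ 0)
    {i i' : Fin N} (hi : (i' : ℕ) = i + 1) (hb : b i = b i') (hf : f i = f i') :
    ∃ p q, (j i).1 = p ++ i :: i' :: q := by
  classical
  by_contra hne
  apply hj
  have hii : i ≠ i' := by
    rintro rfl
    omega
  -- In the factor of `i`, substitute the product of the letters `i` and `i'` for `i`; the two
  -- colors agree, so the substitution respects faces. The variant `h₀` below kills the letter `i`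
  -- instead.
  let h : Fin (k + 1) → Fin N → freeFaced.{u} f := fun κ ℓ =>
    if ℓ = i ∧ κ = b i then gen i * gen i' else gen ℓ
  have hmem : ∀ κ ℓ, h κ ℓ ∈ (freeFaced.{u} f).face (f ℓ) := by
    intro κ ℓ
    simp only [h]
    split_ifs with hℓ
    · rw [hℓ.1]
      exact mul_mem (gen_mem i) (hf ▸ gen_mem i')
    · exact gen_mem ℓ
  let h₀ : Fin (k + 1) → Fin N → freeFaced.{u} f := fun κ ℓ =>
    if ℓ = i ∧ κ = b i then 0 else gen ℓ
  have hmem₀ : ∀ κ ℓ, h₀ κ ℓ ∈ (freeFaced.{u} f).face (f ℓ) := by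
    intro κ ℓ
    simp only [h₀]
    split_ifs with hℓ
    · exact zero_mem _
    · exact gen_mem ℓ
  let H : ∀ κ : Fin (k + 1), freeFaced.{u} f →ₙₐ[ℂ] freeFaced.{u} f := fun κ => freeLift (h κ)
  let H₀ : ∀ κ : Fin (k + 1), freeFaced.{u} f →ₙₐ[ℂ] freeFaced.{u} f := fun κ => freeLift (h₀ κ)
  let ψ : Fin (k + 1) → freeFaced.{u} f →ₗ[ℂ] ℂ := fun κ => moments (indicator b j κ)
  let ψ' : Fin (k + 1) → freeFaced.{u} f →ₗ[ℂ] ℂ := fun κ =>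
    ψ κ ∘ₗ (H κ : freeFaced.{u} f →ₗ[ℂ] freeFaced.{u} f)
  -- After the substitution, a word of that factor through `i` contains `i, i'` consecutively, which
  -- `hne` excludes from the support of the indicator. So killing `i` first changes nothing.
  have key : ∀ κ, ψ' κ = ψ' κ ∘ₗ (H₀ κ : freeFaced.{u} f →ₗ[ℂ] freeFaced.{u} f) := by
    intro κ
    refine free_functional_ext fun l hl => ?_
    change ψ κ (H κ _) = ψ κ (H κ (H₀ κ _))
    simp only [map_wordProd, List.map_map]
    by_cases hil : i ∈ l ∧ κ = b i
    · obtain ⟨hil, rfl⟩ := hil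
      have e1 : wordProd (l.map (H (b i) ∘ H₀ (b i) ∘ gen)) =
          (0 : freeFaced.{u} f) :=
        wordProd_eq_zero (List.mem_map.2 ⟨i, hil, by simp [h₀, H₀]⟩)
      rw [e1, map_zero]
      let r : Fin N → List (Fin N) := fun ℓ => if ℓ = i then [i, i'] else [ℓ]
      have e2 : ∀ l : List (Fin N), l ≠ [] → l.flatMap r ≠ [] ∧
          wordProd (l.map (H (b i) ∘ gen)) =
            (wordProd ((l.flatMap r).map gen) : freeFaced.{u} f) := by
        intro l hl
        have hr : ∀ x, r x ≠ [] := fun x => by simp only [r]; split_ifs <;> simp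
        have hne : l.flatMap r ≠ [] := by
          obtain ⟨x, l, rfl⟩ := List.exists_cons_of_ne_nil hl
          simp [hr]
        refine ⟨hne, ?_⟩
        apply Unitization.inr_injective (R := ℂ)
        rw [inr_wordProd (by simpa using hl), inr_wordProd (by simpa using hne)]
        clear hne hl
        induction l with
        | nil => rfl
        | cons x l ih =>
          rw [List.map_cons, List.map_cons, List.prod_cons, ih, List.flatMap_cons, List.map_append,
            List.map_append, List.prod_append]
          congr 1
          by_cases hx : x = i
          · simp [r, h, H, hx]
          · simp [r, h, H, hx]
      rw [(e2 l hl).2]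
      simp only [ψ]
      rw [moments_word _ (e2 l hl).1, indicator, if_neg]
      intro hall
      obtain ⟨p, q, rfl⟩ := List.append_of_mem hil
      refine hne ⟨p.flatMap r, q.flatMap r, ?_⟩
      rw [(hall i (by simp [r])).2]
      simp [r]
    · congr 2
      refine List.map_congr_left fun x hx => ?_
      have : H₀ κ (gen x) = gen x := by
        simp only [H₀, h₀, freeLift_gen]
        rw [if_neg]
        rintro ⟨rfl, rfl⟩
        exact hil ⟨hx, rfl⟩
      simp only [Function.comp_apply, this]
  have e := P.uext_iterProd_comp k (fun _ => freeFaced f) (fun _ => freeFaced f) H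
    (fun κ => isMultiFaced_freeLift _ (hmem κ)) ψ
  have e₀ := P.uext_iterProd_comp k (fun _ => freeFaced f) (fun _ => freeFaced f) H₀
    (fun κ => isMultiFaced_freeLift _ (hmem₀ κ)) ψ'
  let U := Unitization ℂ (iterCoprod k fun _ => freeFaced.{u} f)
  let g : Fin N → U := fun ℓ => Unitization.inr (embed k (fun _ => freeFaced f) (b ℓ) (gen ℓ))
  have h1 : P.wordCoeff b f j = uext (P.iterProd k (fun _ => freeFaced f) ψ) (List.ofFn g).prod :=
    rfl
  -- The slot of `i'` is emptied, and the substitution restores both letters in the slot of `i`.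
  have h2 : (List.ofFn g).prod = umap (iterLift k (fun _ => freeFaced f)
      fun κ => (embed k (fun _ => freeFaced f) κ).comp (H κ))
      (List.ofFn fun ℓ => if ℓ = i' then 1 else g ℓ).prod := by
    rw [map_list_prod, List.map_ofFn]
    refine prod_ofFn_merge hi (fun ℓ hℓ hℓ' => ?_) ?_
    · simp [g, hℓ, hℓ', H, h]
    · simp [g, hii, H, h, hb]
  rw [h1, h2, ← e]
  have hψ : (fun κ => ψ' κ) = fun κ => ψ' κ ∘ₗ (H₀ κ : freeFaced.{u} f →ₗ[ℂ] freeFaced.{u} f) :=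
    funext key
  change uext (P.iterProd k (fun _ => freeFaced f) fun κ => ψ' κ) _ = 0
  rw [hψ, e₀, map_list_prod, List.map_ofFn, List.prod_eq_zero, map_zero]
  rw [List.mem_ofFn]
  refine ⟨i, ?_⟩
  simp [g, hii, H₀, h₀]

open Classical in
/-- If only the words of the system `j` contribute, then the expansion has only one term. -/
theorem wordValue_eq_wordCoeff_mul (a : ∀ κ, Fin N → A κ)
    (ha : ∀ ℓ, a (b ℓ) ℓ ∈ (A (b ℓ)).face (f ℓ)) (j : Fin N → InjWord N)
    (hj : ∀ x, ∀ y ∈ (j x).1, j y = j x)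
    (h : ∀ j' : Fin N → InjWord N, P.wordCoeff b f j' ≠ 0 → ∀ x,
      (∀ y ∈ (j' x).1, b y = b x ∧ j' y = j' x) → x ∈ (j' x).1 →
      φ (b x) (wordProd ((j' x).1.map (a (b x)))) ≠ 0 → ∃ z, j' x = j z) :
    P.wordValue k A φ b (fun ℓ => a (b ℓ) ℓ) =
      P.wordCoeff b f j * ∏ ℓ, if (j ℓ).1.head? = some ℓ then
        φ (b ℓ) (wordProd ((j ℓ).1.map (a (b ℓ)))) else 1 := by
  rw [wordValue_eq_sum a ha]
  refine Finset.sum_eq_single j (fun j' _ hne => ?_) (by simp)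
  by_contra h0
  obtain ⟨hc, hp⟩ := mul_ne_zero_iff.1 h0
  rw [Finset.prod_ne_zero_iff] at hp
  refine hne (funext fun x => ?_)
  have hx := wordCoeff_ne_zero hc x
  -- The moment of the word through `x` appears in the product at the first letter `y` of that word.
  obtain ⟨y, l, hy⟩ := List.exists_cons_of_ne_nil (List.ne_nil_of_mem hx.1)
  have hyx : j' y = j' x := (hx.2 y (by simp [hy])).2
  have := hp y (Finset.mem_univ y)
  rw [if_pos (by rw [hyx, hy]; rfl)] at this
  obtain ⟨z, hz⟩ := h j' hc y (wordCoeff_ne_zero hc y).2 (wordCoeff_ne_zero hc y).1 this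
  rw [hyx] at hz
  rw [hz]
  exact (hj z x (hz ▸ hx.1)).symm

end UniversalProduct

end

noncomputable section

open MultiFacedAlgebra

/-! ### Restricted states -/

/-- For small `t` of either sign the linear term dominates. The imaginary part vanishes identically
in `t`. -/
theorem eq_zero_of_forall_real_nonneg {a r : ℂ} (h : ∀ t : ℝ, 0 ≤ (t : ℂ) * a + (t : ℂ) ^ 2 * r) :
    a = 0 := by
  have hre : ∀ t : ℝ, 0 ≤ t * a.re + t ^ 2 * r.re := by
    intro t
    have := (Complex.nonneg_iff.1 (h t)).1
    rw [← Complex.ofReal_pow, Complex.add_re, Complex.re_ofReal_mul, Complex.re_ofReal_mul] at this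
    exact this
  have him : ∀ t : ℝ, 0 = t * a.im + t ^ 2 * r.im := by
    intro t
    have := (Complex.nonneg_iff.1 (h t)).2
    rw [← Complex.ofReal_pow, Complex.add_im, Complex.im_ofReal_mul, Complex.im_ofReal_mul] at this
    exact this
  apply Complex.ext
  · have hρ : 0 ≤ r.re := by linarith [hre 1, hre (-1)]
    -- The denominator stays positive even if `r.re = 0`, and the value is minus a square.
    have h1 := hre (-a.re / (r.re + 1))
    have h2 : -a.re / (r.re + 1) * a.re + (-a.re / (r.re + 1)) ^ 2 * r.re =
        -(a.re / (r.re + 1)) ^ 2 := by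
      field_simp
      ring
    rw [h2] at h1
    have h3 : (a.re / (r.re + 1)) = 0 := by
      have : (a.re / (r.re + 1)) ^ 2 = 0 := le_antisymm (by linarith) (sq_nonneg _)
      exact pow_eq_zero_iff (two_ne_zero) |>.1 this
    rcases div_eq_zero_iff.1 h3 with h4 | h4
    · simpa using h4
    · linarith
  · have h1 := him 1
    have h2 := him (-1)
    simp only [Complex.zero_im]
    linarith

namespace MultiFacedAlgebra

variable {F : Type v}

section CauchySchwarz

variable {A : MultiFacedAlgebra.{u} F} [StarRing A] [StarModule ℂ A]

/-- Cauchy–Schwarz by perturbation: positivity at `x + z • star y`, with `z` real and then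
imaginary, annihilates the sum and the difference of the two linear terms. All later arguments with
null vectors rest on this. -/
theorem IsRestrictedState.null {φ : A →ₗ[ℂ] ℂ} (hφ : IsRestrictedState φ) {x : Unitization ℂ A}
    (hx : uext φ (star x * x) = 0) (y : Unitization ℂ A) :
    uext φ (y * x) = 0 ∧ uext φ (star x * y) = 0 := by
  have main : ∀ y, uext φ (y * x) = 0 ∧ uext φ (star x * star y) = 0 := by
    intro y
    have hexp : ∀ z : ℂ, 0 ≤ z * uext φ (star x * star y) + star z * uext φ (y * x) +
        (star z * z) * uext φ (y * star y) := by
      intro z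
      have h := hφ (x + z • star y)
      rw [← uext_apply] at h
      have e : star (x + z • star y) * (x + z • star y) = star x * x + z • (star x * star y) +
          star z • (y * x) + (star z * z) • (y * star y) := by
        rw [star_add, star_smul, star_star, add_mul, mul_add, mul_add, smul_mul_smul_comm,
          smul_mul_assoc, mul_smul_comm]
        abel
      rw [e, map_add, map_add, map_add, hx, map_smul, map_smul, map_smul, zero_add] at h
      simpa [smul_eq_mul] using h
    have h1 := eq_zero_of_forall_real_nonneg (a := uext φ (star x * star y) + uext φ (y * x))
      (r := uext φ (y * star y)) fun t => by
        have := hexp t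
        rw [Complex.star_def, Complex.conj_ofReal] at this
        convert this using 1
        ring
    have h2 := eq_zero_of_forall_real_nonneg
      (a := Complex.I * (uext φ (star x * star y) - uext φ (y * x)))
      (r := uext φ (y * star y)) fun t => by
        have := hexp (Complex.I * t)
        rw [Complex.star_def, map_mul (starRingEnd ℂ), Complex.conj_I, Complex.conj_ofReal] at this
        convert this using 1
        linear_combination ((t : ℂ) ^ 2 * uext φ (y * star y)) * Complex.I_mul_I
    have h3 := (mul_eq_zero.1 h2).resolve_left Complex.I_ne_zero
    constructor
    · linear_combination (h1 - h3) / 2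
    · linear_combination (h1 + h3) / 2
  exact ⟨(main y).1, by simpa using (main (star y)).2⟩

theorem isStarFaced_of_face_eq_adjoin (S : F → Set A)
    (hS : ∀ c, A.face c = NonUnitalAlgebra.adjoin ℂ (S c))
    (h : ∀ c, ∀ x ∈ S c, star x ∈ A.face c) : A.IsStarFaced := by
  intro c x hx
  rw [hS] at hx
  induction hx using NonUnitalAlgebra.adjoin_induction with
  | mem x hx => exact h c x hx
  | add x y _ _ hx hy => rw [star_add]; exact add_mem hx hy
  | zero => rw [star_zero]; exact zero_mem _
  | mul x y _ _ hx hy => rw [star_mul]; exact mul_mem hy hx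
  | smul z x _ hx => rw [star_smul]; exact SMulMemClass.smul_mem _ hx

end CauchySchwarz

theorem IsStarFaced.coprod {A B : MultiFacedAlgebra.{u} F} [StarRing A] [StarModule ℂ A]
    [StarRing B] [StarModule ℂ B] (hA : A.IsStarFaced) (hB : B.IsStarFaced) :
    (A.coprod B).IsStarFaced := by
  refine isStarFaced_of_face_eq_adjoin _ (fun c => rfl) ?_
  rintro c _ (⟨a, ha, rfl⟩ | ⟨b, hb, rfl⟩)
  · have := isMultiFaced_inl (B := B) c _ (hA c a ha)
    exact (congrArg (· ∈ (A.coprod B).face c) (FreeProd.star_inl (B := B) a)).mpr this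
  · have := isMultiFaced_inr (A := A) c _ (hB c b hb)
    exact (congrArg (· ∈ (A.coprod B).face c) (FreeProd.star_inr (A := A) b)).mpr this

/-! ### Free multi-faced `*`-algebras -/

section FreeStar

variable {Y : Type} (col : Y → F)

/-- The free multi-faced `*`-algebra over a set of colored letters. -/
def freeStar : MultiFacedAlgebra.{u} F := freeFaced fun y : Y × Bool => col y.1

variable {col}

/-- A letter (if the second entry is `false`) or its adjoint, in the free `*`-algebra. -/
def sgen (y : Y × Bool) : freeStar.{u} col := gen y

theorem sgen_mem (y : Y × Bool) : (sgen y : freeStar.{u} col) ∈ (freeStar col).face (col y.1) :=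
  gen_mem y

theorem freeStar_induction {p : freeStar.{u} col → Prop} (hgen : ∀ y, p (sgen y)) (h0 : p 0)
    (hadd : ∀ x y, p x → p y → p (x + y)) (hsmul : ∀ (z : ℂ) x, p x → p (z • x))
    (hmul : ∀ x y, p x → p y → p (x * y)) (x : freeStar.{u} col) : p x := by
  refine free_induction (col := fun y : Y × Bool => col y.1) (p := p) h0 hadd hsmul
    (fun l hl => ?_) x
  induction l with
  | nil => exact absurd rfl hl
  | cons y l ih =>
    by_cases hl : l = []
    · subst hl; exact hgen y
    · rw [List.map_cons, wordProd_cons (by simpa)]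
      exact hmul _ _ (hgen y) (ih hl)

/-- The involution of the free `*`-algebra, as a homomorphism into the conjugate opposite. -/
def freeStarAux : freeStar.{u} col →ₙₐ[ℂ] ConjOp (freeStar.{u} col) :=
  freeLift (col := fun y : Y × Bool => col y.1) fun y => ConjOp.op (sgen (y.1, !y.2))

instance : Star (freeStar.{u} col) := ⟨fun x => (freeStarAux x).unop⟩

theorem freeStar_star_def (x : freeStar.{u} col) : star x = (freeStarAux x).unop := rfl

theorem star_sgen (y : Y × Bool) : star (sgen y : freeStar.{u} col) = sgen (y.1, !y.2) := by
  rw [freeStar_star_def]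
  exact congrArg ConjOp.unop (freeLift_gen _ y)

instance : StarRing (freeStar.{u} col) where
  star_involutive x := by
    induction x using freeStar_induction with
    | hgen y => rw [star_sgen, star_sgen]; simp
    | h0 =>
      have e : star (0 : freeStar.{u} col) = 0 := by rw [freeStar_star_def, map_zero]; rfl
      rw [e, e]
    | hadd x y hx hy =>
      rw [freeStar_star_def (x + y), map_add, ConjOp.unop_add, freeStar_star_def, map_add,
        ConjOp.unop_add]
      exact congrArg₂ (· + ·) hx hy
    | hmul x y hx hy =>
      rw [freeStar_star_def (x * y), map_mul, ConjOp.unop_mul, freeStar_star_def, map_mul,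
        ConjOp.unop_mul]
      exact congrArg₂ (· * ·) hx hy
    | hsmul z x hx =>
      rw [freeStar_star_def (z • x), map_smul, ConjOp.unop_smul, freeStar_star_def, map_smul,
        ConjOp.unop_smul, star_star]
      exact congrArg (z • ·) hx
  star_mul x y := by
    rw [freeStar_star_def, map_mul, ConjOp.unop_mul]; rfl
  star_add x y := by
    rw [freeStar_star_def, map_add, ConjOp.unop_add]; rfl

instance : StarModule ℂ (freeStar.{u} col) :=
  ⟨fun z x => by rw [freeStar_star_def, map_smul, ConjOp.unop_smul]; rfl⟩

theorem isStarFaced_freeStar : (freeStar.{u} col).IsStarFaced := by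
  refine isStarFaced_of_face_eq_adjoin _ (fun c => rfl) ?_
  rintro _ _ ⟨y, rfl, rfl⟩
  have := sgen_mem (col := col) (y.1, !y.2)
  rwa [← star_sgen] at this

/-! ### Vector states -/

variable {V : Type} [Fintype V] [DecidableEq V]

/-- The `*`-representation of the free `*`-algebra by matrices. -/
def rep (M : Y → Matrix V V ℂ) : freeStar.{u} col →ₙₐ[ℂ] Matrix V V ℂ :=
  freeLift (col := fun y : Y × Bool => col y.1) fun y =>
    if y.2 then (M y.1).conjTranspose else M y.1

@[simp] theorem rep_sgen (M : Y → Matrix V V ℂ) (y : Y × Bool) :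
    rep M (sgen y : freeStar.{u} col) = if y.2 then (M y.1).conjTranspose else M y.1 :=
  freeLift_gen _ y

theorem rep_star (M : Y → Matrix V V ℂ) (x : freeStar.{u} col) :
    rep M (star x) = (rep M x).conjTranspose := by
  induction x using freeStar_induction with
  | hgen y =>
    rw [star_sgen, rep_sgen, rep_sgen]
    cases y.2 <;> simp
  | h0 => simp
  | hadd x y hx hy => rw [star_add, map_add, hx, hy, map_add, Matrix.conjTranspose_add]
  | hmul x y hx hy => rw [star_mul, map_mul, hx, hy, map_mul, Matrix.conjTranspose_mul]
  | hsmul z x hx => rw [star_smul, map_smul, hx, map_smul, Matrix.conjTranspose_smul]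

/-- The unital extension of `rep`. -/
def urep (M : Y → Matrix V V ℂ) : Unitization ℂ (freeStar.{u} col) →ₐ[ℂ] Matrix V V ℂ :=
  Unitization.lift (rep M)

@[simp] theorem urep_inr (M : Y → Matrix V V ℂ) (x : freeStar.{u} col) :
    urep M (x : Unitization ℂ (freeStar.{u} col)) = rep M x := by
  simp [urep]

theorem urep_apply (M : Y → Matrix V V ℂ) (x : Unitization ℂ (freeStar.{u} col)) :
    urep M x = x.fst • 1 + rep M x.snd := by
  conv_lhs => rw [← Unitization.inl_fst_add_inr_snd_eq x]
  rw [map_add, urep_inr, ← Unitization.algebraMap_eq_inl, AlgHom.commutes,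
    Algebra.algebraMap_eq_smul_one]

theorem urep_star (M : Y → Matrix V V ℂ) (x : Unitization ℂ (freeStar.{u} col)) :
    urep M (star x) = (urep M x).conjTranspose := by
  rw [urep_apply, urep_apply, Unitization.fst_star, Unitization.snd_star, rep_star,
    Matrix.conjTranspose_add, Matrix.conjTranspose_smul, Matrix.conjTranspose_one]

/-- The normalized vector functional given by a vector and matrices. -/
def vectorState (M : Y → Matrix V V ℂ) (Ω : V → ℂ) : freeStar.{u} col →ₗ[ℂ] ℂ where
  toFun x := (star Ω ⬝ᵥ Ω)⁻¹ * (star Ω ⬝ᵥ (rep M x).mulVec Ω)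
  map_add' x y := by rw [map_add, Matrix.add_mulVec, dotProduct_add, mul_add]
  map_smul' z x := by
    rw [map_smul, Matrix.smul_mulVec, dotProduct_smul, smul_eq_mul, RingHom.id_apply,
      smul_eq_mul]
    ring

theorem vectorState_apply (M : Y → Matrix V V ℂ) (Ω : V → ℂ) (x : freeStar.{u} col) :
    vectorState M Ω x = (star Ω ⬝ᵥ Ω)⁻¹ * (star Ω ⬝ᵥ (rep M x).mulVec Ω) := rfl

theorem uext_vectorState {M : Y → Matrix V V ℂ} {Ω : V → ℂ} (hΩ : Ω ≠ 0)
    (x : Unitization ℂ (freeStar.{u} col)) :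
    uext (vectorState M Ω) x = (star Ω ⬝ᵥ Ω)⁻¹ * (star Ω ⬝ᵥ (urep M x).mulVec Ω) := by
  have h : star Ω ⬝ᵥ Ω ≠ 0 := fun h => hΩ (dotProduct_star_self_eq_zero.1 h)
  rw [uext_apply, vectorState_apply, urep_apply, Matrix.add_mulVec, dotProduct_add, mul_add,
    Matrix.smul_mulVec, Matrix.one_mulVec, dotProduct_smul, smul_eq_mul, mul_left_comm,
    inv_mul_cancel₀ h, mul_one]

theorem uext_vectorState_star_mul {M : Y → Matrix V V ℂ} {Ω : V → ℂ} (hΩ : Ω ≠ 0)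
    (x y : Unitization ℂ (freeStar.{u} col)) :
    uext (vectorState M Ω) (star x * y) =
      (star Ω ⬝ᵥ Ω)⁻¹ * (star ((urep M x).mulVec Ω) ⬝ᵥ (urep M y).mulVec Ω) := by
  rw [uext_vectorState hΩ, map_mul, urep_star, Matrix.star_mulVec, ← Matrix.mulVec_mulVec,
    Matrix.dotProduct_mulVec]

theorem isRestrictedState_vectorState {M : Y → Matrix V V ℂ} {Ω : V → ℂ} (hΩ : Ω ≠ 0) :
    IsRestrictedState (vectorState M Ω : freeStar.{u} col →ₗ[ℂ] ℂ) := by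
  intro x
  rw [← uext_apply, uext_vectorState_star_mul hΩ]
  exact mul_nonneg (inv_nonneg.2 (dotProduct_star_self_nonneg Ω)) (dotProduct_star_self_nonneg _)

end FreeStar

end MultiFacedAlgebra

namespace UniversalProduct

variable {F : Type v} {P : UniversalProduct.{u} F}

/-- The iterated product of restricted states is a restricted state. -/
theorem Positive.iterProd (hP : P.Positive) (k : ℕ) (A : Fin (k + 1) → MultiFacedAlgebra.{u} F)
    [∀ κ, StarRing (A κ)] [∀ κ, StarModule ℂ (A κ)] (hA : ∀ κ, (A κ).IsStarFaced)
    (φ : ∀ κ, A κ →ₗ[ℂ] ℂ) (hφ : ∀ κ, IsRestrictedState (φ κ)) :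
    ∃ (_ : StarRing (iterCoprod k A)) (_ : StarModule ℂ (iterCoprod k A)),
      (∀ κ x, star (embed k A κ x) = embed k A κ (star x)) ∧ (iterCoprod k A).IsStarFaced ∧
        IsRestrictedState (P.iterProd k A φ) := by
  induction k with
  | zero =>
    refine ⟨inferInstanceAs (StarRing (A 0)), inferInstanceAs (StarModule ℂ (A 0)), ?_, hA 0, hφ 0⟩
    intro κ x
    obtain rfl : κ = 0 := Fin.fin_one_eq_zero κ
    rfl
  | succ k ih =>
    obtain ⟨_, _, h1, h2, h3⟩ := ih (fun i => A i.succ) (fun i => hA i.succ) (fun i => φ i.succ)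
      fun i => hφ i.succ
    refine ⟨inferInstanceAs (StarRing ((A 0).coprod (iterCoprod k fun i => A i.succ))),
      inferInstanceAs (StarModule ℂ ((A 0).coprod (iterCoprod k fun i => A i.succ))), ?_,
      (hA 0).coprod h2, hP _ _ (hA 0) h2 _ _ (hφ 0) h3⟩
    intro κ
    refine Fin.cases (fun x => ?_) (fun i x => ?_) κ
    · exact FreeProd.star_inl x
    · exact (FreeProd.star_inr _).trans (congrArg FreeProd.inr (h1 i x))

end UniversalProduct

end

noncomputable section

open MultiFacedAlgebra

/-! ### States which detect the words of a system -/

section PathModel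

variable {N : ℕ} (W : Fin N → List (Fin N))

/-- The letter `x` acts by shifting backwards along the edges labeled by `x` of disjoint paths,
where the path number `l` has the edges labeled by `W l`. -/
def pathMatrix (x : Fin N) : Matrix (Fin N × Fin (N + 1)) (Fin N × Fin (N + 1)) ℂ :=
  Matrix.of fun p q =>
    if q.1 = p.1 ∧ (q.2 : ℕ) = p.2 + 1 ∧ (W p.1)[(p.2 : ℕ)]? = some x then 1 else 0

/-- The sum of the end points of all paths. -/
def pathVector (p : Fin N × Fin (N + 1)) : ℂ :=
  if (p.2 : ℕ) = 0 ∨ (p.2 : ℕ) = (W p.1).length then 1 else 0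

variable {W}

theorem pathMatrix_mulVec_apply_eq_zero {x : Fin N} {g : Fin N × Fin (N + 1) → ℂ}
    {p : Fin N × Fin (N + 1)}
    (h : (W p.1)[(p.2 : ℕ)]? = some x → ∀ q, q.1 = p.1 → (q.2 : ℕ) = p.2 + 1 → g q = 0) :
    (pathMatrix W x).mulVec g p = 0 := by
  refine Finset.sum_eq_zero fun q _ => ?_
  simp only [pathMatrix, Matrix.of_apply]
  split_ifs with hq
  · rw [h hq.2.2 q hq.1 hq.2.1, mul_zero]
  · rw [zero_mul]

theorem pathMatrix_conjTranspose_mulVec_apply_eq_zero {x : Fin N}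
    {g : Fin N × Fin (N + 1) → ℂ} {p : Fin N × Fin (N + 1)}
    (h : ∀ i : ℕ, (p.2 : ℕ) = i + 1 → (W p.1)[i]? ≠ some x) :
    (pathMatrix W x).conjTranspose.mulVec g p = 0 := by
  refine Finset.sum_eq_zero fun q _ => ?_
  simp only [pathMatrix, Matrix.conjTranspose_apply, Matrix.of_apply]
  rw [if_neg, star_zero, zero_mul]
  rintro ⟨h1, h2, h3⟩
  exact h _ h2 (h1 ▸ h3)

/-- Each letter reads one edge, so the component at a vertex tests whether `v` can be read from
there and arrives at an end point of the path. -/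
theorem pathMatrix_prod_mulVec (hW : ∀ l, (W l).length ≤ N) (v : List (Fin N))
    (p : Fin N × Fin (N + 1)) :
    (v.map (pathMatrix W)).prod.mulVec (pathVector W) p =
      if v <+: (W p.1).drop p.2 ∧
        ((p.2 : ℕ) + v.length = 0 ∨ (p.2 : ℕ) + v.length = (W p.1).length) then 1 else 0 := by
  induction v generalizing p with
  | nil => simp [pathVector]
  | cons x v ih =>
    rw [List.map_cons, List.prod_cons, ← Matrix.mulVec_mulVec]
    by_cases hx : (W p.1)[(p.2 : ℕ)]? = some x
    · obtain ⟨hlt, hx'⟩ := List.getElem?_eq_some_iff.1 hx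
      have hp : (p.2 : ℕ) + 1 < N + 1 := by
        have := hW p.1
        omega
      have e : (pathMatrix W x).mulVec ((v.map (pathMatrix W)).prod.mulVec (pathVector W)) p =
          (v.map (pathMatrix W)).prod.mulVec (pathVector W) (p.1, ⟨p.2 + 1, hp⟩) := by
        refine (Finset.sum_eq_single (p.1, (⟨p.2 + 1, hp⟩ : Fin (N + 1))) (fun q _ hq => ?_)
          (by simp)).trans ?_
        · simp only [pathMatrix, Matrix.of_apply]
          rw [if_neg, zero_mul]
          rintro ⟨h1, h2, -⟩
          exact hq (Prod.ext h1 (Fin.ext h2))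
        · simp [pathMatrix, hx]
      rw [e, ih]
      simp only [List.length_cons]
      rw [List.drop_eq_getElem_cons hlt, hx']
      refine if_congr ?_ rfl rfl
      rw [List.cons_prefix_cons, and_iff_right rfl]
      refine and_congr_right fun _ => or_congr ?_ ?_ <;> omega
    · rw [pathMatrix_mulVec_apply_eq_zero fun h => absurd h hx, if_neg]
      rintro ⟨⟨t, ht⟩, -⟩
      apply hx
      have := congrArg (fun l => l[0]?) ht
      simpa using this.symm

theorem pathVector_ne_zero (l : Fin N) : pathVector W ≠ 0 := by
  intro h
  have := congrFun h (l, 0)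
  simp [pathVector] at this

end PathModel

namespace MultiFacedAlgebra

variable {F : Type v} {N : ℕ} {f : Fin N → F}

theorem rep_wordProd {Y V : Type} [Fintype V] [DecidableEq V] {col : Y → F}
    (M : Y → Matrix V V ℂ) {l : List (freeStar.{u} col)} (hl : l ≠ []) :
    rep M (wordProd l) = (l.map (rep M)).prod := by
  rw [← urep_inr, inr_wordProd hl, map_list_prod, List.map_map]
  congr 2
  funext y
  simp

/-- Up to a nonzero normalization the moment counts the end points from which `v` leads to an end
point. Being nonempty, `v` cannot start at a terminal vertex, so it runs through a whole path. -/
theorem vectorState_path_ne_zero_iff {W : Fin N → List (Fin N)} (hW : ∀ l, (W l).length ≤ N)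
    {v : List (Fin N)} (hv : v ≠ []) :
    vectorState (pathMatrix W) (pathVector W)
      (wordProd (v.map fun x => (sgen (x, false) : freeStar.{u} f))) ≠ 0 ↔ ∃ l, v = W l := by
  classical
  have hΩ : pathVector W ≠ 0 := pathVector_ne_zero (v.head hv)
  have hc : (star (pathVector W) ⬝ᵥ pathVector W)⁻¹ ≠ 0 :=
    inv_ne_zero fun h => hΩ (dotProduct_star_self_eq_zero.1 h)
  have e : (star (pathVector W) ⬝ᵥ ((v.map (pathMatrix W)).prod.mulVec (pathVector W))) =
      ((Finset.univ.filter fun p : Fin N × Fin (N + 1) =>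
        ((p.2 : ℕ) = 0 ∨ (p.2 : ℕ) = (W p.1).length) ∧ v <+: (W p.1).drop p.2 ∧
        ((p.2 : ℕ) + v.length = 0 ∨ (p.2 : ℕ) + v.length = (W p.1).length)).card : ℂ) := by
    rw [dotProduct, ← Finset.sum_boole]
    refine Finset.sum_congr rfl fun p _ => ?_
    rw [pathMatrix_prod_mulVec hW, Pi.star_apply, pathVector]
    split_ifs <;> simp_all
  rw [vectorState_apply, rep_wordProd _ (by simpa), List.map_map]
  have e2 : v.map (rep (pathMatrix W) ∘ fun x => (sgen (x, false) : freeStar.{u} f)) =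
      v.map (pathMatrix W) := List.map_congr_left fun x _ => by simp
  rw [e2, e, mul_ne_zero_iff, and_iff_right hc, Nat.cast_ne_zero, ← Nat.pos_iff_ne_zero,
    Finset.card_pos]
  constructor
  · rintro ⟨p, hp⟩
    obtain ⟨-, h1, h2, h3⟩ := Finset.mem_filter.1 hp
    have hlen := List.length_pos_iff.2 hv
    rcases h1 with h1 | h1
    · rw [h1] at h2 h3
      refine ⟨p.1, h2.eq_of_length ?_⟩
      simp only [List.drop_zero]
      omega
    · rw [h1, List.drop_length, List.prefix_nil] at h2
      exact absurd h2 hv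
  · rintro ⟨l, rfl⟩
    exact ⟨(l, 0), by simp⟩

end MultiFacedAlgebra

namespace UniversalProduct

variable {F : Type v} {P : UniversalProduct.{u} F} {k N : ℕ}
  {b : Fin N → Fin (k + 1)} {f : Fin N → F}

/-- By positivity, only words of increasing letters contribute to the expansion. -/
theorem Positive.sorted_of_wordCoeff_ne_zero (hP : P.Positive) {j : Fin N → InjWord N}
    (hj : P.wordCoeff b f j ≠ 0) (x : Fin N) : (j x).1.Pairwise (· < ·) := by
  classical
  rw [← List.isChain_iff_pairwise, List.isChain_iff_getElem]
  intro i₀ hi₀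
  by_contra hlt
  generalize hwx : j x = wx at hi₀ hlt
  obtain ⟨w, hw⟩ := wx
  dsimp only at hi₀ hlt
  set m := w[i₀] with hm
  set m' := w[i₀ + 1] with hm'
  have hmm : m' < m := by
    refine lt_of_le_of_ne (not_lt.1 hlt) fun h => ?_
    have := (hw.getElem_inj_iff).1 h
    omega
  have hjm : j m = ⟨w, hw⟩ := by
    rw [← hwx]
    exact ((wordCoeff_ne_zero hj x).2 m (by rw [hwx]; exact List.getElem_mem _)).2
  let W : Fin N → List (Fin N) := fun l => if (j l).1.head? = some l then (j l).1 else []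
  have hW : ∀ l, (W l).length ≤ N := by
    intro l
    simp only [W]
    split_ifs
    · simpa using (j l).2.length_le_card
    · simp
  have hWj : ∀ l, W l ≠ [] → W l = (j l).1 := by
    intro l hl
    simp only [W] at hl ⊢
    split_ifs with h
    · rfl
    · simp [h] at hl
  let A : MultiFacedAlgebra.{u} F := freeStar f
  let ψ : A →ₗ[ℂ] ℂ := vectorState (pathMatrix W) (pathVector W)
  have hΩ : pathVector W ≠ 0 := pathVector_ne_zero m
  obtain ⟨_, _, hstar, -, hstate⟩ := hP.iterProd k (fun _ => A) (fun _ => isStarFaced_freeStar)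
    (fun _ => ψ) fun _ => isRestrictedState_vectorState hΩ
  let Z : Fin N × Bool → Unitization ℂ (iterCoprod k fun _ => A) := fun y =>
    Unitization.inr (embed k (fun _ => A) (b y.1) (sgen y))
  have hZ : ∀ y, star (Z y) = Z (y.1, !y.2) := by
    intro y
    simp only [Z]
    rw [← Unitization.inr_star, hstar, ← star_sgen]
  have hV := wordValue_eq_wordCoeff_mul (P := P) (b := b) (f := f) (A := fun _ => A)
    (φ := fun _ => ψ) (fun _ ℓ => sgen (ℓ, false)) (fun ℓ => sgen_mem (ℓ, false)) j
    (fun x y hy => ((wordCoeff_ne_zero hj x).2 y hy).2) (by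
      intro j' _ x _ hx hne
      have hx' := List.ne_nil_of_mem hx
      have hne' : vectorState (pathMatrix W) (pathVector W)
        (wordProd ((j' x).1.map fun x => (sgen (x, false) : freeStar.{u} f))) ≠ 0 := hne
      rw [vectorState_path_ne_zero_iff hW hx'] at hne'
      obtain ⟨l, hl⟩ := hne'
      exact ⟨l, Subtype.ext (hl.trans (hWj l (hl ▸ hx')))⟩)
  have hV0 : P.wordValue k (fun _ => A) (fun _ => ψ) b (fun ℓ => sgen (ℓ, false)) ≠ 0 := by
    rw [hV]
    refine mul_ne_zero hj (Finset.prod_ne_zero_iff.2 fun ℓ _ => ?_)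
    split_ifs with h
    · have hne : (j ℓ).1 ≠ [] := by
        intro h0
        simp [h0] at h
      refine (vectorState_path_ne_zero_iff (f := f) hW hne).2 ⟨ℓ, ?_⟩
      simp only [W]
      rw [if_pos h]
    · exact one_ne_zero
  apply hV0
  -- Cut the word just before the larger letter `m` of the descent `m, m'`. The tail turns out to be
  -- a null vector of the product state, contradicting `hV0`.
  let L := (List.finRange N).drop m
  obtain ⟨L', hL, hL'⟩ : ∃ L', L = m :: L' ∧ ∀ y ∈ L', m < y := by
    refine ⟨(List.finRange N).drop (m + 1), ?_, ?_⟩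
    · have : (m : ℕ) < (List.finRange N).length := by simp
      simp only [L]
      rw [List.drop_eq_getElem_cons this]
      simp
    · intro y hy
      obtain ⟨i, hi, rfl⟩ := List.getElem_of_mem hy
      rw [Fin.lt_def]
      simp
      omega
  rw [wordValue_apply, show (List.ofFn fun ℓ : Fin N => (Unitization.inr
    (embed k (fun _ => A) (b ℓ) (sgen (ℓ, false))) :
      Unitization ℂ (iterCoprod k fun _ => A))) = (List.finRange N).map fun ℓ => Z (ℓ, false) from
      List.ofFn_eq_map, ← List.take_append_drop m (List.finRange N), List.map_append,
    List.prod_append]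
  refine (hstate.null ?_ _).1
  let D : List (Fin N × Bool) := L.reverse.map (fun x => (x, true)) ++ L.map fun x => (x, false)
  have hD : star (L.map fun ℓ => Z (ℓ, false)).prod * (L.map fun ℓ => Z (ℓ, false)).prod =
      (D.map Z).prod := by
    have : ∀ l : List (Fin N), star (l.map fun ℓ => Z (ℓ, false)).prod =
        (l.reverse.map fun ℓ => Z (ℓ, true)).prod := by
      intro l
      induction l with
      | nil => simp
      | cons y l ih => simp [ih, hZ]
    rw [this]
    simp [D, Function.comp_def]
  have hDe : D = L'.reverse.map (fun x => (x, true)) ++ (m, true) :: (m, false) ::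
      L'.map fun x => (x, false) := by
    simp [D, hL]
  have hDn : D.Nodup := by
    have hLn : L.Nodup := (List.nodup_finRange N).sublist (List.drop_sublist _ _)
    refine List.Nodup.append ((List.nodup_reverse.2 hLn).map fun _ _ h => (Prod.ext_iff.1 h).1)
      (hLn.map fun _ _ h => (Prod.ext_iff.1 h).1) ?_
    intro y hy hy'
    obtain ⟨z, -, rfl⟩ := List.mem_map.1 hy
    obtain ⟨z', -, h⟩ := List.mem_map.1 hy'
    simp at h
  change uext _ (star (L.map fun ℓ => Z (ℓ, false)).prod *
    (L.map fun ℓ => Z (ℓ, false)).prod) = 0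
  have hval := wordValue_eq_sum (P := P) (b := fun p : Fin D.length => b (D.get p).1)
    (f := fun p => f (D.get p).1) (A := fun _ => A) (φ := fun _ => ψ)
    (fun _ p => sgen (D.get p)) fun p => sgen_mem (D.get p)
  rw [wordValue_apply] at hval
  have hZD : (List.ofFn fun p : Fin D.length => (Unitization.inr
    (embed k (fun _ => A) (b (D.get p).1) (sgen (D.get p))) :
      Unitization ℂ (iterCoprod k fun _ => A))) = D.map Z := by
    conv_rhs => rw [← List.ofFn_get D, List.map_ofFn]
    rfl
  rw [hZD] at hval
  rw [hD, hval]
  refine Finset.sum_eq_zero fun j' _ => ?_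
  by_cases hj' : P.wordCoeff (fun p : Fin D.length => b (D.get p).1)
    (fun p => f (D.get p).1) j' = 0
  · rw [hj', zero_mul]
  have hlen : D.length = L'.length + (L'.length + 2) := by simp [hDe]
  let i : Fin D.length := ⟨L'.length, by omega⟩
  let i' : Fin D.length := ⟨L'.length + 1, by omega⟩
  have hDi : D.get i = (m, true) := by
    simp only [i, List.get_eq_getElem]
    simp [hDe]
  have hDi' : D.get i' = (m, false) := by
    simp only [i', List.get_eq_getElem]
    simp [hDe]
  -- In the middle of tail-adjoint times tail, the adjoint of `m` is followed by `m`, with the same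
  -- factor and color. So a contributing system has a word in which the two are consecutive.
  obtain ⟨p, q, hpq⟩ := adjacent_of_wordCoeff_ne_zero hj' (i := i) (i' := i') rfl
    (by rw [hDi, hDi']) (by rw [hDi, hDi'])
  have hgood := wordCoeff_ne_zero hj' i
  obtain ⟨y, l, hy⟩ := List.exists_cons_of_ne_nil (List.ne_nil_of_mem hgood.1)
  have hyi : j' y = j' i := (hgood.2 y (by simp [hy])).2
  refine mul_eq_zero_of_right _ (Finset.prod_eq_zero (Finset.mem_univ y) ?_)
  rw [if_pos (by rw [hyi, hy]; rfl), hyi]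
  -- Words do not repeat positions, so what follows consists of later letters or their adjoints, in
  -- any order.
  have hq : ∀ z ∈ q, m < (D.get z).1 := by
    intro z hz
    have hnd := (j' i).2
    rw [hpq] at hnd
    have hnd' := List.nodup_cons.1 (List.nodup_append.1 hnd).2.1
    have hzi : z ≠ i := by
      rintro rfl
      exact hnd'.1 (by simp [hz])
    have hzi' : z ≠ i' := by
      rintro rfl
      exact (List.nodup_cons.1 hnd'.2).1 hz
    have h1 : D.get z ≠ (m, true) := fun h => hzi (hDn.injective_get (h.trans hDi.symm))
    have h2 : D.get z ≠ (m, false) := fun h => hzi' (hDn.injective_get (h.trans hDi'.symm))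
    have h3 := List.get_mem D z
    generalize D.get z = y at h1 h2 h3
    rw [hDe] at h3
    simp only [List.mem_append, List.mem_map, List.mem_cons, List.mem_reverse] at h3
    rcases h3 with ⟨y, hy, rfl⟩ | rfl | rfl | ⟨y, hy, rfl⟩
    · exact hL' y hy
    · exact absurd rfl h1
    · exact absurd rfl h2
    · exact hL' y hy
  have hψ : ∀ z, ψ z = (star (pathVector W) ⬝ᵥ pathVector W)⁻¹ *
    (star (pathVector W) ⬝ᵥ (rep (pathMatrix W) z).mulVec (pathVector W)) := fun z => rfl
  rw [hψ, rep_wordProd _ (by simp [hpq]), hpq, List.map_map, List.map_append, List.map_cons,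
    List.map_cons, List.prod_append, List.prod_cons, List.prod_cons, ← Matrix.mulVec_mulVec,
    ← Matrix.mulVec_mulVec, ← Matrix.mulVec_mulVec]
  -- The letter `m` reads only the edge `i₀` of a path labeled `w`, and the vertex behind it is not
  -- an end point. To continue there, `q` would have to start with `m'` or with the adjoint of `m`,
  -- but its letters are larger than `m`.
  have hzero : (rep (pathMatrix W) (sgen (D.get i') : freeStar.{u} f)).mulVec
      ((q.map (rep (pathMatrix W) ∘ fun z => (sgen (D.get z) : freeStar.{u} f))).prod.mulVec
        (pathVector W)) = 0 := by
    funext p₀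
    rw [hDi', rep_sgen]
    refine pathMatrix_mulVec_apply_eq_zero fun hp₀ r hr1 hr2 => ?_
    have hW0 : W p₀.1 ≠ [] := by
      intro h
      simp [h] at hp₀
    have hWw : W p₀.1 = w := by
      have h1 := hWj _ hW0
      have h2 : m ∈ (j p₀.1).1 := by
        rw [← h1]
        exact List.mem_of_getElem? hp₀
      rw [h1, ← ((wordCoeff_ne_zero hj _).2 m h2).2, hjm]
    rw [hWw] at hp₀
    have hp₀' : (p₀.2 : ℕ) = i₀ := by
      obtain ⟨h1, h2⟩ := List.getElem?_eq_some_iff.1 hp₀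
      exact (hw.getElem_inj_iff).1 (h2.trans hm)
    cases q with
    | nil =>
      simp only [List.map_nil, List.prod_nil, Matrix.one_mulVec, pathVector]
      rw [if_neg]
      rw [hr1, hWw]
      omega
    | cons z q =>
      rw [List.map_cons, List.prod_cons, ← Matrix.mulVec_mulVec, Function.comp_apply, rep_sgen]
      have hz := hq z (by simp)
      split_ifs
      · refine pathMatrix_conjTranspose_mulVec_apply_eq_zero fun n hn => ?_
        obtain rfl : n = i₀ := by omega
        rw [hr1, hWw, List.getElem?_eq_getElem (by omega), ← hm]
        intro h
        rw [Option.some.injEq] at h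
        exact hz.ne h
      · refine pathMatrix_mulVec_apply_eq_zero fun h => ?_
        rw [hr1, hWw, hr2, hp₀', List.getElem?_eq_getElem hi₀, ← hm', Option.some.injEq] at h
        exact absurd (h ▸ hz) hmm.not_gt
  change _ * (_ ⬝ᵥ Matrix.mulVec _ (Matrix.mulVec _
    ((rep (pathMatrix W) (sgen (D.get i') : freeStar.{u} f)).mulVec
      ((q.map (rep (pathMatrix W) ∘ fun z => (sgen (D.get z) : freeStar.{u} f))).prod.mulVec
        (pathVector W))))) = 0
  rw [hzero, Matrix.mulVec_zero, Matrix.mulVec_zero, dotProduct_zero, mul_zero]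

end UniversalProduct

end

noncomputable section

open MultiFacedAlgebra

/-! ### Permutations of the factors of an iterated product -/

namespace UniversalProduct

variable {F : Type v} {P : UniversalProduct.{u} F}

/-- The canonical isomorphism `B ⊔ (A ⊔ C) → A ⊔ (B ⊔ C)`. -/
def exchange (A B C : MultiFacedAlgebra.{u} F) :
    B.coprod (A.coprod C) →ₙₐ[ℂ] A.coprod (B.coprod C) :=
  lift (inr.comp inl) (lift inl (inr.comp inr))

/-- Associativity on both sides reduces the exchange to symmetry of the first two functionals,
transported by universality along the swap and the identity of the third factor. -/
theorem Symmetric.prod_prod (hP : P.Symmetric) {A B C : MultiFacedAlgebra.{u} F}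
    (φ : A →ₗ[ℂ] ℂ) (ψ : B →ₗ[ℂ] ℂ) (χ : C →ₗ[ℂ] ℂ) (x : B.coprod (A.coprod C)) :
    P.prod ψ (P.prod φ χ) x = P.prod φ (P.prod ψ χ) (exchange A B C x) := by
  let inv : B.coprod (A.coprod C) →ₙₐ[ℂ] (B.coprod A).coprod C :=
    lift (inl.comp inl) (lift (inl.comp inr) inr)
  have h1 : ∀ x, assoc B A C (inv x) = x := by
    have : (assoc B A C).comp inv = NonUnitalAlgHom.id ℂ (B.coprod (A.coprod C)) := by
      refine coprod_hom_ext (fun b => by simp [inv, assoc]) fun y => ?_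
      change ((assoc B A C).comp (inv.comp inr)) y = inr y
      have : (assoc B A C).comp (inv.comp inr) = (inr : A.coprod C →ₙₐ[ℂ] B.coprod (A.coprod C)) :=
        coprod_hom_ext (fun a => by simp [inv, assoc]) fun c => by simp [inv, assoc]
      rw [this]
    exact fun x => DFunLike.congr_fun this x
  have h2 : ∀ x, assoc A B C (map (swap B A) (NonUnitalAlgHom.id ℂ C) (inv x)) =
      exchange A B C x := by
    have : (assoc A B C).comp ((map (swap B A) (NonUnitalAlgHom.id ℂ C)).comp inv) =
        exchange A B C := by
      refine coprod_hom_ext (fun b => by simp [inv, assoc, map, swap, exchange]) fun y => ?_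
      change ((assoc A B C).comp ((map (swap B A) (NonUnitalAlgHom.id ℂ C)).comp
        (inv.comp inr))) y = ((exchange A B C).comp inr) y
      have : (assoc A B C).comp ((map (swap B A) (NonUnitalAlgHom.id ℂ C)).comp (inv.comp inr)) =
          (exchange A B C).comp inr :=
        coprod_hom_ext (fun a => by simp [inv, assoc, map, swap, exchange]) fun c => by
          simp [inv, assoc, map, swap, exchange]
      rw [this]
    exact fun x => DFunLike.congr_fun this x
  have e1 := LinearMap.congr_fun (P.associativity ψ φ χ) (inv x)
  have e2 := LinearMap.congr_fun (P.associativity φ ψ χ)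
    (map (swap B A) (NonUnitalAlgHom.id ℂ C) (inv x))
  have e3 := LinearMap.congr_fun (P.universality (swap B A) (NonUnitalAlgHom.id ℂ C)
    isMultiFaced_swap isMultiFaced_id (P.prod φ ψ) χ) (inv x)
  have e4 := hP B A ψ φ
  rw [← e4] at e3
  change _ = P.prod ψ (P.prod φ χ) (assoc B A C (inv x)) at e1
  change _ = P.prod φ (P.prod ψ χ) (assoc A B C _) at e2
  rw [h1] at e1
  rw [h2] at e2
  rw [← e1, ← e2]
  exact e3

/-- The homomorphism between iterated free products of one algebra which permutes the factors. -/
def permute (k : ℕ) (A : MultiFacedAlgebra.{u} F) (σ : Equiv.Perm (Fin (k + 1))) :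
    iterCoprod k (fun _ => A) →ₙₐ[ℂ] iterCoprod k fun _ => A :=
  iterLift k (fun _ => A) fun κ => embed k (fun _ => A) (σ κ)

theorem permute_embed (k : ℕ) (A : MultiFacedAlgebra.{u} F) (σ : Equiv.Perm (Fin (k + 1)))
    (κ : Fin (k + 1)) (x : A) :
    permute k A σ (embed k (fun _ => A) κ x) = embed k (fun _ => A) (σ κ) x :=
  iterLift_embed k (fun _ => A) _ κ x

theorem isMultiFaced_permute (k : ℕ) (A : MultiFacedAlgebra.{u} F)
    (σ : Equiv.Perm (Fin (k + 1))) : IsMultiFaced (permute k A σ) :=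
  isMultiFaced_iterLift _ _ _ fun _ => isMultiFaced_embed _ _ _

/-- Exchanging the two leading factors is symmetry if there are no others and `Symmetric.prod_prod`
otherwise. A later exchange takes place inside the second factor of the outermost product, where
universality lifts the induction hypothesis. -/
theorem Symmetric.iterProd_swap (hP : P.Symmetric) {A : MultiFacedAlgebra.{u} F} (k : ℕ)
    (i : Fin k) (φ : Fin (k + 1) → A →ₗ[ℂ] ℂ) (x : iterCoprod k fun _ => A) :
    P.iterProd k (fun _ => A) (fun κ => φ (Equiv.swap i.castSucc i.succ κ)) x =
      P.iterProd k (fun _ => A) φ (permute k A (Equiv.swap i.castSucc i.succ) x) := by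
  induction k with
  | zero => exact i.elim0
  | succ k ih =>
    refine Fin.cases ?_ (fun i => ?_) i
    · cases k with
      | zero =>
        have e : swap A A = permute 1 A (Equiv.swap 0 1) := by
          refine iterCoprod_hom_ext 1 (fun _ => A) fun κ x => ?_
          refine Eq.trans ?_ (permute_embed 1 A _ κ x).symm
          fin_cases κ
          · exact (lift_inl _ _ _)
          · exact (lift_inr _ _ _)
        have := LinearMap.congr_fun (hP A A (φ 1) (φ 0)) x
        change _ = P.prod (φ 0) (φ 1) (permute 1 A (Equiv.swap 0 1) x)
        rw [← e]
        exact this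
      | succ k =>
        have e : exchange A A (iterCoprod k fun _ => A) =
            permute (k + 2) A (Equiv.swap (Fin.castSucc 0) (Fin.succ 0)) := by
          refine iterCoprod_hom_ext (k + 2) (fun _ => A) fun κ x => ?_
          refine Eq.trans ?_ (permute_embed (k + 2) A _ κ x).symm
          refine Fin.cases ?_ (fun κ => Fin.cases ?_ (fun κ => ?_) κ) κ
          · refine (lift_inl _ _ _).trans ?_
            simp
            rfl
          · refine (lift_inr _ _ _).trans ((lift_inl _ _ _).trans ?_)
            simp
            rfl
          · refine (lift_inr _ _ _).trans ((lift_inr _ _ _).trans ?_)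
            have h0 : Equiv.swap (Fin.castSucc 0) (Fin.succ 0) κ.succ.succ = κ.succ.succ :=
              Equiv.swap_apply_of_ne_of_ne (Fin.succ_ne_zero _)
                (fun h => Fin.succ_ne_zero _ (Fin.succ_injective _ h))
            exact congrArg (fun κ' => embed (k + 2) (fun _ => A) κ' x) h0.symm
        have := hP.prod_prod (φ 0) (φ 1)
          (P.iterProd k (fun _ => A) fun κ => φ κ.succ.succ) x
        rw [e] at this
        refine Eq.trans ?_ this
        have h0 : ∀ κ : Fin (k + 1), Equiv.swap (Fin.castSucc 0) (Fin.succ 0) κ.succ.succ =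
          κ.succ.succ := fun κ => Equiv.swap_apply_of_ne_of_ne (Fin.succ_ne_zero _)
              (fun h => Fin.succ_ne_zero _ (Fin.succ_injective _ h))
        have h1 : (fun κ : Fin (k + 1) => φ (Equiv.swap (Fin.castSucc 0) (Fin.succ 0) κ.succ.succ))
          = fun κ => φ κ.succ.succ := funext fun κ => congrArg φ (h0 κ)
        change P.prod _ (P.prod _ (P.iterProd k (fun _ => A) fun κ : Fin (k + 1) =>
          φ (Equiv.swap (Fin.castSucc 0) (Fin.succ 0) κ.succ.succ))) x = _
        rw [h1]
        rfl
    · have hs0 : Equiv.swap i.succ.castSucc i.succ.succ 0 = 0 :=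
        Equiv.swap_apply_of_ne_of_ne (by simp [Fin.ext_iff]) (Fin.succ_ne_zero _).symm
      have hs : ∀ κ : Fin (k + 1), Equiv.swap i.succ.castSucc i.succ.succ κ.succ =
          (Equiv.swap i.castSucc i.succ κ).succ := by
        intro κ
        rw [← Fin.succ_castSucc]
        exact ((Fin.succ_injective _).swap_apply _ _ _)
      have h1 : (P.iterProd k (fun _ => A)
          fun κ => φ (Equiv.swap i.succ.castSucc i.succ.succ κ.succ)) =
          P.iterProd k (fun _ => A) (fun κ => φ κ.succ) ∘ₗ
            (permute k A (Equiv.swap i.castSucc i.succ) :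
              iterCoprod k (fun _ => A) →ₗ[ℂ] iterCoprod k fun _ => A) := by
        refine LinearMap.ext fun y => ?_
        simp only [hs]
        exact ih i (fun κ => φ κ.succ) y
      have h2 := P.universality (NonUnitalAlgHom.id ℂ A)
        (permute k A (Equiv.swap i.castSucc i.succ)) isMultiFaced_id (isMultiFaced_permute _ _ _)
        (φ 0) (P.iterProd k (fun _ => A) fun κ => φ κ.succ)
      rw [← h1] at h2
      have h3 : map (NonUnitalAlgHom.id ℂ A) (permute k A (Equiv.swap i.castSucc i.succ)) =
          permute (k + 1) A (Equiv.swap i.succ.castSucc i.succ.succ) := by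
        refine iterCoprod_hom_ext (k + 1) (fun _ => A) fun κ x => ?_
        refine Eq.trans ?_ (permute_embed (k + 1) A _ κ x).symm
        refine Fin.cases ?_ (fun κ => ?_) κ
        · rw [hs0]
          exact lift_inl _ _ _
        · rw [hs]
          exact (lift_inr _ _ _).trans (congrArg inr (permute_embed _ _ _ _ _))
      rw [h3] at h2
      have h4 := LinearMap.congr_fun h2 x
      refine Eq.trans ?_ h4
      change P.prod (φ (Equiv.swap i.succ.castSucc i.succ.succ 0)) _ x = _
      rw [hs0]
      rfl

/-- Adjacent transpositions generate the symmetric group as a monoid. -/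
theorem Symmetric.iterProd_permute (hP : P.Symmetric) {A : MultiFacedAlgebra.{u} F} (k : ℕ)
    (σ : Equiv.Perm (Fin (k + 1))) (φ : Fin (k + 1) → A →ₗ[ℂ] ℂ)
    (x : iterCoprod k fun _ => A) :
    P.iterProd k (fun _ => A) (fun κ => φ (σ κ)) x =
      P.iterProd k (fun _ => A) φ (permute k A σ x) := by
  have hσ : σ ∈ Submonoid.closure
      (Set.range fun i : Fin k => Equiv.swap i.castSucc i.succ) := by
    rw [Equiv.Perm.mclosure_swap_castSucc_succ]; trivial
  induction hσ using Submonoid.closure_induction generalizing φ x with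
  | mem σ hσ =>
    obtain ⟨i, rfl⟩ := hσ
    exact hP.iterProd_swap k i φ x
  | one =>
    have : permute k A 1 = NonUnitalAlgHom.id ℂ (iterCoprod k fun _ => A) :=
      iterCoprod_hom_ext k (fun _ => A) fun κ x => permute_embed k A 1 κ x
    rw [this]
    rfl
  | mul σ τ _ _ hσ hτ =>
    have : permute k A (σ * τ) = (permute k A σ).comp (permute k A τ) :=
      iterCoprod_hom_ext k (fun _ => A) fun κ x => by
        rw [permute_embed, NonUnitalAlgHom.comp_apply, permute_embed, permute_embed]; rfl
    rw [this]
    exact (hτ (fun κ => φ (σ κ)) x).trans (hσ φ _)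

/-- The coefficients do not depend on the enumeration of the factors. -/
theorem Symmetric.wordCoeff_permute (hP : P.Symmetric) {k N : ℕ} (b : Fin N → Fin (k + 1))
    (f : Fin N → F) (j : Fin N → InjWord N) (σ : Equiv.Perm (Fin (k + 1))) :
    P.wordCoeff (fun x => σ (b x)) f j = P.wordCoeff b f j := by
  have h : ∀ κ, indicator b j κ = indicator (fun x => σ (b x)) j (σ κ) := by
    intro κ
    funext l
    simp [indicator]
  rw [wordCoeff, wordCoeff, freeValue, freeValue, wordValue_apply, wordValue_apply]
  simp only [h]
  rw [← uext_umap (h := permute k (freeFaced f) σ) (hP.iterProd_permute k σ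
    fun κ => moments (indicator (fun x => σ (b x)) j κ)),
    map_list_prod (umap (permute k (freeFaced f) σ)), List.map_ofFn]
  refine congrArg (fun g => uext _ (List.ofFn g).prod) (funext fun ℓ => ?_)
  simp [permute_embed]

end UniversalProduct

end

noncomputable section

open MultiFacedAlgebra UniversalProduct

/-! ### Systems of increasing words and partitions -/

section FiberWords

variable {N : ℕ} {β γ : Type*}

open Classical in
/-- The system of the increasing words which consist of the letters in the fibers of a map. -/
def fiberWords (b : Fin N → β) (x : Fin N) : InjWord N :=
  ⟨(List.finRange N).filter fun y => b y = b x, (List.nodup_finRange N).filter _⟩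

@[simp] theorem mem_fiberWords {b : Fin N → β} {x y : Fin N} :
    y ∈ (fiberWords b x).1 ↔ b y = b x := by
  simp [fiberWords]

theorem pairwise_fiberWords (b : Fin N → β) (x : Fin N) :
    (fiberWords b x).1.Pairwise (· < ·) :=
  (List.pairwise_lt_finRange N).filter _

theorem fiberWords_eq_iff {b : Fin N → β} {x y : Fin N} :
    fiberWords b x = fiberWords b y ↔ b x = b y := by
  constructor
  · intro h
    have : x ∈ (fiberWords b x).1 := mem_fiberWords.2 rfl
    rw [h] at this
    exact mem_fiberWords.1 this
  · intro h
    exact Subtype.ext ((pairwise_fiberWords b x).eq_of_mem_iff (pairwise_fiberWords b y) fun z => by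
      rw [mem_fiberWords, mem_fiberWords, h])

theorem eq_fiberWords {j : Fin N → InjWord N} (b : Fin N → β)
    (hs : ∀ x, (j x).1.Pairwise (· < ·)) (h : ∀ x y, y ∈ (j x).1 ↔ b y = b x) :
    j = fiberWords b :=
  funext fun x => Subtype.ext ((hs x).eq_of_mem_iff (pairwise_fiberWords b x) fun y => by
    rw [mem_fiberWords, h])

theorem fiberWords_congr {b : Fin N → β} {b' : Fin N → γ} (h : ∀ x y, b x = b y ↔ b' x = b' y) :
    fiberWords b = fiberWords b' :=
  eq_fiberWords _ (pairwise_fiberWords b) fun x y => by rw [mem_fiberWords, h]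

end FiberWords

namespace WordPartition

variable {n : ℕ}

theorem mem_part_iff (π : WordPartition n) {x y : Fin (n + 1)} :
    y ∈ π.part x ↔ π.part y = π.part x :=
  π.mem_part_iff_part_eq_part (Finset.mem_univ _) (Finset.mem_univ _)

theorem part_ofMap {β : Type*} (b : Fin (n + 1) → β) {x y : Fin (n + 1)} :
    (ofMap b).part x = (ofMap b).part y ↔ b x = b y := by
  classical
  rw [← mem_part_iff]
  refine (Finpartition.mem_part_ofSetoid_iff_rel (s := Setoid.ker b)).trans ?_
  exact eq_comm

theorem part_mem_parts (π : WordPartition n) (x : Fin (n + 1)) : π.part x ∈ π.parts :=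
  π.part_mem.2 (Finset.mem_univ x)

theorem ext_part {π π' : WordPartition n}
    (h : ∀ x y, π.part x = π.part y ↔ π'.part x = π'.part y) : π = π' := by
  have h1 : ∀ x, π.part x = π'.part x := fun x => Finset.ext fun y => by
    rw [mem_part_iff, mem_part_iff, h]
  refine Finpartition.ext (Finset.ext fun β => ⟨fun hβ => ?_, fun hβ => ?_⟩)
  · obtain ⟨x, hx⟩ := π.nonempty_of_mem_parts hβ
    rw [← π.part_eq_of_mem hβ hx, h1]
    exact part_mem_parts _ _
  · obtain ⟨x, hx⟩ := π'.nonempty_of_mem_parts hβ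
    rw [← π'.part_eq_of_mem hβ hx, ← h1]
    exact part_mem_parts _ _

theorem fiberWords_part (π : WordPartition n) (x : Fin (n + 1)) :
    (fiberWords π.part x).1 = (π.part x).sort (· ≤ ·) :=
  (pairwise_fiberWords _ _).eq_of_mem_iff (Finset.sortedLT_sort _).pairwise fun y => by
    rw [mem_fiberWords, Finset.mem_sort, mem_part_iff]

theorem card_parts (n : ℕ) (π : WordPartition n) :
    π.parts.card = π.parts.card - 1 + 1 :=
  (Nat.succ_pred_eq_of_pos (Finset.card_pos.2 ⟨_, π.part_mem_parts 0⟩)).symm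

open Classical in
/-- Products over the blocks of a partition as products over the first legs of the blocks. -/
theorem prod_blocks (π : WordPartition n) {k : ℕ} (b : Fin (n + 1) → Fin (k + 1))
    (hb : ∀ β ∈ π.parts, ∃ κ, ∀ ℓ ∈ β, b ℓ = κ) (Y : Fin (k + 1) → List (Fin (n + 1)) → ℂ) :
    ∏ κ, ∏ β ∈ π.parts with ∀ ℓ ∈ β, b ℓ = κ, Y κ (β.sort (· ≤ ·)) =
      ∏ ℓ, if (fiberWords π.part ℓ).1.head? = some ℓ then Y (b ℓ) (fiberWords π.part ℓ).1
        else 1 := by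
  simp_rw [Finset.prod_filter]
  rw [Finset.prod_comm, ← Finset.prod_fiberwise_of_maps_to (t := π.parts) (g := π.part)
    fun x _ => part_mem_parts π x]
  refine Finset.prod_congr rfl fun β hβ => ?_
  obtain ⟨x, hx⟩ := π.nonempty_of_mem_parts hβ
  obtain ⟨m, l, hm⟩ : ∃ m l, (fiberWords π.part x).1 = m :: l :=
    List.exists_cons_of_ne_nil (List.ne_nil_of_mem (a := x) (by simp))
  have hx' := π.part_eq_of_mem hβ hx
  have hmx : π.part m = π.part x := mem_fiberWords.1 (hm ▸ List.mem_cons_self)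
  have hmβ : m ∈ β := by rw [← hx', mem_part_iff, hmx]
  rw [Finset.prod_eq_single (b m), Finset.prod_eq_single m, if_pos, if_pos,
    fiberWords_eq_iff.2 hmx, fiberWords_part, hx']
  · rw [fiberWords_eq_iff.2 hmx, hm]; rfl
  · obtain ⟨κ, hκ⟩ := hb β hβ
    exact fun ℓ hℓ => (hκ ℓ hℓ).trans (hκ m hmβ).symm
  · intro ℓ hℓ hne
    rw [if_neg]
    rw [fiberWords_eq_iff.2 ((Finset.mem_filter.1 hℓ).2.trans hx'.symm), hm]
    exact fun h => hne (Option.some.inj h).symm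
  · intro h
    exact absurd (Finset.mem_filter.2 ⟨Finset.mem_univ m, hmx.trans hx'⟩) h
  · intro κ _ hκ
    rw [if_neg]
    exact fun h => hκ (h m hmβ).symm
  · simp

end WordPartition

namespace UniversalProduct

variable {F : Type v} {P : UniversalProduct.{u} F}

/-- Increasing words are determined by their sets of letters, and these sets are the fibers of the
labeling `j` itself. Thus contributing systems amount to set partitions. -/
theorem Positive.eq_fiberWords_of_wordCoeff_ne_zero (hP : P.Positive) {k N : ℕ}
    {b : Fin N → Fin (k + 1)} {f : Fin N → F} {j : Fin N → InjWord N}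
    (hj : P.wordCoeff b f j ≠ 0) : j = fiberWords j := by
  refine eq_fiberWords j (hP.sorted_of_wordCoeff_ne_zero hj) fun x y => ⟨fun h => ?_, fun h => ?_⟩
  · exact ((wordCoeff_ne_zero hj x).2 y h).2
  · rw [← h]
    exact (wordCoeff_ne_zero hj y).1

theorem iterProd_wordProd_eq_wordValue {k n : ℕ} (A : Fin (k + 1) → MultiFacedAlgebra.{u} F)
    (φ : ∀ κ, A κ →ₗ[ℂ] ℂ) (b : Fin (n + 1) → Fin (k + 1)) (x : ∀ ℓ, A (b ℓ)) :
    P.iterProd k A φ (wordProd (List.ofFn fun ℓ => embed k A (b ℓ) (x ℓ))) =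
      P.wordValue k A φ b x := by
  rw [wordValue_apply, ← uext_inr, inr_wordProd (by simp), List.map_ofFn]
  rfl

variable (P) in
/-- The coefficients of a positive universal product. -/
def partitionCoeff : CoefficientFamily F := fun _ _ s π =>
  P.wordCoeff (fun ℓ => (s ℓ).1) (fun ℓ => (s ℓ).2) (fiberWords π.part)

/-- The expansion over systems of words is reindexed along the injection from partitions to their
systems of increasing words. A system that does not come from an adapted partition has coefficient
zero, by positivity and by adjacency of equal neighbors. -/
theorem Positive.hasCoefficients (hP : P.Positive) : P.HasCoefficients P.partitionCoeff := by
  classical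
  intro k n s A φ a ha
  rw [iterProd_wordProd_eq_wordValue A φ (fun ℓ => (s ℓ).1) fun ℓ => a (s ℓ).1 ℓ,
    wordValue_eq_sum (f := fun ℓ => (s ℓ).2) a ha]
  symm
  refine Finset.sum_of_injOn (fun π : WordPartition n => fiberWords π.part) ?_ (by simp) ?_ ?_
  · intro π _ π' _ h
    refine WordPartition.ext_part fun x y => ?_
    rw [← fiberWords_eq_iff, ← fiberWords_eq_iff (b := π'.part)]
    exact iff_of_eq (congrArg (fun j : Fin (n + 1) → InjWord (n + 1) => j x = j y) h)
  · intro j _ hj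
    by_contra h0
    have hc := left_ne_zero_of_mul h0
    have hjf := hP.eq_fiberWords_of_wordCoeff_ne_zero hc
    have hpart : fiberWords (WordPartition.ofMap j).part = j :=
      (fiberWords_congr fun x y => WordPartition.part_ofMap j).trans hjf.symm
    refine hj ⟨WordPartition.ofMap j, ?_, hpart⟩
    refine Finset.mem_coe.2 (Finset.mem_filter.2 ⟨Finset.mem_univ _, ?_, ?_⟩)
    · intro β hβ
      obtain ⟨x, hx⟩ := (WordPartition.ofMap j).nonempty_of_mem_parts hβ
      refine ⟨(s x).1, fun y hy => ?_⟩
      rw [← Finpartition.part_eq_of_mem _ hβ hx, WordPartition.mem_part_iff,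
        WordPartition.part_ofMap] at hy
      exact ((wordCoeff_ne_zero hc x).2 y (hy ▸ (wordCoeff_ne_zero hc y).1)).1
    · intro i hi
      obtain ⟨p, q, hpq⟩ := adjacent_of_wordCoeff_ne_zero hc (i := i.castSucc) (i' := i.succ)
        (by simp) (congrArg Prod.fst hi) (congrArg Prod.snd hi)
      refine ⟨(WordPartition.ofMap j).part i.castSucc, WordPartition.part_mem_parts _ _,
        (WordPartition.mem_part_iff _).2 rfl, ?_⟩
      rw [WordPartition.mem_part_iff, WordPartition.part_ofMap]
      exact ((wordCoeff_ne_zero hc i.castSucc).2 i.succ (by simp [hpq])).2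
  · intro π hπ
    rw [partitionCoeff, π.prod_blocks (fun ℓ => (s ℓ).1) (Finset.mem_filter.1 hπ).2.1
      fun κ l => φ κ (wordProd (l.map (a κ)))]

/-- The coefficients of the maximal partitions are determined by the universal product. -/
theorem HasCoefficients.eq_wordCoeff {α : CoefficientFamily F} (hα : P.HasCoefficients α)
    {k n : ℕ} (s : Fin (n + 1) → Fin (k + 1) × F) (π : WordPartition n)
    (h : ∀ x y, π.part x = π.part y ↔ (s x).1 = (s y).1) :
    α k n s π =
      P.wordCoeff (fun ℓ => (s ℓ).1) (fun ℓ => (s ℓ).2) (fiberWords fun ℓ => (s ℓ).1) := by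
  classical
  -- Test on the indicators of the blocks of `π`: its own term has product `1`, and every other
  -- partition meets a vanishing moment.
  have h1 := hα k n s (fun _ => freeFaced fun ℓ => (s ℓ).2)
    (fun κ => moments (indicator (fun ℓ => (s ℓ).1) (fiberWords fun ℓ => (s ℓ).1) κ))
    (fun _ ℓ => gen ℓ) fun ℓ => gen_mem ℓ
  rw [iterProd_wordProd_eq_wordValue (fun _ => freeFaced fun ℓ => (s ℓ).2) _
    (fun ℓ => (s ℓ).1) fun ℓ => gen ℓ] at h1
  have hsort : ∀ β ∈ π.parts, ∀ x ∈ β,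
      (fiberWords (fun ℓ => (s ℓ).1) x).1 = β.sort (· ≤ ·) := by
    intro β hβ x hx
    rw [← π.part_eq_of_mem hβ hx, ← π.fiberWords_part, fiberWords_congr h]
  refine (h1.trans ?_).symm
  rw [Finset.sum_eq_single π, Finset.prod_eq_one, mul_one]
  · intro κ _
    refine Finset.prod_eq_one fun β hβ => ?_
    obtain ⟨hβ, hκ⟩ := Finset.mem_filter.1 hβ
    obtain ⟨x, hx⟩ := π.nonempty_of_mem_parts hβ
    rw [moments_word _ (List.ne_nil_of_mem ((Finset.mem_sort _).2 hx)), indicator, if_pos]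
    intro y hy
    rw [Finset.mem_sort] at hy
    exact ⟨hκ y hy, hsort β hβ y hy⟩
  · intro π' hπ' hne
    have hπ'b := (Finset.mem_filter.1 hπ').2.1
    by_contra h0
    have hp := right_ne_zero_of_mul h0
    rw [π'.prod_blocks (fun ℓ => (s ℓ).1) hπ'b fun κ l =>
      moments (indicator (fun ℓ => (s ℓ).1) (fiberWords fun ℓ => (s ℓ).1) κ)
        (wordProd (l.map gen)), Finset.prod_ne_zero_iff] at hp
    refine hne (WordPartition.ext_part fun x y => ?_)
    have key : ∀ x, fiberWords π'.part x = fiberWords (fun ℓ => (s ℓ).1) x := by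
      intro x
      obtain ⟨m, l, hm⟩ : ∃ m l, (fiberWords π'.part x).1 = m :: l :=
        List.exists_cons_of_ne_nil (List.ne_nil_of_mem (a := x) (by simp))
      have hmx : π'.part m = π'.part x := mem_fiberWords.1 (hm ▸ List.mem_cons_self)
      have := hp m (Finset.mem_univ m)
      rw [if_pos (by rw [fiberWords_eq_iff.2 hmx, hm]; rfl), fiberWords_eq_iff.2 hmx,
        moments_word _ (List.ne_nil_of_mem (a := x) (by simp)), indicator] at this
      exact (Subtype.ext ((ite_ne_right_iff.1 this).1 x (by simp)).2).symm
    rw [← fiberWords_eq_iff, ← fiberWords_eq_iff (b := π.part), key, key, fiberWords_eq_iff,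
      fiberWords_eq_iff, h]
  · intro hπ
    exfalso
    refine hπ (Finset.mem_filter.2 ⟨Finset.mem_univ π, ?_, ?_⟩)
    · intro β hβ
      obtain ⟨x, hx⟩ := π.nonempty_of_mem_parts hβ
      refine ⟨(s x).1, fun y hy => ?_⟩
      rwa [← π.part_eq_of_mem hβ hx, WordPartition.mem_part_iff, h] at hy
    · intro i hi
      refine ⟨π.part i.castSucc, WordPartition.part_mem_parts _ _,
        (WordPartition.mem_part_iff _).2 rfl, ?_⟩
      rw [WordPartition.mem_part_iff, h, hi]

/-- The highest coefficients do not depend on the enumeration of the blocks. -/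
theorem Symmetric.wordCoeff_fiberWords_congr (hP : P.Symmetric) {N k k' : ℕ} (f : Fin N → F)
    {b : Fin N → Fin (k + 1)} {b' : Fin N → Fin (k' + 1)} (hb : Function.Surjective b)
    (hb' : Function.Surjective b') (h : ∀ x y, b x = b y ↔ b' x = b' y) :
    P.wordCoeff b f (fiberWords b) = P.wordCoeff b' f (fiberWords b') := by
  let σ : Fin (k + 1) → Fin (k' + 1) := fun κ => b' (Function.surjInv hb κ)
  have hσ : ∀ x, σ (b x) = b' x := fun x => (h _ _).1 (Function.surjInv_eq hb _)
  have hbij : Function.Bijective σ := by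
    refine ⟨fun κ κ' hκ => ?_, fun κ => ?_⟩
    · have := (h _ _).2 hκ
      rwa [Function.surjInv_eq hb, Function.surjInv_eq hb] at this
    · obtain ⟨x, rfl⟩ := hb' κ
      exact ⟨b x, hσ x⟩
  obtain rfl : k = k' := by simpa using Fintype.card_of_bijective hbij
  rw [← hP.wordCoeff_permute b f (fiberWords b) (Equiv.ofBijective σ hbij), fiberWords_congr h]
  refine congrArg (fun b => P.wordCoeff b f (fiberWords b')) (funext hσ)

/-- An enumeration of the blocks of a partition, as a map of the legs. -/
def blockIndex {n : ℕ} (π : WordPartition n) (ℓ : Fin (n + 1)) : Fin (π.parts.card - 1 + 1) :=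
  finCongr (WordPartition.card_parts n π) (π.parts.equivFin ⟨π.part ℓ, π.part_mem_parts ℓ⟩)

theorem blockIndex_eq_iff {n : ℕ} (π : WordPartition n) {x y : Fin (n + 1)} :
    blockIndex π x = blockIndex π y ↔ π.part x = π.part y := by
  simp [blockIndex]

theorem surjective_part_index {n : ℕ} (π : WordPartition n) {β : Type*} (e : π.parts ≃ β) :
    Function.Surjective fun ℓ => e ⟨π.part ℓ, π.part_mem_parts ℓ⟩ := by
  intro κ
  obtain ⟨⟨β, hβ⟩, rfl⟩ := e.surjective κ
  obtain ⟨x, hx⟩ := π.nonempty_of_mem_parts hβ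
  exact ⟨x, congrArg e (Subtype.ext (π.part_eq_of_mem hβ hx))⟩

theorem surjective_blockIndex {n : ℕ} (π : WordPartition n) :
    Function.Surjective (blockIndex π) :=
  surjective_part_index π
    (π.parts.equivFin.trans (finCongr (WordPartition.card_parts n π)))

variable (P) in
/-- The highest coefficients. -/
def highestCoeff : Weights F := fun _ f π =>
  P.wordCoeff (blockIndex π) f (fiberWords (blockIndex π))

theorem Symmetric.highestCoeff_eq (hP : P.Symmetric) {n k : ℕ} (f : Fin (n + 1) → F)
    (π : WordPartition n) {b : Fin (n + 1) → Fin (k + 1)} (hb : Function.Surjective b)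
    (h : ∀ x y, π.part x = π.part y ↔ b x = b y) :
    P.highestCoeff n f π = P.wordCoeff b f (fiberWords b) :=
  hP.wordCoeff_fiberWords_congr f (surjective_blockIndex π) hb fun x y => by
    rw [blockIndex_eq_iff, h]

theorem Positive.hasHighestCoefficients (hP : P.Positive) (hsymm : P.Symmetric) :
    P.HasHighestCoefficients P.highestCoeff := by
  refine ⟨P.partitionCoeff, hP.hasCoefficients, fun k n f π e => ?_⟩
  rw [hsymm.highestCoeff_eq f π (surjective_part_index π e.symm) (by simp), partitionCoeff]
  congr 1
  exact fiberWords_congr (by simp)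

/-- One enumeration of the blocks determines the weight, so uniqueness depends on neither positivity
nor symmetry. -/
theorem HasHighestCoefficients.eq_highestCoeff {w : Weights F}
    (hw : P.HasHighestCoefficients w) : w = P.highestCoeff := by
  obtain ⟨α, hα, hw⟩ := hw
  funext n f π
  rw [hw (π.parts.card - 1) n f π
    (π.parts.equivFin.trans (finCongr (WordPartition.card_parts n π))).symm]
  rw [hα.eq_wordCoeff _ π (by simp)]
  rfl

end UniversalProduct

end

noncomputable section

open MultiFacedAlgebra UniversalProduct

/-! ### Words in a product of two functionals -/

namespace UniversalProduct

variable {F : Type v} {P : UniversalProduct.{u} F}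

section Pair

variable {A B : MultiFacedAlgebra.{u} F}

/-- Two multi-faced algebras, as a family. -/
def pairAlg (A B : MultiFacedAlgebra.{u} F) (κ : Fin 2) : MultiFacedAlgebra.{u} F :=
  Fin.cases A (fun _ => B) κ

/-- Two functionals, as a family. -/
def pairFun (φ : A →ₗ[ℂ] ℂ) (ψ : B →ₗ[ℂ] ℂ) (κ : Fin 2) : pairAlg A B κ →ₗ[ℂ] ℂ :=
  Fin.cases (motive := fun κ => pairAlg A B κ →ₗ[ℂ] ℂ) φ (fun _ => ψ) κ

/-- Two families of elements of algebras, as a family. -/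
def pairElem {N : ℕ} (a : Fin N → A) (a' : Fin N → B) (κ : Fin 2) : Fin N → pairAlg A B κ :=
  Fin.cases (motive := fun κ => Fin N → pairAlg A B κ) a (fun _ => a') κ

/-- A letter of a word in a free product, which belongs to the first factor if `κ = 0`. -/
def pairLetter (κ : Fin 2) (x : A) (y : B) : Unitization ℂ (A.coprod B) :=
  if κ = 0 then Unitization.inr (inl x) else Unitization.inr (inr y)

variable {N : ℕ} {b : Fin N → Fin 2} {f : Fin N → F} {a : Fin N → A} {a' : Fin N → B}
  (φ : A →ₗ[ℂ] ℂ) (ψ : B →ₗ[ℂ] ℂ)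

theorem prod_word_eq_wordValue :
    uext (P.prod φ ψ) (List.ofFn fun ℓ => pairLetter (b ℓ) (a ℓ) (a' ℓ)).prod =
      P.wordValue 1 (pairAlg A B) (pairFun φ ψ) b fun ℓ => pairElem a a' (b ℓ) ℓ := by
  rw [wordValue_apply]
  refine congrArg (fun g => uext (P.prod φ ψ) (List.ofFn g).prod) (funext fun ℓ => ?_)
  generalize b ℓ = κ
  refine Fin.cases ?_ (fun i => ?_) κ
  · rfl
  · obtain rfl : i = 0 := Fin.fin_one_eq_zero i
    rfl

theorem pairElem_mem (ha : ∀ ℓ, b ℓ = 0 → a ℓ ∈ A.face (f ℓ))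
    (ha' : ∀ ℓ, b ℓ ≠ 0 → a' ℓ ∈ B.face (f ℓ)) (ℓ : Fin N) :
    pairElem a a' (b ℓ) ℓ ∈ (pairAlg A B (b ℓ)).face (f ℓ) := by
  have h0 := ha ℓ
  have h1 := ha' ℓ
  revert h0 h1
  generalize b ℓ = κ
  refine Fin.cases (fun h _ => h rfl) (fun i _ h => h (Fin.succ_ne_zero i)) κ

theorem pairFun_wordProd (κ : Fin 2) (l : List (Fin N)) :
    pairFun φ ψ κ (wordProd (l.map (pairElem a a' κ))) =
      if κ = 0 then φ (wordProd (l.map a)) else ψ (wordProd (l.map a')) := by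
  refine Fin.cases ?_ (fun i => ?_) κ
  · rfl
  · rw [if_neg (Fin.succ_ne_zero i)]
    rfl

open Classical in
theorem prod_word_eq_sum (ha : ∀ ℓ, b ℓ = 0 → a ℓ ∈ A.face (f ℓ))
    (ha' : ∀ ℓ, b ℓ ≠ 0 → a' ℓ ∈ B.face (f ℓ)) :
    uext (P.prod φ ψ) (List.ofFn fun ℓ => pairLetter (b ℓ) (a ℓ) (a' ℓ)).prod =
      ∑ j, P.wordCoeff b f j * ∏ ℓ, if (j ℓ).1.head? = some ℓ then
        (if b ℓ = 0 then φ (wordProd ((j ℓ).1.map a)) else ψ (wordProd ((j ℓ).1.map a'))) else 1 := by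
  rw [prod_word_eq_wordValue, wordValue_eq_sum (f := f) _ (pairElem_mem ha ha')]
  simp only [pairFun_wordProd]

open Classical in
theorem prod_word_eq_wordCoeff_mul (ha : ∀ ℓ, b ℓ = 0 → a ℓ ∈ A.face (f ℓ))
    (ha' : ∀ ℓ, b ℓ ≠ 0 → a' ℓ ∈ B.face (f ℓ)) (j : Fin N → InjWord N)
    (hj : ∀ x, ∀ y ∈ (j x).1, j y = j x)
    (h : ∀ j' : Fin N → InjWord N, P.wordCoeff b f j' ≠ 0 → ∀ x,
      (if b x = 0 then φ (wordProd ((j' x).1.map a)) else ψ (wordProd ((j' x).1.map a'))) ≠ 0 →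
        ∃ z, j' x = j z) :
    uext (P.prod φ ψ) (List.ofFn fun ℓ => pairLetter (b ℓ) (a ℓ) (a' ℓ)).prod =
      P.wordCoeff b f j * ∏ ℓ, if (j ℓ).1.head? = some ℓ then
        (if b ℓ = 0 then φ (wordProd ((j ℓ).1.map a)) else ψ (wordProd ((j ℓ).1.map a'))) else 1 := by
  rw [prod_word_eq_wordValue, wordValue_eq_wordCoeff_mul (f := f) _ (pairElem_mem ha ha') j hj]
  · simp only [pairFun_wordProd]
  · intro j' hj' x _ _ hx
    rw [pairFun_wordProd] at hx
    exact h j' hj' x hx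

theorem uext_prod_inl (x : Unitization ℂ A) : uext (P.prod φ ψ) (umap inl x) = uext φ x :=
  uext_umap (fun x => (P.restrict_left φ ψ x).symm) x

theorem uext_prod_comp {A' B' : MultiFacedAlgebra.{u} F} {h : A' →ₙₐ[ℂ] A} {g : B' →ₙₐ[ℂ] B}
    (hh : IsMultiFaced h) (hg : IsMultiFaced g) {φ' : A' →ₗ[ℂ] ℂ} {ψ' : B' →ₗ[ℂ] ℂ}
    (hφ : ∀ x, φ' x = φ (h x)) (hψ : ∀ x, ψ' x = ψ (g x)) (x : Unitization ℂ (A'.coprod B')) :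
    uext (P.prod φ ψ) (umap (map h g) x) = uext (P.prod φ' ψ') x := by
  have e1 : φ' = φ ∘ₗ (h : A' →ₗ[ℂ] A) := LinearMap.ext hφ
  have e2 : ψ' = ψ ∘ₗ (g : B' →ₗ[ℂ] B) := LinearMap.ext hψ
  refine uext_umap (fun y => ?_) x
  rw [e1, e2, P.universality h g hh hg]
  rfl

/-! ### Nesting coefficients -/

/-- The map whose fibers are the blocks of `nestPartition`. -/
abbrev nestMap : Fin 3 → Fin 2 := ![0, 1, 0]

variable (P) in
/-- The highest coefficient of `nestPartition`. -/
def nestCoeff (p c q : F) : ℂ := P.wordCoeff nestMap ![p, c, q] (fiberWords nestMap)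

theorem fiberWords_nestMap :
    (fiberWords nestMap 0).1 = [0, 2] ∧ (fiberWords nestMap 1).1 = [1] ∧
      (fiberWords nestMap 2).1 = [0, 2] := by
  refine ⟨?_, ?_, ?_⟩ <;>
  · refine (pairwise_fiberWords _ _).eq_of_mem_iff (by simp) fun y => ?_
    rw [mem_fiberWords]
    fin_cases y <;> simp [nestMap]

theorem Symmetric.highestCoeff_nestPartition (hP : P.Symmetric) (p c q : F) :
    P.highestCoeff 2 ![p, c, q] nestPartition = P.nestCoeff p c q := by
  refine hP.highestCoeff_eq _ _ ?_ fun x y => WordPartition.part_ofMap _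
  intro κ
  fin_cases κ
  · exact ⟨0, rfl⟩
  · exact ⟨1, rfl⟩

/-- Centering eliminates the system in which the outer legs are separate, and positivity excludes
the word that joins them in decreasing order. Only the nested partition remains; this is how nesting
coefficients enter the analysis. -/
theorem Positive.prod_nest (hP : P.Positive) {p c q : F} {x y : A} {e : B} (hx : x ∈ A.face p)
    (hy : y ∈ A.face q) (he : e ∈ B.face c) (hφx : φ x = 0) (hφy : φ y = 0) :
    uext (P.prod φ ψ) (Unitization.inr (inl x) * Unitization.inr (inr e) * Unitization.inr (inl y)) =
      P.nestCoeff p c q * (φ (x * y) * ψ e) := by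
  classical
  have h := prod_word_eq_wordCoeff_mul (P := P) (b := nestMap) (f := ![p, c, q])
    (a := ![x, 0, y]) (a' := ![0, e, 0]) φ ψ
    (fun ℓ hℓ => by fin_cases ℓ <;> simp_all [nestMap])
    (fun ℓ hℓ => by fin_cases ℓ <;> simp_all [nestMap]) (fiberWords nestMap)
    (fun x y hy => fiberWords_eq_iff.2 (mem_fiberWords.1 hy)) (by
      intro j' hj' z hz
      have hs := hP.sorted_of_wordCoeff_ne_zero hj' z
      have hg := wordCoeff_ne_zero hj' z
      refine ⟨z, Subtype.ext (hs.eq_of_mem_iff (pairwise_fiberWords _ _) fun y => ?_)⟩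
      rw [mem_fiberWords]
      refine ⟨fun hy => (hg.2 y hy).1, fun hy => ?_⟩
      by_contra hyz
      have hone : (j' z).1 = [z] := by
        refine hs.eq_of_mem_iff (by simp) fun t => ?_
        rw [List.mem_singleton]
        refine ⟨fun ht => ?_, fun ht => ht ▸ hg.1⟩
        have h1 := (hg.2 t ht).1
        have h2 : y ≠ t := fun h => hyz (h ▸ ht)
        have h3 : y ≠ z := fun h => hyz (h ▸ hg.1)
        clear hz hs hg hyz hj' ht
        revert h1 h2 h3 hy
        revert y z t
        decide
      have hyz' : y ≠ z := fun h => hyz (h ▸ hg.1)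
      rw [hone] at hz
      have : z = 0 ∨ z = 2 := by
        clear hz hs hg hyz hj' hone
        revert hy hyz'
        revert y z
        decide
      rcases this with rfl | rfl
      · simp [wordProd, hφx, nestMap] at hz
      · simp [wordProd, hφy, nestMap] at hz)
  rw [nestCoeff]
  have e1 : (List.ofFn fun ℓ => pairLetter (nestMap ℓ) (![x, 0, y] ℓ) (![0, e, 0] ℓ)).prod =
      (Unitization.inr (inl x) * Unitization.inr (inr e) * Unitization.inr (inl y) :
        Unitization ℂ (A.coprod B)) := by
    simp [List.ofFn_succ, pairLetter, nestMap, mul_assoc]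
  rw [← e1, h, Fin.prod_univ_three, fiberWords_nestMap.1, fiberWords_nestMap.2.1,
    fiberWords_nestMap.2.2]
  simp [wordProd, nestMap]

end Pair

end UniversalProduct

end

/-! ### Color independence of nesting coefficients, and deletion of a unit-like letter for vector
states -/

noncomputable section

open MultiFacedAlgebra UniversalProduct

namespace MultiFacedAlgebra

variable {F : Type v} {A B : MultiFacedAlgebra.{u} F} [StarRing A] [StarModule ℂ A] [StarRing B]
  [StarModule ℂ B]

theorem star_inl (x : A) : star (inl x : A.coprod B) = inl (star x) :=
  FreeProd.star_inl x

theorem star_inr (x : B) : star (inr x : A.coprod B) = inr (star x) :=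
  FreeProd.star_inr x

theorem star_umap_inl (x : Unitization ℂ A) :
    star (umap (inl : A →ₙₐ[ℂ] A.coprod B) x) = umap inl (star x) := by
  rw [umap_apply, umap_apply, star_add, ← Unitization.inr_star, star_inl, ← Unitization.inl_star]
  simp

section UnitState

variable {Y : Type} {col : Y → F}

/-- The state of the free `*`-algebra which is multiplicative and maps every letter to `1`. -/
def unitState : freeStar.{u} col →ₗ[ℂ] ℂ :=
  vectorState (V := Unit) (fun _ => 1) fun _ => 1

theorem unitState_apply (x : freeStar.{u} col) :
    unitState x = rep (V := Unit) (fun _ => 1) x () () := by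
  simp [unitState, vectorState_apply, dotProduct, Matrix.mulVec]

@[simp] theorem unitState_sgen (y : Y × Bool) : unitState (sgen y : freeStar.{u} col) = 1 := by
  rw [unitState_apply, rep_sgen]
  simp

@[simp] theorem unitState_mul (x y : freeStar.{u} col) :
    unitState (x * y) = unitState x * unitState y := by
  simp [unitState_apply, Matrix.mul_apply]

theorem isRestrictedState_unitState :
    IsRestrictedState (unitState : freeStar.{u} col →ₗ[ℂ] ℂ) :=
  isRestrictedState_vectorState fun h => one_ne_zero (congrFun h ())

end UnitState

end MultiFacedAlgebra

namespace UniversalProduct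

variable {F : Type v} {P : UniversalProduct.{u} F}

/-- The highest coefficient of `nestPartition` depends only on the color of the inner leg. -/
theorem Positive.nestCoeff_congr (hP : P.Positive) (c p q p' q' : F) :
    P.nestCoeff p c q = P.nestCoeff p' c q' := by
  -- The letter `1` supplies the inner color, the other four the old and new outer colors.
  let col : Fin 5 → F := ![p, c, q, p', q']
  let D : MultiFacedAlgebra.{u} F := freeStar col
  let Ω : Fin 2 → ℂ := ![1, 0]
  have hΩ : Ω ≠ 0 := fun h => one_ne_zero (congrFun h 0)
  -- All letters map `Ω` to the same vector orthogonal to `Ω`. Hence they are centered, and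
  -- differences of letters of different colors are null in the product state.
  let M : Fin 5 → Matrix (Fin 2) (Fin 2) ℂ := fun _ => !![0, 0; 1, 0]
  let φ : D →ₗ[ℂ] ℂ := vectorState M Ω
  let ψ : D →ₗ[ℂ] ℂ := unitState
  have hφ : ∀ y, φ (sgen y) = 0 := by
    rintro ⟨i, β⟩
    change vectorState M Ω _ = 0
    rw [vectorState_apply, rep_sgen]
    cases β <;> simp [M, Ω, dotProduct, Matrix.mulVec]
  have hφ2 : ∀ i i', φ (sgen (i, true) * sgen (i', false)) = 1 := by
    intro i i'
    change vectorState M Ω _ = 1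
    rw [vectorState_apply, map_mul, rep_sgen, rep_sgen]
    simp [M, Ω, dotProduct, Matrix.mulVec, Matrix.mul_apply]
  have hstate : IsRestrictedState (P.prod φ ψ) :=
    hP D D isStarFaced_freeStar isStarFaced_freeStar φ ψ (isRestrictedState_vectorState hΩ)
      isRestrictedState_unitState
  let L : Fin 5 × Bool → Unitization ℂ (D.coprod D) := fun y => Unitization.inr (inl (sgen y))
  let R : Unitization ℂ (D.coprod D) := Unitization.inr (inr (sgen ((1 : Fin 5), false)))
  have hL : ∀ y, star (L y) = L (y.1, !y.2) := by
    intro y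
    simp only [L]
    rw [← Unitization.inr_star, star_inl, star_sgen]
  have hval : ∀ i i', uext (P.prod φ ψ) (L (i, true) * R * L (i', false)) =
      P.nestCoeff (col i) c (col i') := by
    intro i i'
    rw [hP.prod_nest φ ψ (sgen_mem (i, true)) (sgen_mem (i', false)) (sgen_mem ((1 : Fin 5), false))
      (hφ _) (hφ _), hφ2]
    change P.nestCoeff (col i) c (col i') * (1 * unitState _) = _
    simp
  have hnull : ∀ i i', uext (P.prod φ ψ)
      (star (L (i, false) - L (i', false)) * (L (i, false) - L (i', false))) = 0 := by
    intro i i'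
    have h2 : ∀ i i', uext (P.prod φ ψ) (L (i, true) * L (i', false)) = 1 := by
      intro i i'
      simp only [L]
      rw [← Unitization.inr_mul, ← map_mul, uext_inr, P.restrict_left, hφ2]
    rw [star_sub, hL, hL, sub_mul, mul_sub, mul_sub]
    simp [h2]
  -- A null difference on the right changes `q` into `q'`; on the left, in `h2`, it changes `p` into
  -- `p'`.
  have h1 := (hstate.null (hnull 2 4) (L (0, true) * R)).1
  have h2 := (hstate.null (hnull 0 3) (R * L (4, false))).2
  rw [mul_sub, map_sub, hval, hval] at h1
  rw [star_sub, hL, hL, sub_mul, ← mul_assoc, ← mul_assoc, map_sub] at h2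
  change uext (P.prod φ ψ) (L (0, true) * R * L (4, false)) -
    uext (P.prod φ ψ) (L (3, true) * R * L (4, false)) = 0 at h2
  rw [hval, hval] at h2
  exact (sub_eq_zero.1 h1).trans (sub_eq_zero.1 h2)

section Insertion

variable {Y V : Type} [Fintype V] [DecidableEq V] {col : Y → F} {M : Y → Matrix V V ℂ} {Ω : V → ℂ}

/-- In the GNS picture, let `r` be the inserted letter and decompose `ZΩ` into its part along `Ω`
and the orthogonal part `yΩ`. Since `r` has the moments of a unit, it fixes `Ω`; since the nesting
coefficient is `1`, it fixes `yΩ`. So it fixes `ZΩ`. -/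
theorem Positive.prod_insert_of_letter (hP : P.Positive) {s y : Y}
    (hν : ∀ p q, P.nestCoeff p (col s) q = 1) (hΩ : Ω ≠ 0) (X Z : Unitization ℂ (freeStar.{u} col))
    (hZ : (urep M Z).mulVec Ω = uext (vectorState M Ω) Z • Ω + (M y).mulVec Ω)
    (hy : star Ω ⬝ᵥ (M y).mulVec Ω = 0) :
    uext (P.prod (vectorState M Ω) (unitState : freeStar.{u} col →ₗ[ℂ] ℂ))
      (umap inl X * Unitization.inr (inr (sgen (s, false))) * umap inl Z) =
        uext (vectorState M Ω) (X * Z) := by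
  set φ : freeStar.{u} col →ₗ[ℂ] ℂ := vectorState M Ω with hφ
  set ψ : freeStar.{u} col →ₗ[ℂ] ℂ := unitState with hψ
  set Φ := uext (P.prod φ ψ) with hΦ
  have hstate : IsRestrictedState (P.prod φ ψ) :=
    hP _ _ isStarFaced_freeStar isStarFaced_freeStar φ ψ (isRestrictedState_vectorState hΩ)
      isRestrictedState_unitState
  have hy0 : φ (sgen (y, false)) = 0 := by
    rw [hφ, vectorState_apply, rep_sgen]
    simp [hy]
  have hy1 : φ (sgen (y, true)) = 0 := by
    rw [hφ, vectorState_apply, rep_sgen]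
    have : star Ω ⬝ᵥ (M y).conjTranspose.mulVec Ω = star (star Ω ⬝ᵥ (M y).mulVec Ω) := by
      rw [← Matrix.star_dotProduct_star, star_star, Matrix.star_mulVec, dotProduct_comm,
        ← Matrix.dotProduct_mulVec, dotProduct_comm, dotProduct_comm]
    simp [this, hy]
  let L : Bool → Unitization ℂ ((freeStar.{u} col).coprod (freeStar.{u} col)) := fun β => Unitization.inr (inl (sgen (y, β)))
  let R : Bool → Unitization ℂ ((freeStar.{u} col).coprod (freeStar.{u} col)) := fun β => Unitization.inr (inr (sgen (s, β)))
  have hL : star (L false) = L true := by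
    simp only [L]
    rw [← Unitization.inr_star, star_inl, star_sgen]
    rfl
  have hR : star (R false) = R true := by
    simp only [R]
    rw [← Unitization.inr_star, star_inr, star_sgen]
    rfl
  have nullify : ∀ z, Φ (star z * z) = 0 → ∀ w, Φ (w * z) = 0 := fun z hz w =>
    (hstate.null hz w).1
  have hR1 : ∀ β, Φ (R β) = 1 := fun β => by
    simp only [R, hΦ]
    rw [uext_inr, P.restrict_right]
    exact unitState_sgen _
  have eR : R true * R false = Unitization.inr (inr (sgen (s, true) * sgen (s, false))) := by
    simp only [R]
    rw [map_mul inr, Unitization.inr_mul]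
  have hRR : Φ (R true * R false) = 1 := by
    rw [eR, hΦ, uext_inr, P.restrict_right]
    simp [hψ]
  have n1 : ∀ w, Φ (w * (R false - 1)) = 0 := by
    refine nullify _ ?_
    rw [star_sub, hR, star_one, sub_mul, mul_sub, mul_one, one_mul, map_sub, map_sub, map_sub, hRR,
      hR1, hR1, hΦ, uext_one]
    ring
  have n2 : ∀ w, Φ (w * (umap inl Z - algebraMap ℂ _ (uext φ Z) - L false)) = 0 := by
    refine nullify _ ?_
    have e : umap inl Z - algebraMap ℂ _ (uext φ Z) - L false =
        umap (inl : freeStar.{u} col →ₙₐ[ℂ] (freeStar.{u} col).coprod (freeStar.{u} col))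
          (Z - algebraMap ℂ _ (uext φ Z) - Unitization.inr (sgen (y, false))) := by
      simp [L]
    rw [e, star_umap_inl, ← map_mul, hΦ, uext_prod_inl, hφ, uext_vectorState_star_mul hΩ]
    have h0 : (urep M (Z - algebraMap ℂ _ (uext φ Z) -
        (Unitization.inr (sgen (y, false)) : Unitization ℂ (freeStar.{u} col)))).mulVec Ω = 0 := by
      rw [map_sub, map_sub, AlgHom.commutes, urep_inr, rep_sgen, Matrix.sub_mulVec,
        Matrix.sub_mulVec, hZ, Algebra.algebraMap_eq_smul_one, Matrix.smul_mulVec,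
        Matrix.one_mulVec]
      simp
    rw [h0]
    simp
  -- The squared norm of `ryΩ - yΩ` has four terms, with `r* r`, `r`, `r*` or nothing between `y*`
  -- and `y`. By `Positive.prod_nest` each of them is `± φ(y* y)`, and they cancel.
  have n3 : ∀ w, Φ (w * (R false * L false - L false)) = 0 := by
    refine nullify _ ?_
    have key : ∀ e ∈ (freeStar.{u} col).face (col s), ψ e = 1 →
        Φ (L true * Unitization.inr (inr e) * L false) =
          φ (sgen (y, true) * sgen (y, false)) := by
      intro e he h1
      refine (hP.prod_nest φ ψ (sgen_mem (y, true)) (sgen_mem (y, false)) he hy1 hy0).trans ?_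
      rw [hν, h1, one_mul, mul_one]
    have k1 := key _ (sgen_mem (s, false)) (unitState_sgen _)
    have k2 := key _ (sgen_mem (s, true)) (unitState_sgen _)
    have k3 := key _ (mul_mem (sgen_mem (s, true)) (sgen_mem (s, false))) (by simp [hψ])
    have k4 : Φ (L true * L false) = φ (sgen (y, true) * sgen (y, false)) := by
      simp only [L, hΦ]
      rw [← Unitization.inr_mul, ← map_mul, uext_inr, P.restrict_left]
    rw [← eR] at k3
    have e : star (R false * L false - L false) * (R false * L false - L false) =
        L true * (R true * R false) * L false - L true * R true * L false -
          L true * R false * L false + L true * L false := by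
      rw [star_sub, star_mul, hL, hR]
      noncomm_ring
    rw [e, map_add, map_sub, map_sub]
    linear_combination k3 - k1 - k2 + k4
  -- Each summand ends in a null vector or is a multiple of one: `n2` handles the first, `n1` the
  -- second, `n3` the third.
  have hsum : umap inl X * Unitization.inr (inr (sgen (s, false))) * umap inl Z - umap inl (X * Z) =
      umap inl X * (R false - 1) * (umap inl Z - algebraMap ℂ _ (uext φ Z) - L false) +
        uext φ Z • (umap inl X * (R false - 1)) + umap inl X * (R false * L false - L false) := by
    rw [map_mul, Algebra.algebraMap_eq_smul_one]
    simp only [R]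
    simp only [mul_sub, sub_mul, mul_one, smul_sub, mul_smul_comm, mul_assoc]
    abel
  have := congrArg Φ hsum
  rw [map_sub, map_add, map_add, n2, n3, map_smul, n1, smul_zero, add_zero, add_zero,
    sub_eq_zero] at this
  rw [this, hΦ, uext_prod_inl]

/-- If the nesting coefficient is `1`, then a letter of the color in question which has the
distribution of a unit can be removed, for vector states. -/
theorem Positive.prod_insert_vectorState (hP : P.Positive) {s : Y}
    (hν : ∀ p q, P.nestCoeff p (col s) q = 1) (hΩ : Ω ≠ 0)
    (X Z : Unitization ℂ (freeStar.{u} col)) :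
    uext (P.prod (vectorState M Ω) (unitState : freeStar.{u} col →ₗ[ℂ] ℂ))
      (umap inl X * Unitization.inr (inr (sgen (s, false))) * umap inl Z) =
        uext (vectorState M Ω) (X * Z) := by
  have hΩΩ : star Ω ⬝ᵥ Ω ≠ 0 := fun h => hΩ (dotProduct_star_self_eq_zero.1 h)
  -- The part of `ZΩ` orthogonal to `Ω`.
  let η : V → ℂ := (urep M Z).mulVec Ω - uext (vectorState M Ω) Z • Ω
  let col' : Option Y → F := fun y => y.elim (col s) col
  -- A new letter is adjoined that acts by the rank-one matrix taking `Ω` to `η`. Its color may be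
  -- chosen freely because `hν` covers all outer colors; universality carries the result back to the
  -- original alphabet.
  let M' : Option Y → Matrix V V ℂ := fun y =>
    y.elim ((star Ω ⬝ᵥ Ω)⁻¹ • Matrix.vecMulVec η (star Ω)) M
  let h : freeStar.{u} col →ₙₐ[ℂ] freeStar.{u} col' :=
    freeLift (col := fun y : Y × Bool => col y.1) fun y => sgen (some y.1, y.2)
  have hh : IsMultiFaced h := isMultiFaced_freeLift _ fun y => sgen_mem (some y.1, y.2)
  have hgen : ∀ y, h (sgen y) = sgen (some y.1, y.2) := fun y => freeLift_gen _ y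
  have hrep : ∀ x, rep M' (h x) = rep M x := by
    intro x
    induction x using freeStar_induction with
    | hgen y => rw [hgen, rep_sgen, rep_sgen]; rfl
    | h0 => simp
    | hadd x y hx hy => simp [hx, hy]
    | hsmul z x hx => simp [hx]
    | hmul x y hx hy => simp [hx, hy]
  have hunit : ∀ x : freeStar.{u} col, unitState x = unitState (h x) := by
    intro x
    induction x using freeStar_induction with
    | hgen y => rw [hgen, unitState_sgen, unitState_sgen]
    | h0 => simp
    | hadd x y hx hy => simp [hx, hy]
    | hsmul z x hx => simp [hx]
    | hmul x y hx hy => simp [hx, hy]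
  have hvec : ∀ x, vectorState M Ω x = vectorState M' Ω (h x) := fun x => by
    rw [vectorState_apply, vectorState_apply, hrep]
  have hurep : ∀ x, urep M' (umap h x) = urep M x := by
    intro x
    rw [umap_apply, map_add, urep_inr, hrep, ← Unitization.algebraMap_eq_inl, AlgHom.commutes,
      urep_apply, Algebra.algebraMap_eq_smul_one]
  have hu : ∀ x, uext (vectorState M' Ω) (umap h x) = uext (vectorState M Ω) x := uext_umap hvec
  have hnone : (M' none).mulVec Ω = η := by
    simp only [M', Option.elim]
    rw [Matrix.smul_mulVec, Matrix.vecMulVec_mulVec]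
    ext i
    simp only [Pi.smul_apply, MulOpposite.smul_eq_mul_unop, MulOpposite.unop_op, smul_eq_mul]
    field_simp
  have := hP.prod_insert_of_letter (M := M') (s := some s) (y := none) (col := col') hν hΩ
    (umap h X) (umap h Z) (by rw [hurep, hu, hnone]; simp [η]) (by
      rw [hnone]
      simp only [η]
      rw [dotProduct_sub, dotProduct_smul, uext_vectorState hΩ, smul_eq_mul]
      field_simp
      ring)
  rw [← map_mul, hu] at this
  rw [← this, ← uext_prod_comp _ _ hh hh hvec hunit]
  congr 1
  rw [map_mul, map_mul, ← umap_comp_apply, ← umap_comp_apply, ← umap_comp_apply, ← umap_comp_apply]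
  have e1 : (map h h).comp inl = (inl : freeStar.{u} col' →ₙₐ[ℂ] _).comp h :=
    NonUnitalAlgHom.ext fun x => lift_inl _ _ x
  have e2 : map h h (inr (sgen (s, false))) = inr (sgen (some s, false)) := by
    rw [← hgen (s, false)]
    exact lift_inr _ _ _
  rw [e1, umap_inr, e2]

end Insertion

end UniversalProduct

end

/-! ### Factorization of a single element, for arbitrary functionals -/

noncomputable section

open MultiFacedAlgebra UniversalProduct

theorem exists_finRange_eq_append {N : ℕ} (s : Fin N) :
    ∃ p q, List.finRange N = p ++ s :: q ∧ p.length = s ∧ (p ++ q).Pairwise (· < ·) ∧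
      ∀ x, x ∈ p ++ q ↔ x ≠ s := by
  obtain ⟨p, q, hpq⟩ := List.append_of_mem (List.mem_finRange s)
  have hs := List.pairwise_lt_finRange N
  have hn := List.nodup_finRange N
  refine ⟨p, q, hpq, ?_, ?_, fun x => ?_⟩
  · have h1 : (List.finRange N)[p.length]? = some s := by rw [hpq]; simp
    obtain ⟨h2, h3⟩ := List.getElem?_eq_some_iff.1 h1
    rw [List.getElem_finRange] at h3
    rw [← h3]
    rfl
  · rw [hpq] at hs
    exact hs.sublist ((List.append_sublist_append_left p).2 (List.sublist_cons_self s q))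
  · have hx := List.mem_finRange x
    rw [hpq] at hx hn
    have hn' := List.nodup_middle.1 hn
    constructor
    · rintro h rfl
      exact (List.nodup_cons.1 hn').1 h
    · intro h
      simp only [List.mem_append, List.mem_cons] at hx ⊢
      tauto

/-- A linear functional on the unitization is determined by the products of generators. -/
theorem unitization_functional_ext {R : Type*} [NonUnitalRing R] [Module ℂ R] [IsScalarTower ℂ R R]
    [SMulCommClass ℂ R R] {S : Set R} (hS : NonUnitalAlgebra.adjoin ℂ S = ⊤)
    {f g : Unitization ℂ R →ₗ[ℂ] ℂ}
    (h : ∀ l : List R, (∀ x ∈ l, x ∈ S) →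
      f (l.map (Unitization.inr : R → Unitization ℂ R)).prod =
        g (l.map (Unitization.inr : R → Unitization ℂ R)).prod) : f = g := by
  have hmem : ∀ z, z ∈ Algebra.adjoin ℂ ((Unitization.inr : R → Unitization ℂ R) '' S) := by
    intro z
    rw [← Unitization.inl_fst_add_inr_snd_eq z, ← Unitization.algebraMap_eq_inl]
    refine add_mem (algebraMap_mem _ _) ?_
    have hz : z.snd ∈ NonUnitalAlgebra.adjoin ℂ S := by rw [hS]; trivial
    generalize z.snd = x at hz
    induction hz using NonUnitalAlgebra.adjoin_induction with
    | mem x hx => exact Algebra.subset_adjoin ⟨x, hx, rfl⟩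
    | add x y _ _ hx hy => rw [Unitization.inr_add]; exact add_mem hx hy
    | zero => rw [Unitization.inr_zero]; exact zero_mem _
    | mul x y _ _ hx hy => rw [Unitization.inr_mul]; exact mul_mem hx hy
    | smul r x _ hx => rw [Unitization.inr_smul]; exact SMulMemClass.smul_mem _ hx
  refine LinearMap.ext fun z => ?_
  have hz := hmem z
  rw [← Subalgebra.mem_toSubmodule, Algebra.adjoin_eq_span] at hz
  refine LinearMap.eqOn_span (fun x hx => ?_) hz
  obtain ⟨l, hl, rfl⟩ := Submonoid.exists_list_of_mem_closure hx
  choose! g' hg' using hl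
  have hl' : l = (l.map g').map (Unitization.inr : R → Unitization ℂ R) := by
    rw [List.map_map]
    conv_lhs => rw [← List.map_id l]
    exact List.map_congr_left fun x hx => (hg' x hx).2.symm
  rw [hl']
  refine h _ fun x hx => ?_
  obtain ⟨y, hy, rfl⟩ := List.mem_map.1 hx
  exact (hg' y hy).1

namespace UniversalProduct

variable {F : Type v} {P : UniversalProduct.{u} F}

section Insertion

variable {N : ℕ} {b : Fin N → Fin 2} {f : Fin N → F} {s : Fin N}

theorem ofFn_pairLetter_prod {A B : MultiFacedAlgebra.{u} F} (hb : ∀ ℓ, b ℓ = 0 ↔ ℓ ≠ s)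
    (a : Fin N → A) (a' : Fin N → B) {p q : List (Fin N)} (hpq : List.finRange N = p ++ s :: q)
    (hmem : ∀ x, x ∈ p ++ q ↔ x ≠ s) :
    (List.ofFn fun ℓ => pairLetter (b ℓ) (a ℓ) (a' ℓ)).prod =
      umap inl (p.map fun ℓ => (Unitization.inr (a ℓ) : Unitization ℂ A)).prod *
        Unitization.inr (inr (a' s)) *
          umap (inl : A →ₙₐ[ℂ] A.coprod B)
            (q.map fun ℓ => (Unitization.inr (a ℓ) : Unitization ℂ A)).prod := by
  have h : ∀ l : List (Fin N), (∀ x ∈ l, x ≠ s) →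
      (l.map fun ℓ => pairLetter (b ℓ) (a ℓ) (a' ℓ)).prod =
        umap inl (l.map fun ℓ => (Unitization.inr (a ℓ) : Unitization ℂ A)).prod := by
    intro l hl
    rw [map_list_prod, List.map_map]
    congr 1
    refine List.map_congr_left fun x hx => ?_
    simp [pairLetter, (hb x).2 (hl x hx)]
  rw [List.ofFn_eq_map, hpq, List.map_append, List.map_cons, List.prod_append, List.prod_cons,
    h p fun x hx => (hmem x).1 (by simp [hx]), h q fun x hx => (hmem x).1 (by simp [hx]), mul_assoc]
  congr 2
  rw [pairLetter, if_neg]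
  exact fun h => (hb s).1 h rfl

/-- Give the first factor the vector state that detects the words of `j`, and the second one the
unit state. The product is nonzero by the expansion, while deletion of `s` turns it into the moment
of all remaining letters in order. Hence these letters, if any, form one word of `j`. -/
theorem Positive.eq_fiberWords_of_single (hP : P.Positive) (hb : ∀ ℓ, b ℓ = 0 ↔ ℓ ≠ s)
    (hν : ∀ p q, P.nestCoeff p (f s) q = 1) {j : Fin N → InjWord N} (hj : P.wordCoeff b f j ≠ 0) :
    j = fiberWords b := by
  classical
  obtain ⟨p, q, hpq, -, -, hmem⟩ := exists_finRange_eq_append s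
  let W : Fin N → List (Fin N) := fun l => if (j l).1.head? = some l then (j l).1 else []
  have hW : ∀ l, (W l).length ≤ N := by
    intro l
    simp only [W]
    split_ifs
    · simpa using (j l).2.length_le_card
    · simp
  have hWj : ∀ l, W l ≠ [] → W l = (j l).1 := by
    intro l hl
    simp only [W] at hl ⊢
    split_ifs with h
    · rfl
    · simp [h] at hl
  have hΩ : pathVector W ≠ 0 := pathVector_ne_zero s
  have hbs : ∀ y, b y = b s → y = s := by
    intro y hy
    by_contra hne
    exact (hb s).1 (hy ▸ (hb y).2 hne) rfl
  have hjs : ∀ x, (∀ y ∈ (j x).1, b y = b x) → x ∈ (j x).1 → b x ≠ 0 → (j x).1 = [s] := by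
    intro x hx hxx hx0
    obtain rfl : x = s := by
      by_contra hne
      exact hx0 ((hb x).2 hne)
    refine (hP.sorted_of_wordCoeff_ne_zero hj x).eq_of_mem_iff (by simp) fun y => ?_
    rw [List.mem_singleton]
    exact ⟨fun hy => hbs y (hx y hy), fun hy => hy ▸ hxx⟩
  have h1 := prod_word_eq_wordCoeff_mul (P := P) (b := b) (f := f)
    (vectorState (pathMatrix W) (pathVector W) : freeStar.{u} f →ₗ[ℂ] ℂ) unitState
    (a := fun ℓ => sgen (ℓ, false)) (a' := fun ℓ => sgen (ℓ, false))
    (fun ℓ _ => sgen_mem (ℓ, false)) (fun ℓ _ => sgen_mem (ℓ, false)) j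
    (fun x y hy => ((wordCoeff_ne_zero hj x).2 y hy).2) (by
      intro j' hj' x hx
      have hg := wordCoeff_ne_zero hj' x
      have hx' := List.ne_nil_of_mem hg.1
      by_cases hx0 : b x = 0
      · rw [if_pos hx0, vectorState_path_ne_zero_iff hW hx'] at hx
        obtain ⟨l, hl⟩ := hx
        exact ⟨l, Subtype.ext (hl.trans (hWj l (hl ▸ hx')))⟩
      · obtain rfl : x = s := by
          by_contra hne
          exact hx0 ((hb x).2 hne)
        refine ⟨x, Subtype.ext ?_⟩
        have e : ∀ j : Fin N → InjWord N, P.wordCoeff b f j ≠ 0 → (j x).1 = [x] := by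
          intro j hj
          refine (hP.sorted_of_wordCoeff_ne_zero hj x).eq_of_mem_iff (by simp) fun y => ?_
          rw [List.mem_singleton]
          exact ⟨fun hy => hbs y ((wordCoeff_ne_zero hj x).2 y hy).1,
            fun hy => hy ▸ (wordCoeff_ne_zero hj x).1⟩
        rw [e j' hj', e j hj])
  rw [ofFn_pairLetter_prod hb _ _ hpq hmem, hP.prod_insert_vectorState hν hΩ] at h1
  have h2 : uext (vectorState (pathMatrix W) (pathVector W) : freeStar.{u} f →ₗ[ℂ] ℂ)
      ((p ++ q).map fun ℓ => (Unitization.inr (sgen (ℓ, false)) :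
        Unitization ℂ (freeStar.{u} f))).prod ≠ 0 := by
    rw [List.map_append, List.prod_append, h1]
    refine mul_ne_zero hj (Finset.prod_ne_zero_iff.2 fun ℓ _ => ?_)
    split_ifs with hh h0
    · have hne : (j ℓ).1 ≠ [] := by
        intro h0
        simp [h0] at hh
      refine (vectorState_path_ne_zero_iff (f := f) hW hne).2 ⟨ℓ, ?_⟩
      simp only [W]
      rw [if_pos hh]
    · rw [hjs ℓ (fun y hy => ((wordCoeff_ne_zero hj ℓ).2 y hy).1) (wordCoeff_ne_zero hj ℓ).1 h0]
      simp [wordProd]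
    · exact one_ne_zero
  refine eq_fiberWords b (hP.sorted_of_wordCoeff_ne_zero hj) fun x y => ?_
  refine ⟨fun hy => ((wordCoeff_ne_zero hj x).2 y hy).1, fun hy => ?_⟩
  by_cases hx : x = s
  · subst hx
    rw [hbs y hy]
    exact (wordCoeff_ne_zero hj x).1
  · have hne : p ++ q ≠ [] := List.ne_nil_of_mem ((hmem x).2 hx)
    have e : ((p ++ q).map fun ℓ => (Unitization.inr (sgen (ℓ, false)) :
        Unitization ℂ (freeStar.{u} f))) =
        ((p ++ q).map fun ℓ => (sgen (ℓ, false) : freeStar.{u} f)).map Unitization.inr := by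
      rw [List.map_map]
      rfl
    rw [e, ← inr_wordProd (by simpa using hne), uext_inr,
      vectorState_path_ne_zero_iff hW hne] at h2
    obtain ⟨l, hl⟩ := h2
    have hl' := hl.trans (hWj l (hl ▸ hne))
    have hxl : x ∈ (j l).1 := hl' ▸ (hmem x).2 hx
    rw [((wordCoeff_ne_zero hj l).2 x hxl).2, ← hl', hmem]
    rintro rfl
    exact hx (hbs x hy.symm)

/-- Evaluate at the unit state on both factors: all moments are `1`, only this coefficient survives,
and deleting the letter `s` gives the value `1`. -/
theorem Positive.wordCoeff_of_single (hP : P.Positive) (hb : ∀ ℓ, b ℓ = 0 ↔ ℓ ≠ s)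
    (hν : ∀ p q, P.nestCoeff p (f s) q = 1) : P.wordCoeff b f (fiberWords b) = 1 := by
  classical
  obtain ⟨p, q, hpq, -, -, hmem⟩ := exists_finRange_eq_append s
  have hword : ∀ l : List (Fin N), l ≠ [] →
      unitState (wordProd (l.map fun ℓ => (sgen (ℓ, false) : freeStar.{u} f))) = 1 := by
    intro l hl
    induction l with
    | nil => exact absurd rfl hl
    | cons x l ih =>
      by_cases hl' : l = []
      · simp [hl', wordProd]
      · rw [List.map_cons, wordProd_cons (by simpa), unitState_mul, ih hl', unitState_sgen, one_mul]
  have h1 := prod_word_eq_sum (P := P) (b := b) (f := f)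
    (unitState : freeStar.{u} f →ₗ[ℂ] ℂ) unitState
    (a := fun ℓ => sgen (ℓ, false)) (a' := fun ℓ => sgen (ℓ, false))
    (fun ℓ _ => sgen_mem (ℓ, false)) (fun ℓ _ => sgen_mem (ℓ, false))
  rw [Finset.sum_eq_single (fiberWords b)
    (fun j _ hj => mul_eq_zero_of_left (by_contra fun h => hj (hP.eq_fiberWords_of_single hb hν h)) _)
    (by simp), Finset.prod_eq_one, mul_one, ofFn_pairLetter_prod hb _ _ hpq hmem] at h1
  · rw [← h1]
    refine (hP.prod_insert_vectorState hν (fun h => one_ne_zero (congrFun h ())) _ _).trans ?_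
    rw [← List.prod_append, ← List.map_append]
    change uext unitState _ = 1
    by_cases hne : p ++ q = []
    · simp [hne]
    · have e : ((p ++ q).map fun ℓ => (Unitization.inr (sgen (ℓ, false)) :
          Unitization ℂ (freeStar.{u} f))) =
          ((p ++ q).map fun ℓ => (sgen (ℓ, false) : freeStar.{u} f)).map Unitization.inr := by
        rw [List.map_map]
        rfl
      rw [e, ← inr_wordProd (by simpa using hne), uext_inr, hword _ hne]
  · intro ℓ _
    have hne : (fiberWords b ℓ).1 ≠ [] := List.ne_nil_of_mem (mem_fiberWords.2 rfl : ℓ ∈ _)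
    split_ifs
    · exact hword _ hne
    · exact hword _ hne
    · rfl

variable {A B : MultiFacedAlgebra.{u} F} (φ : A →ₗ[ℂ] ℂ) (ψ : B →ₗ[ℂ] ℂ)

/-- The coefficients found with vector states are the same for all functionals. The one surviving
system consists of `s` alone and, if other letters exist, of these letters in order, with
coefficient `1`. -/
theorem Positive.prod_insert_word (hP : P.Positive) (hb : ∀ ℓ, b ℓ = 0 ↔ ℓ ≠ s)
    (hν : ∀ p q, P.nestCoeff p (f s) q = 1) {a : Fin N → A} {a' : Fin N → B}
    (ha : ∀ ℓ, ℓ ≠ s → a ℓ ∈ A.face (f ℓ)) (ha' : a' s ∈ B.face (f s)) {p q : List (Fin N)}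
    (hpw : (p ++ q).Pairwise (· < ·)) (hmem : ∀ x, x ∈ p ++ q ↔ x ≠ s) :
    uext (P.prod φ ψ) (List.ofFn fun ℓ => pairLetter (b ℓ) (a ℓ) (a' ℓ)).prod =
      uext φ ((p ++ q).map fun ℓ => (Unitization.inr (a ℓ) : Unitization ℂ A)).prod * ψ (a' s) := by
  classical
  have hbs : ∀ ℓ, b ℓ ≠ 0 → ℓ = s := fun ℓ h => by_contra fun h' => h ((hb ℓ).2 h')
  have hs0 : b s ≠ 0 := fun h => (hb s).1 h rfl
  rw [prod_word_eq_sum φ ψ (f := f) (fun ℓ h => ha ℓ ((hb ℓ).1 h)) fun ℓ h => hbs ℓ h ▸ ha',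
    Finset.sum_eq_single (fiberWords b)
    (fun j _ hj => mul_eq_zero_of_left (by_contra fun h => hj (hP.eq_fiberWords_of_single hb hν h)) _)
    (by simp), hP.wordCoeff_of_single hb hν, one_mul]
  have hfs : (fiberWords b s).1 = [s] := by
    refine (pairwise_fiberWords b s).eq_of_mem_iff (by simp) fun y => ?_
    rw [mem_fiberWords, List.mem_singleton]
    exact ⟨fun h => hbs y (h ▸ hs0), fun h => by rw [h]⟩
  have hf : ∀ x, x ≠ s → (fiberWords b x).1 = p ++ q := by
    intro x hx
    refine (pairwise_fiberWords b x).eq_of_mem_iff hpw fun y => ?_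
    rw [mem_fiberWords, hmem, (hb x).2 hx, hb]
  by_cases hne : p ++ q = []
  · have hall : ∀ x, x = s := fun x => by
      by_contra hx
      have := (hmem x).2 hx
      simp [hne] at this
    rw [Finset.prod_eq_single s (fun x _ hx => absurd (hall x) hx) (by simp), hfs,
      if_pos (by simp), if_neg hs0, hne]
    simp [wordProd]
  · obtain ⟨m, t, hm⟩ := List.exists_cons_of_ne_nil hne
    have hms : m ≠ s := (hmem m).1 (by simp [hm])
    rw [Fintype.prod_eq_mul m s hms, if_pos (by rw [hf m hms, hm]; rfl), if_pos ((hb m).2 hms),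
      hf m hms, hfs, if_pos (by simp), if_neg hs0, ← uext_inr φ, inr_wordProd (by simpa using hne),
      List.map_map]
    · rfl
    · rintro x ⟨hxm, hxs⟩
      rw [if_neg]
      rw [hf x hxs, hm]
      exact fun h => hxm (Option.some.inj h).symm

/-- If the nesting coefficient is `1`, then a single element of the second factor, of the color in
question, factorizes. -/
theorem Positive.prod_insert (hP : P.Positive) {c : F} (hν : ∀ p q, P.nestCoeff p c q = 1) {e : B}
    (he : e ∈ B.face c) (X Z : Unitization ℂ A) :
    uext (P.prod φ ψ) (umap inl X * Unitization.inr (inr e) * umap inl Z) =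
      uext φ (X * Z) * ψ e := by
  have main : ∀ X Z : List A, (∀ x ∈ X, x ∈ ⋃ c, (A.face c : Set A)) →
      (∀ x ∈ Z, x ∈ ⋃ c, (A.face c : Set A)) →
      uext (P.prod φ ψ) (umap inl (X.map (Unitization.inr : A → Unitization ℂ A)).prod *
        Unitization.inr (inr e) * umap inl (Z.map (Unitization.inr : A → Unitization ℂ A)).prod) =
      uext φ ((X.map (Unitization.inr : A → Unitization ℂ A)).prod *
        (Z.map (Unitization.inr : A → Unitization ℂ A)).prod) * ψ e := by
    classical
    intro X Z hX hZ
    -- The `0` reserves the slot that is occupied by `e` in the second factor.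
    let L : List A := X ++ 0 :: Z
    let s : Fin L.length := ⟨X.length, by simp [L]⟩
    have hL : ∀ ℓ : Fin L.length, ∃ d, L.get ℓ ∈ A.face d := by
      intro ℓ
      have := List.get_mem L ℓ
      simp only [L, List.mem_append, List.mem_cons] at this
      rcases this with h | h | h
      · exact Set.mem_iUnion.1 (hX _ h)
      · exact ⟨c, h ▸ zero_mem _⟩
      · exact Set.mem_iUnion.1 (hZ _ h)
    choose col hcol using hL
    obtain ⟨p, q, hpq, hlen, hpw, hmem⟩ := exists_finRange_eq_append s
    have hb : ∀ ℓ, (if ℓ = s then 1 else 0 : Fin 2) = 0 ↔ ℓ ≠ s := by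
      intro ℓ
      split_ifs with h <;> simp [h]
    have hmap : p.map L.get ++ L.get s :: q.map L.get = X ++ 0 :: Z := by
      rw [← List.map_cons, ← List.map_append, ← hpq]
      rw [← List.ofFn_eq_map, List.ofFn_get]
    obtain ⟨h1, h2⟩ := List.append_inj hmap (by rw [List.length_map, hlen])
    have h3 := (List.cons.inj h2).2
    have h := hP.prod_insert_word φ ψ (b := fun ℓ => if ℓ = s then 1 else 0)
      (f := fun ℓ => if ℓ = s then c else col ℓ) (s := s) hb (by simpa using hν) (a := L.get)
      (a' := fun _ => e) (fun ℓ hℓ => by rw [if_neg hℓ]; exact hcol ℓ) (by simpa using he) hpw hmem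
    rw [ofFn_pairLetter_prod hb _ _ hpq hmem] at h
    have e1 : ∀ l : List (Fin L.length), (l.map fun ℓ => (Unitization.inr (L.get ℓ) :
        Unitization ℂ A)) = (l.map L.get).map Unitization.inr := fun l => by
      rw [List.map_map]; rfl
    rwa [e1, e1, e1, h1, h3, List.map_append, List.map_append, h1, h3, List.prod_append] at h
  have h1 : ∀ Z : List A, (∀ x ∈ Z, x ∈ ⋃ c, (A.face c : Set A)) → ∀ X : Unitization ℂ A,
      uext (P.prod φ ψ) (umap inl X *
        Unitization.inr (inr e) * umap inl (Z.map (Unitization.inr : A → Unitization ℂ A)).prod) =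
      uext φ (X * (Z.map (Unitization.inr : A → Unitization ℂ A)).prod) * ψ e := by
    intro Z hZ X
    set z := (Z.map (Unitization.inr : A → Unitization ℂ A)).prod
    have := unitization_functional_ext (adjoin_faces A)
      (f := uext (P.prod φ ψ) ∘ₗ LinearMap.mulRight ℂ (umap inl z) ∘ₗ
        LinearMap.mulRight ℂ (Unitization.inr (inr e)) ∘ₗ (umap inl).toLinearMap)
      (g := LinearMap.mulRight ℂ (ψ e) ∘ₗ uext φ ∘ₗ LinearMap.mulRight ℂ z)
      fun X hX => main X Z hX hZ
    exact LinearMap.congr_fun this X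
  have := unitization_functional_ext (adjoin_faces A)
    (f := uext (P.prod φ ψ) ∘ₗ LinearMap.mulLeft ℂ (umap inl X * Unitization.inr (inr e)) ∘ₗ
      (umap inl).toLinearMap)
    (g := LinearMap.mulRight ℂ (ψ e) ∘ₗ uext φ ∘ₗ LinearMap.mulLeft ℂ X)
    fun Z hZ => h1 Z hZ X
  exact LinearMap.congr_fun this Z

theorem Symmetric.uext_prod_swap (hP : P.Symmetric) (x : Unitization ℂ (A.coprod B)) :
    uext (P.prod φ ψ) x = uext (P.prod ψ φ) (umap (swap A B) x) :=
  (uext_umap (fun x => LinearMap.congr_fun (hP A B φ ψ) x) x).symm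

theorem Positive.prod_insert_left (hP : P.Positive) (hsymm : P.Symmetric) {c : F}
    (hν : ∀ p q, P.nestCoeff p c q = 1) {e : A} (he : e ∈ A.face c) (X Z : Unitization ℂ B) :
    uext (P.prod φ ψ) (umap inr X * Unitization.inr (inl e) * umap inr Z) =
      uext ψ (X * Z) * φ e := by
  rw [hsymm.uext_prod_swap, map_mul (umap _), map_mul (umap _), ← umap_comp_apply, ← umap_comp_apply, umap_inr,
    ← hP.prod_insert ψ φ hν he]
  have e1 : (swap A B).comp inr = inl := NonUnitalAlgHom.ext fun x => lift_inr _ _ x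
  have e2 : swap A B (inl e) = inr e := lift_inl _ _ _
  rw [e1, e2]

end Insertion

end UniversalProduct

end

noncomputable section

open MultiFacedAlgebra UniversalProduct

/-! ### Removal of singletons -/

theorem WordPartition.part_erase {n : ℕ} (π : WordPartition (n + 1)) (s : Fin (n + 2))
    {x y : Fin (n + 1)} : (π.erase s).part x = (π.erase s).part y ↔
      π.part (s.succAbove x) = π.part (s.succAbove y) :=
  WordPartition.part_ofMap _

namespace UniversalProduct

variable {F : Type v} {P : UniversalProduct.{u} F}

/-- The coefficient of the partition with one block. -/
theorem wordCoeff_of_const {n : ℕ} (f : Fin (n + 1) → F) :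
    P.wordCoeff (fun _ => (0 : Fin 1)) f (fiberWords fun _ => (0 : Fin 1)) = 1 := by
  have h := iterProd_wordProd_eq_wordValue (P := P) (k := 0) (fun _ => freeFaced f)
    (fun κ => moments (indicator (fun _ => (0 : Fin 1)) (fiberWords fun _ => (0 : Fin 1)) κ))
    (fun _ => 0) fun ℓ => gen ℓ
  refine h.symm.trans ?_
  change moments _ (wordProd (List.ofFn fun ℓ => (gen ℓ : freeFaced.{u} f))) = 1
  rw [List.ofFn_eq_map, moments_word _ (by simp), indicator, if_pos]
  intro x _
  refine ⟨rfl, (pairwise_fiberWords _ _).eq_of_mem_iff (List.pairwise_lt_finRange _) fun y => ?_⟩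
  simp

/-- Removing the inner leg leaves two legs in one block, and the coefficient of a single block is
`1`. -/
theorem Symmetric.nestCoeff_eq_one (hP : P.Symmetric) (h : P.highestCoeff.SingletonInductive)
    (p c q : F) : P.nestCoeff p c q = 1 := by
  have hs : {1} ∈ nestPartition.parts := by
    have : nestPartition.part 1 = {1} := by
      ext y
      rw [WordPartition.mem_part_iff, nestPartition, WordPartition.part_ofMap]
      fin_cases y <;> simp
    rw [← this]
    exact WordPartition.part_mem_parts _ _
  rw [← hP.highestCoeff_nestPartition, h 1 _ nestPartition 1 hs,
    hP.highestCoeff_eq (b := fun _ => (0 : Fin 1)) _ _ (fun κ => ⟨0, (Fin.fin_one_eq_zero κ).symm⟩),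
    wordCoeff_of_const]
  intro x y
  rw [WordPartition.part_erase, nestPartition, WordPartition.part_ofMap]
  fin_cases x <;> fin_cases y <;> simp [Fin.succAbove]

section Erase

variable {n k : ℕ} {f : Fin (n + 2) → F} {s : Fin (n + 2)} {b : Fin (n + 2) → Fin (k + 2)}
  {b' : Fin (n + 1) → Fin (k + 1)}

theorem fiberWords_succAbove (hs : b s = 0) (hb : ∀ i, b (s.succAbove i) = (b' i).succ)
    (x : Fin (n + 1)) :
    (fiberWords b (s.succAbove x)).1 = (fiberWords b' x).1.map s.succAbove := by
  refine (pairwise_fiberWords _ _).eq_of_mem_iff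
    ((pairwise_fiberWords b' x).map _ fun _ _ h => Fin.strictMono_succAbove s h) fun y => ?_
  rw [mem_fiberWords, hb, List.mem_map]
  constructor
  · intro hy
    obtain rfl | ⟨z, rfl⟩ := Fin.eq_self_or_eq_succAbove s y
    · rw [hs] at hy
      exact absurd hy.symm (Fin.succ_ne_zero _)
    · rw [hb] at hy
      exact ⟨z, mem_fiberWords.2 (Fin.succ_injective _ hy), rfl⟩
  · rintro ⟨z, hz, rfl⟩
    rw [hb, mem_fiberWords.1 hz]

/-- Renaming the letters along `s.succAbove` is a multi-faced homomorphism that matches the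
indicators. Thus the coefficient without `s` can be computed with the same algebra and functionals
as the coefficient with `s`. -/
theorem wordCoeff_succAbove (hs : b s = 0) (hb : ∀ i, b (s.succAbove i) = (b' i).succ) :
    P.wordCoeff b' (fun i => f (s.succAbove i)) (fiberWords b') =
      P.wordValue k (fun _ => freeFaced f)
        (fun κ => moments (indicator b (fiberWords b) κ.succ)) b' fun i => gen (s.succAbove i) := by
  refine (wordValue_comp (φ := fun κ => moments (indicator b (fiberWords b) κ.succ))
    (fun _ => freeLift fun i => (gen (s.succAbove i) : freeFaced.{u} f))
    (fun _ => isMultiFaced_freeLift _ fun i => gen_mem (s.succAbove i)) ?_ _).trans ?_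
  · intro κ x
    refine LinearMap.congr_fun (free_functional_ext (ψ := moments (indicator b (fiberWords b) κ.succ)
      ∘ₗ ((freeLift fun i => (gen (s.succAbove i) : freeFaced.{u} f) :
        freeFaced (fun i => f (s.succAbove i)) →ₙₐ[ℂ] freeFaced f) :
        freeFaced (fun i => f (s.succAbove i)) →ₗ[ℂ] freeFaced f)) fun l hl => ?_) x
    rw [LinearMap.comp_apply, moments_word _ hl]
    change _ = moments _ (freeLift _ _)
    rw [map_wordProd, List.map_map]
    have e : l.map ((freeLift fun i => (gen (s.succAbove i) : freeFaced.{u} f)) ∘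
        (gen : _ → freeFaced.{u} fun i => f (s.succAbove i))) =
        (l.map s.succAbove).map gen := by
      rw [List.map_map]
      exact List.map_congr_left fun i _ => freeLift_gen _ i
    rw [e, moments_word _ (by simpa)]
    unfold indicator
    refine if_congr ?_ rfl rfl
    simp only [List.mem_map, forall_exists_index, and_imp, forall_apply_eq_imp_iff₂, hb,
      fiberWords_succAbove hs hb, Fin.succ_inj]
    refine forall₂_congr fun x _ => and_congr_right fun _ => ?_
    exact (List.map_injective_iff.2 Fin.succAbove_right_injective).eq_iff.symm
  · simp

/-- The leg `s` is the only letter of the leading factor, and all others belong to the iterated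
product of the rest. So `Positive.prod_insert_left` deletes it, at the cost of its own indicator
moment `1`. -/
theorem Positive.wordCoeff_erase (hP : P.Positive) (hsymm : P.Symmetric)
    (hν : ∀ p q, P.nestCoeff p (f s) q = 1) (hs : b s = 0)
    (hb : ∀ i, b (s.succAbove i) = (b' i).succ) :
    P.wordCoeff b f (fiberWords b) =
      P.wordCoeff b' (fun i => f (s.succAbove i)) (fiberWords b') := by
  obtain ⟨p, q, hpq, -, hpw, hmem⟩ := exists_finRange_eq_append s
  have hmap : (List.finRange (n + 1)).map s.succAbove = p ++ q := by
    refine ((List.pairwise_lt_finRange _).map _ fun _ _ h =>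
      Fin.strictMono_succAbove s h).eq_of_mem_iff hpw fun x => ?_
    rw [hmem, List.mem_map]
    constructor
    · rintro ⟨y, -, rfl⟩
      exact Fin.succAbove_ne s y
    · intro hx
      obtain ⟨y, rfl⟩ := Fin.exists_succAbove_eq hx
      exact ⟨y, List.mem_finRange y, rfl⟩
  obtain ⟨p', q', hpq', rfl, rfl⟩ := List.map_eq_append_iff.1 hmap
  rw [wordCoeff_succAbove hs hb, wordCoeff, freeValue, wordValue_apply, wordValue_apply,
    List.ofFn_eq_map, List.ofFn_eq_map, hpq, hpq', List.map_append, List.map_cons, List.map_map,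
    List.map_map, List.prod_append, List.prod_cons, List.map_append, List.prod_append]
  set m : Fin (k + 2) → freeFaced.{u} f →ₗ[ℂ] ℂ := fun κ =>
    moments (indicator b (fiberWords b) κ) with hm
  let g : Fin (n + 1) → Unitization ℂ (iterCoprod k fun _ => freeFaced.{u} f) := fun i =>
    Unitization.inr (embed k (fun _ => freeFaced f) (b' i) (gen (s.succAbove i)))
  let G : Fin (n + 2) → Unitization ℂ (iterCoprod (k + 1) fun _ => freeFaced.{u} f) := fun ℓ =>
    Unitization.inr (embed (k + 1) (fun _ => freeFaced f) (b ℓ) (gen ℓ))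
  have hG : ∀ l : List (Fin (n + 1)), (l.map (G ∘ s.succAbove)).prod =
      umap inr (l.map g).prod := by
    intro l
    rw [map_list_prod, List.map_map]
    congr 1
    refine List.map_congr_left fun i _ => ?_
    simp only [G, g, Function.comp_apply, umap_inr]
    rw [hb]
    rfl
  have hGs : G s = Unitization.inr (inl (gen s)) := by
    simp only [G]
    rw [hs]
    rfl
  have h1 : m 0 (gen s) = 1 := by
    have := moments_word (col := f) (indicator b (fiberWords b) 0) (l := [s]) (by simp)
    refine this.trans ?_
    rw [indicator, if_pos]
    intro x hx
    obtain rfl := List.mem_singleton.1 hx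
    refine ⟨hs, (pairwise_fiberWords _ _).eq_of_mem_iff (by simp) fun y => ?_⟩
    rw [mem_fiberWords, hs, List.mem_singleton]
    constructor
    · intro hy
      obtain rfl | ⟨z, rfl⟩ := Fin.eq_self_or_eq_succAbove x y
      · rfl
      · rw [hb] at hy
        exact absurd hy (Fin.succ_ne_zero _)
    · rintro rfl
      exact hs
  have h2 := hP.prod_insert_left (m 0) (P.iterProd k (fun _ => freeFaced f) fun κ => m κ.succ) hsymm
    hν (gen_mem s) (p'.map g).prod (q'.map g).prod
  rw [h1, mul_one, ← hG, ← hG, ← hGs] at h2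
  exact (congrArg _ (mul_assoc _ _ _).symm).trans h2

end Erase

theorem Positive.singletonInductive (hP : P.Positive) (hsymm : P.Symmetric)
    (hν : ∀ p c q, P.nestCoeff p c q = 1) : P.highestCoeff.SingletonInductive := by
  intro n f π s hs
  have hπs : ∀ i, π.part (s.succAbove i) ≠ π.part s := by
    intro i h
    rw [← WordPartition.mem_part_iff, π.part_eq_of_mem hs (Finset.mem_singleton_self s),
      Finset.mem_singleton] at h
    exact Fin.succAbove_ne s i h
  let b' := blockIndex (π.erase s)
  -- By symmetry any enumeration of the blocks may be used; this one puts the singleton first.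
  let b : Fin (n + 2) → Fin ((π.erase s).parts.card - 1 + 2) :=
    s.insertNth 0 fun i => (b' i).succ
  have hbs : b s = 0 := Fin.insertNth_apply_same _ _ _
  have hb : ∀ i, b (s.succAbove i) = (b' i).succ := fun i => Fin.insertNth_apply_succAbove _ _ _ _
  rw [hsymm.highestCoeff_eq (b := b) f π]
  · exact hP.wordCoeff_erase hsymm (fun p q => hν p _ q) hbs hb
  · intro κ
    refine Fin.cases ⟨s, hbs⟩ (fun κ => ?_) κ
    obtain ⟨i, hi⟩ := surjective_blockIndex (π.erase s) κ
    exact ⟨s.succAbove i, (hb i).trans (congrArg Fin.succ hi)⟩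
  · intro x y
    obtain hx | ⟨x, rfl⟩ := Fin.eq_self_or_eq_succAbove s x <;>
    obtain hy | ⟨y, rfl⟩ := Fin.eq_self_or_eq_succAbove s y
    · simp [hx, hy]
    · rw [hx, hbs, hb]
      exact iff_of_false (hπs y).symm (Fin.succ_ne_zero _).symm
    · rw [hy, hbs, hb]
      exact iff_of_false (hπs x) (Fin.succ_ne_zero _)
    · rw [hb, hb, Fin.succ_inj, blockIndex_eq_iff, WordPartition.part_erase]

end UniversalProduct

end

noncomputable section

open MultiFacedAlgebra UniversalProduct

/-! ### Unit preserving products -/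

/-- The insertion of an element into products does not change a functional if it does not change it
on the products of generators. -/
theorem insertion_ext {R : Type*} [NonUnitalRing R] [Module ℂ R] [IsScalarTower ℂ R R]
    [SMulCommClass ℂ R R] {S : Set R} (hS : NonUnitalAlgebra.adjoin ℂ S = ⊤)
    {Φ : Unitization ℂ R →ₗ[ℂ] ℂ} {z : Unitization ℂ R}
    (h : ∀ X Y : List R, (∀ x ∈ X, x ∈ S) → (∀ x ∈ Y, x ∈ S) →
      Φ ((X.map (Unitization.inr : R → Unitization ℂ R)).prod * z *
        (Y.map (Unitization.inr : R → Unitization ℂ R)).prod) =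
      Φ ((X.map (Unitization.inr : R → Unitization ℂ R)).prod *
        (Y.map (Unitization.inr : R → Unitization ℂ R)).prod)) (X Y : Unitization ℂ R) :
    Φ (X * z * Y) = Φ (X * Y) := by
  have h1 : ∀ Y : List R, (∀ x ∈ Y, x ∈ S) → ∀ X,
      Φ (X * z * (Y.map (Unitization.inr : R → Unitization ℂ R)).prod) =
      Φ (X * (Y.map (Unitization.inr : R → Unitization ℂ R)).prod) := by
    intro Y hY X
    set y := (Y.map (Unitization.inr : R → Unitization ℂ R)).prod
    exact LinearMap.congr_fun (unitization_functional_ext hS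
      (f := Φ ∘ₗ LinearMap.mulRight ℂ y ∘ₗ LinearMap.mulRight ℂ z)
      (g := Φ ∘ₗ LinearMap.mulRight ℂ y) fun X hX => h X Y hX hY) X
  exact LinearMap.congr_fun (unitization_functional_ext hS
    (f := Φ ∘ₗ LinearMap.mulLeft ℂ (X * z)) (g := Φ ∘ₗ LinearMap.mulLeft ℂ X)
    fun Y hY => h1 Y hY X) Y

namespace MultiFacedAlgebra

variable {F : Type v} {A B : MultiFacedAlgebra.{u} F}

theorem subset_idealSpan (S : Set A) : S ⊆ A.idealSpan S := fun _ hx =>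
  Submodule.mem_sInf.2 fun _ hI => hI.1 hx

theorem mul_mem_idealSpan {S : Set A} {x : A} (hx : x ∈ A.idealSpan S) (a : A) :
    a * x ∈ A.idealSpan S ∧ x * a ∈ A.idealSpan S :=
  ⟨Submodule.mem_sInf.2 fun I hI => (hI.2 a x (Submodule.mem_sInf.1 hx I hI)).1,
    Submodule.mem_sInf.2 fun I hI => (hI.2 a x (Submodule.mem_sInf.1 hx I hI)).2⟩

theorem idealSpan_le {S : Set A} {I : Submodule ℂ A} (h : S ⊆ I)
    (hI : ∀ a, ∀ x ∈ I, a * x ∈ I ∧ x * a ∈ I) : A.idealSpan S ≤ I :=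
  sInf_le ⟨h, hI⟩

/-- A functional vanishes on an ideal if its unital extension vanishes on the multiples of the
generators. -/
theorem eq_zero_of_mem_idealSpan {S : Set A} {φ : A →ₗ[ℂ] ℂ}
    (h : ∀ x ∈ S, ∀ X Y : Unitization ℂ A, uext φ (X * Unitization.inr x * Y) = 0) {x : A}
    (hx : x ∈ A.idealSpan S) : φ x = 0 := by
  let I : Submodule ℂ A :=
    { carrier := {x | ∀ X Y : Unitization ℂ A, uext φ (X * Unitization.inr x * Y) = 0}
      add_mem' := fun {x y} hx hy X Y => by
        rw [Unitization.inr_add, mul_add, add_mul, map_add, hx, hy, add_zero]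
      zero_mem' := fun X Y => by simp
      smul_mem' := fun z x hx X Y => by
        rw [Unitization.inr_smul, mul_smul_comm, smul_mul_assoc, map_smul, hx, smul_zero] }
  have hI : A.idealSpan S ≤ I := idealSpan_le (fun x hx => h x hx) fun a x hx =>
    ⟨fun X Y => by rw [Unitization.inr_mul, ← mul_assoc]; exact hx _ _,
      fun X Y => by rw [Unitization.inr_mul, ← mul_assoc, mul_assoc]; exact hx _ _⟩
  have := hI hx 1 1
  simpa using this

theorem uext_mul_eq_zero {S : Set A} {φ : A →ₗ[ℂ] ℂ} (h : ∀ x ∈ A.idealSpan S, φ x = 0) {x : A}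
    (hx : x ∈ A.idealSpan S) (X Y : Unitization ℂ A) :
    uext φ (X * Unitization.inr x * Y) = 0 := by
  have e1 : X * Unitization.inr x = Unitization.inr (X.fst • x + X.snd * x) := by
    ext <;> simp
  have e2 : ∀ y : A, Unitization.inr y * Y = Unitization.inr (Y.fst • y + y * Y.snd) := by
    intro y
    ext <;> simp
  rw [e1, e2, uext_inr]
  have h1 : X.fst • x + X.snd * x ∈ A.idealSpan S :=
    add_mem (Submodule.smul_mem _ _ hx) (mul_mem_idealSpan hx _).1
  exact h _ (add_mem (Submodule.smul_mem _ _ h1) (mul_mem_idealSpan h1 _).2)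

/-- Units of the faces can be inserted, for functionals which identify the units. -/
theorem uext_insert_unit {e : F → A} (he : ∀ c, A.IsFaceUnit c (e c)) {φ : A →ₗ[ℂ] ℂ}
    (h : ∀ x ∈ A.idealSpan {x | ∃ c d, x = e c - e d}, φ x = 0) (h1 : ∀ c, φ (e c) = 1) (c : F)
    (X Y : Unitization ℂ A) : uext φ (X * Unitization.inr (e c) * Y) = uext φ (X * Y) := by
  refine insertion_ext (adjoin_faces A) (fun X Y hX hY => ?_) X Y
  have h0 : ∀ d, ∀ X Y : Unitization ℂ A,
      uext φ (X * Unitization.inr (e c) * Y) = uext φ (X * Unitization.inr (e d) * Y) := by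
    intro d X Y
    have := uext_mul_eq_zero h (subset_idealSpan _ ⟨c, d, rfl⟩) X Y
    rwa [Unitization.inr_sub, mul_sub, sub_mul, map_sub, sub_eq_zero] at this
  -- Exchange `e c` for the unit of the face of a neighboring letter, which absorbs it. Without
  -- neighbors, the value is `φ (e c) = 1`.
  rcases List.eq_nil_or_concat X with rfl | ⟨X, x, rfl⟩
  · cases Y with
    | nil => simp [h1]
    | cons y Y =>
      obtain ⟨d, hd⟩ := Set.mem_iUnion.1 (hY y (by simp))
      rw [h0 d, List.map_cons, List.prod_cons, List.map_nil, List.prod_nil, one_mul, one_mul,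
        ← mul_assoc, ← Unitization.inr_mul, ((he d).2 y hd).1]
  · obtain ⟨d, hd⟩ := Set.mem_iUnion.1 (hX x (by simp))
    rw [h0 d, List.concat_eq_append, List.map_append, List.prod_append, List.map_cons, List.map_nil,
      List.prod_singleton, mul_assoc _ _ (Unitization.inr (e d)), ← Unitization.inr_mul,
      ((he d).2 x hd).2]

/-- The homogeneous generators of a free product. -/
def coprodGenerators (A B : MultiFacedAlgebra.{u} F) : Set (A.coprod B) :=
  {x | (∃ c, ∃ a ∈ A.face c, x = inl a) ∨ ∃ c, ∃ b ∈ B.face c, x = inr b}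

theorem adjoin_coprodGenerators (A B : MultiFacedAlgebra.{u} F) :
    NonUnitalAlgebra.adjoin ℂ (coprodGenerators A B) = ⊤ := by
  rw [eq_top_iff, ← adjoin_faces (A.coprod B), NonUnitalAlgebra.adjoin_le_iff]
  refine Set.iUnion_subset fun c x hx => ?_
  have : (A.coprod B).face c ≤ NonUnitalAlgebra.adjoin ℂ (coprodGenerators A B) := by
    refine NonUnitalAlgebra.adjoin_le_iff.2 ?_
    rintro _ (⟨a, ha, rfl⟩ | ⟨b, hb, rfl⟩)
    · exact NonUnitalAlgebra.subset_adjoin ℂ (A := A.coprod B) (Or.inl ⟨c, a, ha, rfl⟩)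
    · exact NonUnitalAlgebra.subset_adjoin ℂ (A := A.coprod B) (Or.inr ⟨c, b, hb, rfl⟩)
  exact this hx

end MultiFacedAlgebra

namespace UniversalProduct

variable {F : Type v} {P : UniversalProduct.{u} F} {A B B' : MultiFacedAlgebra.{u} F}

/-- The expansion involves only moments of words without repeated letters, so elements of different
algebras may be exchanged as soon as these moments agree. -/
theorem prod_word_congr {N : ℕ} {b : Fin N → Fin 2} {f : Fin N → F} {a : Fin N → A}
    {a' : Fin N → B} {a'' : Fin N → B'} (φ : A →ₗ[ℂ] ℂ) {ψ : B →ₗ[ℂ] ℂ} {χ : B' →ₗ[ℂ] ℂ}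
    (ha : ∀ ℓ, b ℓ = 0 → a ℓ ∈ A.face (f ℓ)) (ha' : ∀ ℓ, b ℓ ≠ 0 → a' ℓ ∈ B.face (f ℓ))
    (ha'' : ∀ ℓ, b ℓ ≠ 0 → a'' ℓ ∈ B'.face (f ℓ))
    (h : ∀ l : List (Fin N), l ≠ [] → l.Nodup →
      ψ (wordProd (l.map a')) = χ (wordProd (l.map a''))) :
    uext (P.prod φ ψ) (List.ofFn fun ℓ => pairLetter (b ℓ) (a ℓ) (a' ℓ)).prod =
      uext (P.prod φ χ) (List.ofFn fun ℓ => pairLetter (b ℓ) (a ℓ) (a'' ℓ)).prod := by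
  classical
  rw [prod_word_eq_sum φ ψ ha ha', prod_word_eq_sum φ χ ha ha'']
  refine Finset.sum_congr rfl fun j _ => congrArg _ (Finset.prod_congr rfl fun ℓ _ => ?_)
  by_cases hh : (j ℓ).1.head? = some ℓ
  · rw [if_pos hh, if_pos hh, h _ (fun h0 => by simp [h0] at hh) (j ℓ).2]
  · rw [if_neg hh, if_neg hh]

theorem uext_prod_assoc {C : MultiFacedAlgebra.{u} F} (φ : A →ₗ[ℂ] ℂ) (ψ : B →ₗ[ℂ] ℂ)
    (χ : C →ₗ[ℂ] ℂ) (x : Unitization ℂ ((A.coprod B).coprod C)) :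
    uext (P.prod φ (P.prod ψ χ)) (umap (assoc A B C) x) = uext (P.prod (P.prod φ ψ) χ) x :=
  uext_umap (fun x => LinearMap.congr_fun (P.associativity φ ψ χ) x) x

/-- If an element of the second factor can be inserted there without changing the functional, then
it can be inserted in the free product. -/
theorem Positive.prod_insert_unit (hP : P.Positive) {c : F} (hν : ∀ p q, P.nestCoeff p c q = 1)
    {e : B} (he : e ∈ B.face c) (φ : A →ₗ[ℂ] ℂ) {ψ : B →ₗ[ℂ] ℂ}
    (hψ : ∀ X Y, uext ψ (X * Unitization.inr e * Y) = uext ψ (X * Y))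
    (X Y : Unitization ℂ (A.coprod B)) :
    uext (P.prod φ ψ) (X * Unitization.inr (inr e) * Y) = uext (P.prod φ ψ) (X * Y) := by
  classical
  refine insertion_ext (adjoin_coprodGenerators A B) (fun X Y hX hY => ?_) X Y
  -- An auxiliary third factor generated by one letter `g` of color `c` with all moments `1`; this
  -- letter will stand in for `e`.
  let E : MultiFacedAlgebra.{u} F := freeFaced fun _ : Unit => c
  let g : E := gen ()
  let τ : E →ₗ[ℂ] ℂ := moments fun _ => 1
  have hg : g ∈ E.face c := gen_mem ()
  have hτ : τ g = 1 := moments_word (col := fun _ : Unit => c) (fun _ => 1) (l := [()]) (by simp)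
  let L : List (A.coprod B) := X ++ 0 :: Y
  let s : Fin L.length := ⟨X.length, by simp [L]⟩
  have hL : ∀ ℓ : Fin L.length, ∃ (κ : Fin 2) (d : F) (a : A) (a' : B), (κ = 0 → a ∈ A.face d) ∧
      (κ ≠ 0 → a' ∈ B.face d) ∧ Unitization.inr (L.get ℓ) = pairLetter κ a a' := by
    have hgen : ∀ x ∈ coprodGenerators A B, ∃ (κ : Fin 2) (d : F) (a : A) (a' : B),
        (κ = 0 → a ∈ A.face d) ∧ (κ ≠ 0 → a' ∈ B.face d) ∧
          Unitization.inr x = pairLetter κ a a' := by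
      rintro _ (⟨d, a, ha, rfl⟩ | ⟨d, b, hb, rfl⟩)
      · exact ⟨0, d, a, 0, fun _ => ha, fun h => absurd rfl h, by simp [pairLetter]⟩
      · exact ⟨1, d, 0, b, fun h => absurd h (by decide), fun _ => hb, by simp [pairLetter]⟩
    intro ℓ
    have := List.get_mem L ℓ
    simp only [L, List.mem_append, List.mem_cons] at this
    rcases this with h | h | h
    · exact hgen _ (hX _ h)
    · exact hgen _ (Or.inl ⟨c, 0, zero_mem _, by rw [map_zero]; exact h⟩)
    · exact hgen _ (hY _ h)
  choose κ d a a' ha ha' haa using hL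
  obtain ⟨p, q, hpq, hlen, hpw, hmem⟩ := exists_finRange_eq_append s
  have hmap : p.map L.get ++ L.get s :: q.map L.get = X ++ 0 :: Y := by
    rw [← List.map_cons, ← List.map_append, ← hpq]
    rw [← List.ofFn_eq_map, List.ofFn_get]
  obtain ⟨h1, h2⟩ := List.append_inj hmap (by rw [List.length_map, hlen])
  have h3 := (List.cons.inj h2).2
  let b : Fin L.length → Fin 2 := fun ℓ => if ℓ = s then 1 else κ ℓ
  let f : Fin L.length → F := fun ℓ => if ℓ = s then c else d ℓ
  let a₁ : Fin L.length → B := fun ℓ => if ℓ = s then e else a' ℓ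
  let a₂ : Fin L.length → B.coprod E := fun ℓ => if ℓ = s then inr g else inl (a' ℓ)
  have hsnot : ∀ x ∈ p ++ q, x ≠ s := fun x hx => (hmem x).1 hx
  -- Replace `e` under `ψ` by `g` under the product of `ψ` and `τ`. The moments agree because both
  -- elements can be removed: `e` by `hψ`, and `g` by `Positive.prod_insert`, which applies since
  -- `g` occurs at most once in a word without repetition.
  have key := prod_word_congr (P := P) (b := b) (f := f) (a := a) (a' := a₁) (a'' := a₂) φ (ψ := ψ)
    (χ := P.prod ψ τ) (fun ℓ hℓ => by
      by_cases hs : ℓ = s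
      · simp [b, hs] at hℓ
      · simp only [b, f, hs, if_false] at hℓ ⊢
        exact ha ℓ hℓ)
    (fun ℓ hℓ => by
      by_cases hs : ℓ = s
      · simpa only [f, a₁, hs, if_true] using he
      · simp only [b, f, a₁, hs, if_false] at hℓ ⊢
        exact ha' ℓ hℓ)
    (fun ℓ hℓ => by
      by_cases hs : ℓ = s
      · simpa only [f, a₂, hs, if_true] using isMultiFaced_inr c g hg
      · simp only [b, f, a₂, hs, if_false] at hℓ ⊢
        exact isMultiFaced_inl _ _ (ha' ℓ hℓ))
    (fun l hl hnd => by
      have e2 : ∀ l : List (Fin L.length), s ∉ l →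
          (l.map (Unitization.inr ∘ a₂)).prod = umap (inl : B →ₙₐ[ℂ] B.coprod E)
            (l.map ((Unitization.inr : B → Unitization ℂ B) ∘ a₁)).prod := by
        intro l hl
        rw [map_list_prod, List.map_map]
        congr 1
        refine List.map_congr_left fun x hx => ?_
        have : x ≠ s := fun h => hl (h ▸ hx)
        simp [a₁, a₂, this]
      rw [← uext_inr ψ, ← uext_inr (P.prod ψ τ), inr_wordProd (by simpa), inr_wordProd (by simpa),
        List.map_map, List.map_map]
      by_cases hs : s ∈ l
      · obtain ⟨t, t', rfl⟩ := List.append_of_mem hs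
        have hnd' := (List.nodup_cons.1 (List.nodup_middle.1 hnd)).1
        rw [List.mem_append, not_or] at hnd'
        rw [List.map_append, List.map_append, List.map_cons, List.map_cons, List.prod_append,
          List.prod_append, List.prod_cons, List.prod_cons, e2 _ hnd'.1, e2 _ hnd'.2]
        have e3 : ((Unitization.inr : B.coprod E → Unitization ℂ (B.coprod E)) ∘ a₂) s = Unitization.inr (inr g) := by simp [a₂]
        have e4 : ((Unitization.inr : B → Unitization ℂ B) ∘ a₁) s = Unitization.inr e := by
          simp [a₁]
        rw [e3, e4, ← mul_assoc, ← mul_assoc, hP.prod_insert ψ τ hν hg, hψ, hτ, mul_one]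
      · rw [e2 l hs, uext_prod_inl])
  let θ : A.coprod B →ₙₐ[ℂ] A.coprod (B.coprod E) := map (NonUnitalAlgHom.id ℂ A) inl
  have hw1 : ∀ l : List (Fin L.length), s ∉ l →
      (l.map fun ℓ => pairLetter (b ℓ) (a ℓ) (a₁ ℓ)) = (l.map L.get).map Unitization.inr := by
    intro l hl
    rw [List.map_map]
    refine List.map_congr_left fun x hx => ?_
    have : x ≠ s := fun h => hl (h ▸ hx)
    simp only [b, a₁, this, if_false]
    exact (haa x).symm
  have hw2 : ∀ l : List (Fin L.length), s ∉ l →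
      (l.map fun ℓ => pairLetter (b ℓ) (a ℓ) (a₂ ℓ)) =
        ((l.map L.get).map Unitization.inr).map (umap θ) := by
    intro l hl
    rw [List.map_map, List.map_map]
    refine List.map_congr_left fun x hx => ?_
    have : x ≠ s := fun h => hl (h ▸ hx)
    simp only [b, a₂, this, if_false, Function.comp_apply]
    rw [haa x]
    unfold pairLetter
    split_ifs
    · rw [umap_inr]
      exact congrArg Unitization.inr (lift_inl _ _ _).symm
    · rw [umap_inr]
      exact congrArg Unitization.inr
        (lift_inr (inl.comp (NonUnitalAlgHom.id ℂ A)) (inr.comp inl) (a' x)).symm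
  have hsp : s ∉ p := fun h => hsnot s (List.mem_append_left _ h) rfl
  have hsq : s ∉ q := fun h => hsnot s (List.mem_append_right _ h) rfl
  have hb1 : pairLetter (b s) (a s) (a₁ s) = Unitization.inr (inr e) := by
    simp [b, a₁, pairLetter]
  have hb2 : pairLetter (b s) (a s) (a₂ s) = Unitization.inr (inr (inr g)) := by
    simp [b, a₂, pairLetter]
  rw [List.ofFn_eq_map, List.ofFn_eq_map, hpq, List.map_append, List.map_append, List.map_cons,
    List.map_cons, hw1 p hsp, hw1 q hsq, hw2 p hsp, hw2 q hsq, hb1, hb2, h1, h3, List.prod_append,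
    List.prod_append, List.prod_cons, List.prod_cons, ← map_list_prod, ← map_list_prod,
    ← mul_assoc, ← mul_assoc] at key
  rw [key]
  -- After regrouping, `g` is the only element of the last factor, so `Positive.prod_insert` removes
  -- it from the full word.
  have hassoc := uext_prod_assoc (P := P) φ ψ τ
    (umap inl (X.map (Unitization.inr : A.coprod B → Unitization ℂ (A.coprod B))).prod *
      Unitization.inr (inr g) *
      umap inl (Y.map (Unitization.inr : A.coprod B → Unitization ℂ (A.coprod B))).prod)
  rw [hP.prod_insert (P.prod φ ψ) τ hν hg, hτ, mul_one, map_mul (umap _), map_mul (umap _),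
    ← umap_comp_apply, ← umap_comp_apply, umap_inr] at hassoc
  rw [← hassoc]
  have e5 : (assoc A B E).comp inl = θ :=
    coprod_hom_ext (fun x => by simp [assoc, θ, map]) fun x => by simp [assoc, θ, map]
  have e6 : assoc A B E (inr g) = inr (inr g) := lift_inr _ _ _
  rw [e5, e6]

/-- Units of faces can be inserted in any place without changing the product functional, those of
the first factor by symmetry. Differences of units therefore vanish in every context, and insertion
into the empty word gives the value `1`. -/
theorem Positive.unitPreserving (hP : P.Positive) (hsymm : P.Symmetric)
    (hν : ∀ p c q, P.nestCoeff p c q = 1) : P.UnitPreserving := by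
  intro A₁ A₂ e₁ e₂ he₁ he₂ φ₁ φ₂ h₁ h₁' h₂ h₂' E
  have hE : ∀ i c, ∀ X Y : Unitization ℂ (A₁.coprod A₂),
      uext (P.prod φ₁ φ₂) (X * Unitization.inr (E i c) * Y) = uext (P.prod φ₁ φ₂) (X * Y) := by
    intro i c X Y
    fin_cases i
    · change uext (P.prod φ₁ φ₂) (X * Unitization.inr (inl (e₁ c)) * Y) = _
      rw [hsymm.uext_prod_swap φ₁ φ₂ (X * Unitization.inr (inl (e₁ c)) * Y),
        hsymm.uext_prod_swap φ₁ φ₂ (X * Y), map_mul (umap _), map_mul (umap _),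
        map_mul (umap _), umap_inr]
      have : swap A₁ A₂ (inl (e₁ c)) = inr (e₁ c) := lift_inl _ _ _
      rw [this]
      exact hP.prod_insert_unit (fun p q => hν p c q) (he₁ c).1 φ₂
        (uext_insert_unit he₁ h₁ h₁' c) _ _
    · exact hP.prod_insert_unit (fun p q => hν p c q) (he₂ c).1 φ₁
        (uext_insert_unit he₂ h₂ h₂' c) X Y
  refine ⟨fun x hx => eq_zero_of_mem_idealSpan ?_ hx, fun i c => ?_⟩
  · rintro _ ⟨i, j, c, d, rfl⟩ X Y
    rw [Unitization.inr_sub, mul_sub, sub_mul, map_sub, hE, hE, sub_self]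
  · have := hE i c 1 1
    simpa using this

end UniversalProduct

end

noncomputable section

open MultiFacedAlgebra UniversalProduct

/-! ### Multi-faced algebras with unital faces -/

namespace MultiFacedAlgebra

variable {F : Type v} {A B : MultiFacedAlgebra.{u} F}

section OneFace

variable (D : Type u) [NonUnitalRing D] [Module ℂ D] [IsScalarTower ℂ D D] [SMulCommClass ℂ D D]

open Classical in
/-- The multi-faced algebra with one nontrivial face. -/
def oneFace (c : F) : MultiFacedAlgebra.{u} F where
  carrier := D
  face d := if d = c then ⊤ else ⊥
  free R _ _ _ _ h := by
    have hmem : ∀ x : D, x ∈ (if c = c then ⊤ else ⊥ : NonUnitalSubalgebra ℂ D) := by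
      intro x
      rw [if_pos rfl]
      trivial
    refine ⟨(h c).comp (NonUnitalAlgHom.codRestrict (NonUnitalAlgHom.id ℂ D) _ hmem), ?_, ?_⟩
    · rintro d ⟨x, hx⟩
      by_cases hd : d = c
      · subst hd
        rfl
      · rw [if_neg hd] at hx
        obtain rfl : x = 0 := NonUnitalAlgebra.mem_bot.1 hx
        exact (map_zero _).trans (map_zero (h d)).symm
    · intro H hH
      exact NonUnitalAlgHom.ext fun x => hH c ⟨x, hmem x⟩

variable {D}

open Classical in
theorem mem_oneFace {c d : F} (h : d = c) (x : D) : x ∈ (oneFace D c).face d := by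
  change x ∈ (if d = c then ⊤ else ⊥ : NonUnitalSubalgebra ℂ D)
  rw [if_pos h]
  trivial

open Classical in
theorem eq_zero_of_mem_oneFace {c d : F} (h : d ≠ c) {x : D} (hx : x ∈ (oneFace D c).face d) :
    x = 0 := by
  change x ∈ (if d = c then ⊤ else ⊥ : NonUnitalSubalgebra ℂ D) at hx
  rw [if_neg h] at hx
  exact NonUnitalAlgebra.mem_bot.1 hx

end OneFace

theorem isFaceUnit_of_adjoin {c : F} {S : Set A} (hS : A.face c = NonUnitalAlgebra.adjoin ℂ S)
    {e : A} (he : e ∈ A.face c) (h : ∀ x ∈ S, e * x = x ∧ x * e = x) : A.IsFaceUnit c e := by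
  refine ⟨he, fun x hx => ?_⟩
  rw [hS] at hx
  induction hx using NonUnitalAlgebra.adjoin_induction with
  | mem x hx => exact h x hx
  | add x y _ _ hx hy => rw [mul_add, add_mul, hx.1, hx.2, hy.1, hy.2]; exact ⟨rfl, rfl⟩
  | zero => simp
  | mul x y _ _ hx hy => rw [← mul_assoc, hx.1, mul_assoc, hy.2]; exact ⟨rfl, rfl⟩
  | smul z x _ hx => rw [mul_smul_comm, smul_mul_assoc, hx.1, hx.2]; exact ⟨rfl, rfl⟩

theorem IsFaceUnit.coprod_left {c : F} {e : A} (he : A.IsFaceUnit c e)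
    (hB : ∀ x ∈ B.face c, x = 0) : (A.coprod B).IsFaceUnit c (inl e) := by
  refine isFaceUnit_of_adjoin rfl (isMultiFaced_inl c e he.1) ?_
  rintro _ (⟨a, ha, rfl⟩ | ⟨b, hb, rfl⟩)
  · change inl e * inl a = inl a ∧ inl a * inl e = inl a
    rw [← map_mul, ← map_mul, (he.2 a ha).1, (he.2 a ha).2]
    exact ⟨rfl, rfl⟩
  · change inl e * inr b = inr b ∧ inr b * inl e = inr b
    rw [hB b hb, map_zero]
    simp

theorem IsFaceUnit.coprod_right {c : F} {e : B} (he : B.IsFaceUnit c e)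
    (hA : ∀ x ∈ A.face c, x = 0) : (A.coprod B).IsFaceUnit c (inr e) := by
  refine isFaceUnit_of_adjoin rfl (isMultiFaced_inr c e he.1) ?_
  rintro _ (⟨a, ha, rfl⟩ | ⟨b, hb, rfl⟩)
  · change inr e * inl a = inl a ∧ inl a * inr e = inl a
    rw [hA a ha, map_zero]
    simp
  · change inr e * inr b = inr b ∧ inr b * inr e = inr b
    rw [← map_mul, ← map_mul, (he.2 b hb).1, (he.2 b hb).2]
    exact ⟨rfl, rfl⟩

theorem eq_zero_of_mem_iterCoprod {c : F} (k : ℕ) (A : Fin (k + 1) → MultiFacedAlgebra.{u} F)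
    (hA : ∀ κ, ∀ x ∈ (A κ).face c, x = 0) : ∀ x ∈ (iterCoprod k A).face c, x = 0 := by
  induction k with
  | zero => exact hA 0
  | succ k ih =>
    have h := ih (fun i => A i.succ) fun i => hA i.succ
    intro x hx
    have hx' : x ∈ (NonUnitalAlgebra.adjoin ℂ
        ((FreeProd.inl : A 0 →ₙₐ[ℂ] FreeProd (A 0) (iterCoprod k fun i => A i.succ)) ''
          (A 0).face c ∪ FreeProd.inr '' (iterCoprod k fun i => A i.succ).face c)) := hx
    have hle : NonUnitalAlgebra.adjoin ℂ
        ((FreeProd.inl : A 0 →ₙₐ[ℂ] FreeProd (A 0) (iterCoprod k fun i => A i.succ)) ''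
          (A 0).face c ∪ FreeProd.inr '' (iterCoprod k fun i => A i.succ).face c) ≤ ⊥ := by
      refine NonUnitalAlgebra.adjoin_le_iff.2 ?_
      rintro _ (⟨a, ha, rfl⟩ | ⟨b, hb, rfl⟩)
      · rw [hA 0 a ha, map_zero]; exact zero_mem _
      · rw [h b hb, map_zero]; exact zero_mem _
    exact (NonUnitalAlgebra.mem_bot (R := ℂ)
      (A := FreeProd (A 0) (iterCoprod k fun i => A i.succ))).1 (hle hx')

/-- The face of color `c` of the free product receives nothing from the other factors, whose faces
of this color are zero, so it is generated by the image of a single face. -/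
theorem IsFaceUnit.embed {c : F} {k : ℕ} {A : Fin (k + 1) → MultiFacedAlgebra.{u} F}
    {κ : Fin (k + 1)} {e : A κ} (he : (A κ).IsFaceUnit c e)
    (hA : ∀ κ', κ' ≠ κ → ∀ x ∈ (A κ').face c, x = 0) :
    (iterCoprod k A).IsFaceUnit c (embed k A κ e) := by
  induction k with
  | zero =>
    obtain rfl : κ = 0 := Fin.fin_one_eq_zero κ
    exact he
  | succ k ih =>
    revert e
    refine Fin.cases (motive := fun κ => (∀ κ', κ' ≠ κ → ∀ x ∈ (A κ').face c, x = 0) →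
      ∀ {e : A κ}, (A κ).IsFaceUnit c e → (iterCoprod (k + 1) A).IsFaceUnit c
        (MultiFacedAlgebra.embed (k + 1) A κ e)) (fun hA e he => ?_) (fun κ hA e he => ?_) κ hA
    · exact he.coprod_left (eq_zero_of_mem_iterCoprod k _ fun i => hA _ (Fin.succ_ne_zero i))
    · refine IsFaceUnit.coprod_right (ih he fun κ' hκ' => hA _ fun h => hκ' ?_)
        (hA 0 (Fin.succ_ne_zero κ).symm)
      exact Fin.succ_injective _ h

/-- A multi-faced algebra with unital faces, and a functional which identifies the units and is
centered, but not zero on squares, at an element of a given face. -/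
theorem exists_unital_faces [Finite F] (c : F) :
    ∃ (A : MultiFacedAlgebra.{u} F) (e : F → A) (φ : A →ₗ[ℂ] ℂ) (x : A),
      (∀ d, A.IsFaceUnit d (e d)) ∧ (∀ y ∈ A.idealSpan {y | ∃ d d', y = e d - e d'}, φ y = 0) ∧
        (∀ d, φ (e d) = 1) ∧ x ∈ A.face c ∧ φ x = 0 ∧ φ (x * x) = 1 := by
  obtain ⟨N, ⟨ε⟩⟩ := Finite.exists_equiv_fin F
  obtain ⟨k, rfl⟩ : ∃ k, N = k + 1 := by
    cases N with
    | zero => exact (ε c).elim0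
    | succ k => exact ⟨k, rfl⟩
  -- Functions on two points with the averaging functional `τ`: the element `(1, -1)` is centered
  -- and its square is the unit.
  let D : Type u := ULift.{u} (ℂ × ℂ)
  let τ : D →ₗ[ℂ] ℂ :=
    { toFun := fun z => (z.down.1 + z.down.2) / 2
      map_add' := fun z w => by
        change (z.down.1 + w.down.1 + (z.down.2 + w.down.2)) / 2 = _
        ring
      map_smul' := fun t z => by
        change (t * z.down.1 + t * z.down.2) / 2 = t * _
        ring }
  let A : Fin (k + 1) → MultiFacedAlgebra.{u} F := fun κ => oneFace D (ε.symm κ)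
  let U := iterCoprod k A
  -- The free product has one copy of `D` for each color. Folding all copies onto `D` identifies
  -- their units, so its kernel contains the ideal on which `φ` has to vanish.
  let θ : U →ₙₐ[ℂ] oneFace D c := iterLift k A fun κ => NonUnitalAlgHom.id ℂ D
  have hθ : ∀ κ (z : D), θ (embed k A κ z) = z := fun κ z => iterLift_embed k A _ κ z
  let φ : U →ₗ[ℂ] ℂ := τ ∘ₗ (θ : U →ₗ[ℂ] oneFace D c)
  have hφ : ∀ y z : U, ∀ w : D, θ y * θ z = w → φ (y * z) = τ w := by
    rintro y z w rfl
    exact congrArg τ (map_mul θ y z)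
  let e : F → U := fun d => embed k A (ε d) (1 : D)
  have he : ∀ d, θ (e d) = (1 : D) := fun d => hθ _ _
  refine ⟨U, e, φ, embed k A (ε c) (⟨(1, -1)⟩ : D), fun d => ?_, fun y hy => ?_, fun d => ?_, ?_, ?_,
    ?_⟩
  · refine IsFaceUnit.embed ⟨mem_oneFace (ε.symm_apply_apply d).symm (1 : D),
      fun x _ => ⟨one_mul (M := D) x, mul_one (M := D) x⟩⟩ fun κ hκ x hx => ?_
    refine eq_zero_of_mem_oneFace (D := D) (c := ε.symm κ) (d := d) (fun h => hκ ?_) hx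
    rw [h, ε.apply_symm_apply]
  · have hle : U.idealSpan {y | ∃ d d', y = e d - e d'} ≤
        LinearMap.ker (θ : U →ₗ[ℂ] oneFace D c) := by
      refine idealSpan_le ?_ fun a x hx => ?_
      · rintro _ ⟨d, d', rfl⟩
        change θ (e d - e d') = 0
        rw [map_sub]
        exact (congrArg₂ (· - ·) (he d) (he d')).trans (sub_self (1 : D))
      · have hx' : θ x = 0 := hx
        constructor
        · change θ (a * x) = 0
          rw [map_mul, hx', mul_zero]
        · change θ (x * a) = 0
          rw [map_mul, hx', zero_mul]
    have hy' : θ y = 0 := hle hy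
    change τ (θ y) = 0
    rw [hy']
    exact map_zero τ
  · change τ (θ (e d)) = 1
    rw [he]
    change ((1 : ℂ) + 1) / 2 = 1
    norm_num
  · exact isMultiFaced_embed k A (ε c) c _
      (mem_oneFace (ε.symm_apply_apply c).symm (⟨(1, -1)⟩ : D))
  · change τ (θ _) = 0
    rw [hθ]
    change ((1 : ℂ) + -1) / 2 = 0
    norm_num
  · rw [hφ _ _ (⟨(1, 1)⟩ : D)]
    · change ((1 : ℂ) + 1) / 2 = 1
      norm_num
    · rw [hθ]
      change (⟨((1 : ℂ) * 1, (-1 : ℂ) * -1)⟩ : D) = ⟨(1, 1)⟩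
      norm_num

end MultiFacedAlgebra

/-! ### From unit preservation to nesting coefficients -/

namespace UniversalProduct

variable {F : Type v} {P : UniversalProduct.{u} F}

/-- The element `x (e₂ - e₁) x` lies in the ideal of unit differences. Its first part has the value
`ν φ(x²)` by `Positive.prod_nest`; in the second part `e₁` is the unit of the face of `x`, which
leaves `φ(x²) = 1`. This settles equal colors, and `Positive.nestCoeff_congr` handles other outer
colors. -/
theorem UnitPreserving.nestCoeff_eq_one [Finite F] (h : P.UnitPreserving) (hP : P.Positive)
    (p c q : F) : P.nestCoeff p c q = 1 := by
  obtain ⟨A, e, φ, x, he, hφ, hφ1, hx, hφx, hφxx⟩ := exists_unital_faces.{u} c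
  have h1 := (h A A e e he he φ φ hφ hφ1 hφ hφ1).1
  have h2 : P.prod φ φ (inl x * (inr (e c) - inl (e c)) * inl x) = 0 := by
    refine h1 _ (mul_mem_idealSpan (mul_mem_idealSpan ?_ _).1 _).2
    exact subset_idealSpan _ ⟨1, 0, c, c, rfl⟩
  have h3 := hP.prod_nest φ φ hx hx (he c).1 hφx hφx
  rw [← Unitization.inr_mul, ← Unitization.inr_mul, uext_inr, hφxx, hφ1, one_mul, mul_one] at h3
  rw [mul_sub, sub_mul, map_sub, h3, ← map_mul, ← map_mul, P.restrict_left, ((he c).2 x hx).2, hφxx,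
    sub_eq_zero] at h2
  rw [← h2]
  exact hP.nestCoeff_congr c p q c c

end UniversalProduct

end

/-! ### The equivalence -/

theorem theorem9p6 {F : Type v} [Finite F] (P : UniversalProduct.{u} F)
    (hpos : P.Positive) (hsymm : P.Symmetric) :
    ∃ w : Weights F,
      (P.HasHighestCoefficients w ∧ ∀ w', P.HasHighestCoefficients w' → w' = w) ∧
      ∃ ν : F → ℂ, (∀ p c q : F, w 2 ![p, c, q] nestPartition = ν c) ∧
        List.TFAE [P.UnitPreserving, ∀ c, ν c = 1, w.SingletonInductive] := by
  have hν : ∀ p c q, P.nestCoeff p c q = P.nestCoeff c c c := fun p c q =>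
    hpos.nestCoeff_congr c p q c c
  refine ⟨P.highestCoeff, ⟨hpos.hasHighestCoefficients hsymm, fun w' hw' => hw'.eq_highestCoeff⟩,
    fun c => P.nestCoeff c c c, fun p c q => ?_, ?_⟩
  · rw [hsymm.highestCoeff_nestPartition, hν]
  · tfae_have 1 → 2 := fun h c => h.nestCoeff_eq_one hpos c c c
    tfae_have 2 → 3 := fun h => hpos.singletonInductive hsymm fun p c q => (hν p c q).trans (h c)
    tfae_have 3 → 2 := fun h c => hsymm.nestCoeff_eq_one h c c c
    tfae_have 2 → 1 := fun h => hpos.unitPreserving hsymm fun p c q => (hν p c q).trans (h c)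
    tfae_finish
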